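/- **Setting.** Let $\mathcal G$ be an undirected graph without loops on $\mathcal V=\{1,\dots,L\}$, with neighbour sets $\mathcal N_i$. Consider subsystems $$x_i(k+1)=A_ix_i(k)+\sum_{j\in\mathcal N_i}A_{ij}x_j(k)+B_iu_i(k)+w_i(k),\qquad y_i=C_ix_i,\qquad z_i=C_i^zx_i+\sum_{j\in\mathcal N_i}C^z_{ij}x_j+D_i^zu_i,$$ with $x_i,w_i\in\mathbb R^{n_i}$, $u_i\in\mathbb R^{m_i}$, $A_{\mathcal N_i}=\operatorname{row}_{j\in\mathcal N_i}A_{ij}$, $C^z_{\mathcal N_i}=\operatorname{row}_{j\in\mathcal N_i}C^z_{ij}$. The output matrices are known; $(A_i,A_{\mathcal N_i},B_i)$ is unknown. Given are data $X_i=[x_i(0)\cdots x_i(N)]$, $U_i^-=[u_i(0)\cdots u_i(N-1)]$; put $X_i^-=[x_i(0)\cdots x_i(N-1)]$, $X_i^+=[x_i(1)\cdots x_i(N)]$, $X_{\mathcal N_i}^-=\operatorname{col}_{j\in\mathcal N_i}X_j^-$. Let $\Pi_i=\begin{bmatrix}Q_w^i&S_w^i\\(S_w^i)^\top&R_w^i\end{bmatrix}$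 be symmetric with $Q_w^i<0$, and let $\Sigma_{\mathcal D}^i$ be the set of all $(A_i,A_{\mathcal N_i},B_i)$ with $X_i^+=A_iX_i^-+A_{\mathcal N_i}X_{\mathcal N_i}^-+B_iU_i^-+W$ for some $W$ satisfying $\begin{bmatrix}W^\top\\I\end{bmatrix}^\top\Pi_i\begin{bmatrix}W^\top\\I\end{bmatrix}\ge0$. Assume that $\operatorname{col}(X_i^-,X_{\mathcal N_i}^-,U_i^-)$ has full row rank and that $$\begin{bmatrix}\bar Q_{\mathcal D}^i&\bar S_{\mathcal D}^i\\(\bar S_{\mathcal D}^i)^\top&\bar R_{\mathcal D}^i\end{bmatrix}:=F_i\Pi_iF_i^\top,\qquad F_i=\begin{bmatrix}X_i^-&0\\X_{\mathcal N_i}^-&0\\U_i^-&0\\X_i^+&I\end{bmatrix},$$ is invertible; write $\begin{bmatrix}Q_{\mathcal D}^i&S_{\mathcal D}^i\\(S_{\mathcal D}^i)^\top&R_{\mathcal D}^i\end{bmatrix}$ for its inverse. (The blocks of both matrices have sizes $n_i+\sum_{j\in\mathcal N_i}n_j+m_i$ and $n_i$.) **Scales.** For symmetric $X_{ij}^{11}\in\mathbb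 R^{n_i\times n_i}$ and arbitrary $X_{ij}^{12}\in\mathbb R^{n_i\times n_j}$ let, with $j$ running over $\mathcal N_i$, $Z_i^{11}=-\operatorname{diag}_jX_{ij}^{11}$, $Z_i^{22}=\operatorname{diag}_jX_{ji}^{11}$, $Z_i^{12}=\operatorname{diag}\big(-\operatorname{diag}_{j\le i}X_{ij}^{12},\operatorname{diag}_{j>i}(X_{ji}^{12})^\top\big)$, $Z_i=\begin{bmatrix}Z_i^{11}&Z_i^{12}\\(Z_i^{12})^\top&Z_i^{22}\end{bmatrix}$; define $\bar Z_i$ in the same way from matrices $\bar X_{ij}^{11}$ (symmetric), $\bar X_{ij}^{12}$. **Matrices.** Let $\mathbf 1\otimes I$ be the stack of $|\mathcal N_i|$ copies of $I_{n_i}$, and let $$M_i=\begin{bmatrix}I&0&0&0\\0&0&I&I\\\mathbf 1\otimes I&0&0&0\\0&I&0&0\\0&0&I&0\\E_1&E_2&0&0\\0&0&0&I\\C_i^z&C^z_{\mathcal N_i}&0&0\end{bmatrix},\qquad E_1=\begin{bmatrix}I\\0\\0\end{bmatrix},\ E_2=\begin{bmatrix}0\\I\\0\end{bmatrix},$$ with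 columns $(x_i,\operatorname{col}_{j\in\mathcal N_i}x_j,l_i,w_i)$. Let $M_i^\perp$ be the basis matrix of $\ker M_i^\top$ whose block rows 2, 3, 6 and 8 together form the identity. Let $\mathcal M_i(P,Z,a,D,g)$, for $D=\begin{bmatrix}Q&S\\S^\top&R\end{bmatrix}$, be the block diagonal matrix with diagonal blocks $-P$, $P$, $Z$, $\begin{bmatrix}-aR&-aS^\top\\-aS&-aQ\end{bmatrix}$, $-gI$, $I$. Let the columns of $\Psi_i$ be a basis of $\ker\begin{bmatrix}C_i&0&0&0\end{bmatrix}$, and those of $\Phi_i$ a basis of $\ker\begin{bmatrix}0&I&(D_i^z)^\top\end{bmatrix}$, where, in the coordinates of rows 2, 3, 6, 8 of $M_i$, $I$ acts on the last $m_i$ entries of row 6 and $(D_i^z)^\top$ on row 8. **Controllers.** A distributed controller consists of matrices $\Theta_i$ with $$\begin{bmatrix}\xi_i(k+1)\\o_i(k)\\u_i(k)\end{bmatrix}=\Theta_i\begin{bmatrix}\xi_i(k)\\s_i(k)\\y_i(k)\end{bmatrix},\quad \xi_i\in\mathbb R^{n_i},\quad o_i=\operatorname{col}_{j\in\mathcal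 N_i}o_{ij},\quad s_i=\operatorname{col}_{j\in\mathcal N_i}s_{ij},\quad s_{ij}=o_{ji}\in\mathbb R^{n_{ij}},$$ where $n_{ij}=n_{ji}=3\max(n_i,n_j)$ (so $n_{ij}=3n_i$ if $n_i=n_j$). It is well posed if these equations determine all $o_i$ uniquely from all $\xi_i$ and $y_i$. **Proposition.** Let $\gamma>0$. Suppose there are $P_i$, $\bar P_i$, scales $Z_i$, $\bar Z_i$ as above and $\alpha_i$ such that for all $i\in\mathcal V$, with $\beta_i=\alpha_i^{-1}$: $P_i>0$, $\bar P_i>0$, $\alpha_i>0$, $$\Psi_i^\top M_i^\top\,\mathcal M_i\!\left(P_i,Z_i,\alpha_i,\begin{bmatrix}Q_{\mathcal D}^i&S_{\mathcal D}^i\\(S_{\mathcal D}^i)^\top&R_{\mathcal D}^i\end{bmatrix},\gamma^2\right)M_i\Psi_i<0,$$ $$\Phi_i^\top (M_i^\perp)^\top\,\mathcal M_i\!\left(\bar P_i,\bar Z_i,\beta_i,\begin{bmatrix}\bar Q_{\mathcal D}^i&\bar S_{\mathcal D}^i\\(\bar S_{\mathcal D}^i)^\top&\bar R_{\mathcal D}^i\end{bmatrix},\gamma^{-2}\right)M_i^\perp\Phi_i>0,\qquad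 \begin{bmatrix}P_i&I\\I&\bar P_i\end{bmatrix}\ge0.$$ Then there is a well-posed distributed controller $(\Theta_i)_{i\in\mathcal V}$ such that for every choice of $(A_i,A_{\mathcal N_i},B_i)\in\Sigma_{\mathcal D}^i$, $i\in\mathcal V$, the closed loop is asymptotically stable and the $\mathcal H_\infty$ norm (the supremum over $|q|>1$ of the largest singular value) of its transfer matrix from $w=\operatorname{col}_iw_i$ to $z=\operatorname{col}_iz_i$ is less than $\gamma$. -/

import Mathlib

open Matrix

noncomputable section

namespace DistCtrl

/-! ### The network, its subsystems and its signals -/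

/-- The graph (undirected, without loops) on the vertices `1, …, L`, and the dimensions of the
state `x_i` (also of the noise `w_i`), input `u_i`, measured output `y_i` and performance output
`z_i` of each subsystem. -/
structure Network (L : ℕ) where
  graph : SimpleGraph (Fin L)
  decAdj : DecidableRel graph.Adj
  n : Fin L → ℕ
  m : Fin L → ℕ
  p : Fin L → ℕ
  r : Fin L → ℕ

attribute [instance] Network.decAdj

variable {L : ℕ}

/-- The neighbours of vertex `i`. -/
abbrev Nbr (S : Network L) (i : Fin L) : Type := {j : Fin L // S.graph.Adj i j}

/-- Index type of `col_{j ∈ N_i} x_j`. -/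
abbrev NbrX (S : Network L) (i : Fin L) : Type := Σ j : Nbr S i, Fin (S.n j.1)

/-- Index type of `col_{j ∈ N_i} x_i`, one copy of the own state for each neighbour. -/
abbrev OwnX (S : Network L) (i : Fin L) : Type := Σ _ : Nbr S i, Fin (S.n i)

/-- Index type of `col (x_i, col_{j ∈ N_i} x_j, u_i)`. -/
abbrev RegIdx (S : Network L) (i : Fin L) : Type := Fin (S.n i) ⊕ (NbrX S i ⊕ Fin (S.m i))

/-- The matrices `(A_i, A_{N_i}, B_i)` of a subsystem, with `A_{N_i} = row_{j ∈ N_i} A_ij`. -/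
structure Subsystem (S : Network L) (i : Fin L) where
  A : Matrix (Fin (S.n i)) (Fin (S.n i)) ℝ
  AN : Matrix (Fin (S.n i)) (NbrX S i) ℝ
  B : Matrix (Fin (S.n i)) (Fin (S.m i)) ℝ

/-- The output matrices of a subsystem: `y_i = C x_i` and
`z_i = Cz x_i + CzN col_{j ∈ N_i} x_j + Dz u_i`. -/
structure Outputs (S : Network L) (i : Fin L) where
  C : Matrix (Fin (S.p i)) (Fin (S.n i)) ℝ
  Cz : Matrix (Fin (S.r i)) (Fin (S.n i)) ℝ
  CzN : Matrix (Fin (S.r i)) (NbrX S i) ℝ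
  Dz : Matrix (Fin (S.r i)) (Fin (S.m i)) ℝ

/-! ### Data, noise and the set of data-consistent subsystems -/

/-- Input-state data: `X i = [x_i(0) ⋯ x_i(N)]` and `U i = [u_i(0) ⋯ u_i(N-1)]`. -/
structure Data (S : Network L) (N : ℕ) where
  X : (i : Fin L) → Matrix (Fin (S.n i)) (Fin (N + 1)) ℝ
  U : (i : Fin L) → Matrix (Fin (S.m i)) (Fin N) ℝ

/-- The coefficient blocks of the quadratic noise bound of subsystem `i`. -/
structure NoiseModel (S : Network L) (N : ℕ) (i : Fin L) where
  Qw : Matrix (Fin N) (Fin N) ℝ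
  Sw : Matrix (Fin N) (Fin (S.n i)) ℝ
  Rw : Matrix (Fin (S.n i)) (Fin (S.n i)) ℝ

variable {S : Network L} {N : ℕ}

/-- `X_i^- = [x_i(0) ⋯ x_i(N-1)]`. -/
def Data.Xm (d : Data S N) (i : Fin L) : Matrix (Fin (S.n i)) (Fin N) ℝ :=
  (d.X i).submatrix id Fin.castSucc

/-- `X_i^+ = [x_i(1) ⋯ x_i(N)]`. -/
def Data.Xp (d : Data S N) (i : Fin L) : Matrix (Fin (S.n i)) (Fin N) ℝ :=
  (d.X i).submatrix id Fin.succ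

/-- `X_{N_i}^- = col_{j ∈ N_i} X_j^-`. -/
def Data.XN (d : Data S N) (i : Fin L) : Matrix (NbrX S i) (Fin N) ℝ :=
  Matrix.of fun a t => d.Xm a.1.1 a.2 t

/-- `col (X_i^-, X_{N_i}^-, U_i^-)`. -/
def Data.reg (d : Data S N) (i : Fin L) : Matrix (RegIdx S i) (Fin N) ℝ :=
  fromRows (d.Xm i) (fromRows (d.XN i) (d.U i))

/-- The matrix `[[Qw, Sw], [Swᵀ, Rw]]` of the noise bound. -/
def NoiseModel.mat {i : Fin L} (ν : NoiseModel S N i) :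
    Matrix (Fin N ⊕ Fin (S.n i)) (Fin N ⊕ Fin (S.n i)) ℝ :=
  fromBlocks ν.Qw ν.Sw ν.Swᵀ ν.Rw

/-- `[Wᵀ; I]`. -/
def noiseFactor {i : Fin L} (W : Matrix (Fin (S.n i)) (Fin N) ℝ) :
    Matrix (Fin N ⊕ Fin (S.n i)) (Fin (S.n i)) ℝ :=
  fromRows Wᵀ 1

/-- The set of admissible noise matrices `W`:
`[Wᵀ; I]ᵀ [[Qw, Sw], [Swᵀ, Rw]] [Wᵀ; I] ≥ 0`. -/
def NoiseModel.noiseSet {i : Fin L} (ν : NoiseModel S N i) :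
    Set (Matrix (Fin (S.n i)) (Fin N) ℝ) :=
  {W | ((noiseFactor W)ᵀ * ν.mat * noiseFactor W).PosSemidef}

/-- The set of subsystems `(A_i, A_{N_i}, B_i)` that are consistent with the data. -/
def consistent (d : Data S N) {i : Fin L} (ν : NoiseModel S N i) : Set (Subsystem S i) :=
  {M | ∃ W ∈ ν.noiseSet, d.Xp i = M.A * d.Xm i + M.AN * d.XN i + M.B * d.U i + W}

/-- `[[X_i^-, 0], [X_{N_i}^-, 0], [U_i^-, 0], [X_i^+, I]]`. -/
def dataFactor (d : Data S N) (i : Fin L) :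
    Matrix (RegIdx S i ⊕ Fin (S.n i)) (Fin N ⊕ Fin (S.n i)) ℝ :=
  fromBlocks (d.reg i) 0 (d.Xp i) 1

/-- `[[Q̄_D, S̄_D], [S̄_Dᵀ, R̄_D]]`. -/
def dataBar (d : Data S N) {i : Fin L} (ν : NoiseModel S N i) :
    Matrix (RegIdx S i ⊕ Fin (S.n i)) (RegIdx S i ⊕ Fin (S.n i)) ℝ :=
  dataFactor d i * ν.mat * (dataFactor d i)ᵀ

/-- `[[Q_D, S_D], [S_Dᵀ, R_D]]`, the inverse of `dataBar`. -/
def dataMat (d : Data S N) {i : Fin L} (ν : NoiseModel S N i) :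
    Matrix (RegIdx S i ⊕ Fin (S.n i)) (RegIdx S i ⊕ Fin (S.n i)) ℝ :=
  (dataBar d ν)⁻¹

/-- From `[[Q, S], [Sᵀ, R]]` to `[[-a R, -a Sᵀ], [-a S, -a Q]]`. -/
def flipScale {i : Fin L} (a : ℝ)
    (D : Matrix (RegIdx S i ⊕ Fin (S.n i)) (RegIdx S i ⊕ Fin (S.n i)) ℝ) :
    Matrix (Fin (S.n i) ⊕ RegIdx S i) (Fin (S.n i) ⊕ RegIdx S i) ℝ :=
  fromBlocks (-(a • D.toBlocks₂₂)) (-(a • D.toBlocks₁₂ᵀ))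
    (-(a • D.toBlocks₁₂)) (-(a • D.toBlocks₁₁))

/-! ### Interconnection scales -/

/-- The matrices `X_ij^{11}` and `X_ij^{12}` that define the scales `Z_i`. -/
structure Scales (S : Network L) where
  X11 : (i j : Fin L) → Matrix (Fin (S.n i)) (Fin (S.n i)) ℝ
  X12 : (i j : Fin L) → Matrix (Fin (S.n i)) (Fin (S.n j)) ℝ

/-- `Z_i^{11} = - diag_j X_ij^{11}`. -/
def Scales.Z11 (X : Scales S) (i : Fin L) : Matrix (OwnX S i) (OwnX S i) ℝ :=
  -blockDiagonal' fun j : Nbr S i => X.X11 i j.1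

/-- `Z_i^{22} = diag_j X_ji^{11}`. -/
def Scales.Z22 (X : Scales S) (i : Fin L) : Matrix (NbrX S i) (NbrX S i) ℝ :=
  blockDiagonal' fun j : Nbr S i => X.X11 j.1 i

/-- `Z_i^{12} = diag (- diag_{j ≤ i} X_ij^{12}, diag_{j > i} (X_ji^{12})ᵀ)`. -/
def Scales.Z12 (X : Scales S) (i : Fin L) : Matrix (OwnX S i) (NbrX S i) ℝ :=
  blockDiagonal' fun j : Nbr S i => if j.1 ≤ i then -X.X12 i j.1 else (X.X12 j.1 i)ᵀ

/-- `Z_i = [[Z_i^{11}, Z_i^{12}], [(Z_i^{12})ᵀ, Z_i^{22}]]`. -/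
def Scales.Z (X : Scales S) (i : Fin L) :
    Matrix (OwnX S i ⊕ NbrX S i) (OwnX S i ⊕ NbrX S i) ℝ :=
  fromBlocks (X.Z11 i) (X.Z12 i) (X.Z12 i)ᵀ (X.Z22 i)

/-! ### The matrices in the two linear matrix inequalities -/

/-- Index type of the column variables `(x_i, col_j x_j, l_i, w_i)` of the primal inequality. -/
abbrev InIdx (S : Network L) (i : Fin L) : Type :=
  Fin (S.n i) ⊕ (NbrX S i ⊕ (Fin (S.n i) ⊕ Fin (S.n i)))

/-- Index type of the column variables `(x_i^+, 1 ⊗ x_i, p_i, z_i)` of the dual inequality. -/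
abbrev OutIdx (S : Network L) (i : Fin L) : Type :=
  Fin (S.n i) ⊕ (OwnX S i ⊕ (RegIdx S i ⊕ Fin (S.r i)))

/-- Row index type of the outer factors,
`(x_i, x_i^+ | 1 ⊗ x_i, col_j x_j | l_i, p_i | w_i, z_i)`. -/
abbrev MidIdx (S : Network L) (i : Fin L) : Type :=
  (Fin (S.n i) ⊕ Fin (S.n i)) ⊕ ((OwnX S i ⊕ NbrX S i) ⊕
    ((Fin (S.n i) ⊕ RegIdx S i) ⊕ (Fin (S.n i) ⊕ Fin (S.r i))))

/-- The block diagonal middle matrix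
`diag (-P, P, Z, [[-a R, -a Sᵀ], [-a S, -a Q]], -g I, I)`. -/
def middle {i : Fin L} (P : Matrix (Fin (S.n i)) (Fin (S.n i)) ℝ)
    (Z : Matrix (OwnX S i ⊕ NbrX S i) (OwnX S i ⊕ NbrX S i) ℝ) (a : ℝ)
    (D : Matrix (RegIdx S i ⊕ Fin (S.n i)) (RegIdx S i ⊕ Fin (S.n i)) ℝ) (g : ℝ) :
    Matrix (MidIdx S i) (MidIdx S i) ℝ :=
  fromBlocks (fromBlocks (-P) 0 0 P) 0 0
    (fromBlocks Z 0 0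
      (fromBlocks (flipScale a D) 0 0 (fromBlocks (-(g • 1)) 0 0 1)))

/-- `1 ⊗ I`, the map from `x_i` to one copy of `x_i` for each neighbour. -/
def onesKron (S : Network L) (i : Fin L) : Matrix (OwnX S i) (Fin (S.n i)) ℝ :=
  Matrix.of fun a b => if a.2 = b then 1 else 0

/-- A matrix with the four column blocks of `InIdx`. -/
def inRow {i : Fin L} {ρ : Type} (a : Matrix ρ (Fin (S.n i)) ℝ) (b : Matrix ρ (NbrX S i) ℝ)
    (c : Matrix ρ (Fin (S.n i)) ℝ) (e : Matrix ρ (Fin (S.n i)) ℝ) : Matrix ρ (InIdx S i) ℝ :=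
  fromCols a (fromCols b (fromCols c e))

/-- A matrix with the four column blocks of `OutIdx`. -/
def outRow {i : Fin L} {ρ : Type} (a : Matrix ρ (Fin (S.n i)) ℝ) (b : Matrix ρ (OwnX S i) ℝ)
    (c : Matrix ρ (RegIdx S i) ℝ) (e : Matrix ρ (Fin (S.r i)) ℝ) : Matrix ρ (OutIdx S i) ℝ :=
  fromCols a (fromCols b (fromCols c e))

/-- The outer factor of the primal inequality. -/
def outer {i : Fin L} (O : Outputs S i) : Matrix (MidIdx S i) (InIdx S i) ℝ :=
  fromRows
    (fromRows
      (inRow 1 0 0 0)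
      (inRow 0 0 1 1))
    (fromRows
      (fromRows
        (inRow (onesKron S i) 0 0 0)
        (inRow 0 1 0 0))
      (fromRows
        (fromRows
          (inRow 0 0 1 0)
          (inRow (fromRows 1 (fromRows 0 0)) (fromRows 0 (fromRows 1 0)) 0 0))
        (fromRows
          (inRow 0 0 0 1)
          (inRow O.Cz O.CzN 0 0))))

/-- The outer factor of the dual inequality: the basis matrix of `ker (outer O)ᵀ`, the orthogonal
complement of the image of `outer O`, in which the rows `x_i^+`, `1 ⊗ x_i`, `p_i`, `z_i` carry the
identity. -/
def outerPerp {i : Fin L} (O : Outputs S i) : Matrix (MidIdx S i) (OutIdx S i) ℝ :=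
  fromRows
    (fromRows
      (outRow 0 (-(onesKron S i)ᵀ) (fromCols (-1) (fromCols 0 0)) (-O.Czᵀ))
      (outRow 1 0 0 0))
    (fromRows
      (fromRows
        (outRow 0 1 0 0)
        (outRow 0 0 (fromCols 0 (fromCols (-1) 0)) (-O.CzNᵀ)))
      (fromRows
        (fromRows
          (outRow (-1) 0 0 0)
          (outRow 0 0 1 0))
        (fromRows
          (outRow (-1) 0 0 0)
          (outRow 0 0 0 1))))

/-- The columns of `K` form a basis of the kernel of `M`. -/
def IsKerBasis {α β δ : Type} [Fintype β] (M : Matrix α β ℝ) (K : Matrix β δ ℝ) : Prop :=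
  LinearIndependent ℝ K.col ∧ Submodule.span ℝ (Set.range K.col) = LinearMap.ker M.mulVecLin

/-- `[C_i  0]`, acting on `(x_i, col_j x_j, l_i, w_i)`. -/
def measMat {i : Fin L} (O : Outputs S i) : Matrix (Fin (S.p i)) (InIdx S i) ℝ :=
  inRow O.C 0 0 0

/-- `[0  I  (D_i^z)ᵀ]`, acting on `(x_i^+, 1 ⊗ x_i, p_i, z_i)`; the identity acts on the component
of `p_i` that belongs to `u_i`. -/
def actMat {i : Fin L} (O : Outputs S i) : Matrix (Fin (S.m i)) (OutIdx S i) ℝ :=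
  outRow 0 0 (fromCols 0 (fromCols 0 1)) O.Dzᵀ

/-! ### Distributed controllers and the closed loop -/

/-- Dimension of the controller interconnection signals on the edge between `i` and `j`, in both
directions; it is `3 n_i` if `n_i = n_j`. -/
def chan (S : Network L) (i j : Fin L) : ℕ := 3 * max (S.n i) (S.n j)

/-- Index type of `o_i = col_{j ∈ N_i} o_ij`. -/
abbrev OIdx (S : Network L) (i : Fin L) : Type := Σ j : Nbr S i, Fin (chan S i j.1)

/-- Index type of `s_i = col_{j ∈ N_i} s_ij`. -/
abbrev SIdx (S : Network L) (i : Fin L) : Type := Σ j : Nbr S i, Fin (chan S j.1 i)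

/-- A distributed controller: for each `i` the matrix `Θ_i` of the map
`(ξ_i(k), s_i(k), y_i(k)) ↦ (ξ_i(k+1), o_i(k), u_i(k))`, where `ξ_i` has dimension `n_i`. -/
abbrev Controller (S : Network L) : Type :=
  (i : Fin L) → Matrix (Fin (S.n i) ⊕ (OIdx S i ⊕ Fin (S.m i)))
    (Fin (S.n i) ⊕ (SIdx S i ⊕ Fin (S.p i))) ℝ

/-- Index type of the stacked state `x = col (x_1, …, x_L)`, also of `w` and of `ξ`. -/
abbrev XAll (S : Network L) : Type := Σ i : Fin L, Fin (S.n i)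
/-- Index type of the stacked input. -/
abbrev UAll (S : Network L) : Type := Σ i : Fin L, Fin (S.m i)
/-- Index type of the stacked measured output. -/
abbrev YAll (S : Network L) : Type := Σ i : Fin L, Fin (S.p i)
/-- Index type of the stacked performance output. -/
abbrev ZAll (S : Network L) : Type := Σ i : Fin L, Fin (S.r i)
/-- Index type of the stacked `o_i`. -/
abbrev OAll (S : Network L) : Type := Σ i : Fin L, OIdx S i
/-- Index type of the stacked `s_i`. -/
abbrev SAll (S : Network L) : Type := Σ i : Fin L, SIdx S i

/-- The map `x ↦ col_i (col_{j ∈ N_i} x_j)`. -/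
def nbrSel (S : Network L) : Matrix (Σ i : Fin L, NbrX S i) (XAll S) ℝ :=
  Matrix.of fun a b => if (⟨a.2.1.1, a.2.2⟩ : XAll S) = b then 1 else 0

/-- The map `o ↦ s` given by `s_ij = o_ji`. -/
def link (S : Network L) : Matrix (SAll S) (OAll S) ℝ :=
  Matrix.of fun a b => if (⟨a.2.1.1, ⟨⟨a.1, a.2.1.2.symm⟩, a.2.2⟩⟩ : OAll S) = b then 1 else 0

/-- State matrix of the interconnected plant. -/
def plantA (M : (i : Fin L) → Subsystem S i) : Matrix (XAll S) (XAll S) ℝ :=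
  (blockDiagonal' fun i => (M i).A) + (blockDiagonal' fun i => (M i).AN) * nbrSel S

/-- Input matrix of the interconnected plant. -/
def plantB (M : (i : Fin L) → Subsystem S i) : Matrix (XAll S) (UAll S) ℝ :=
  blockDiagonal' fun i => (M i).B

/-- `y = plantC x`. -/
def plantC (O : (i : Fin L) → Outputs S i) : Matrix (YAll S) (XAll S) ℝ :=
  blockDiagonal' fun i => (O i).C

/-- `z = plantCz x + plantDz u`. -/
def plantCz (O : (i : Fin L) → Outputs S i) : Matrix (ZAll S) (XAll S) ℝ :=
  (blockDiagonal' fun i => (O i).Cz) + (blockDiagonal' fun i => (O i).CzN) * nbrSel S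

/-- `z = plantCz x + plantDz u`. -/
def plantDz (O : (i : Fin L) → Outputs S i) : Matrix (ZAll S) (UAll S) ℝ :=
  blockDiagonal' fun i => (O i).Dz

namespace Controller

variable (Θ : Controller S)

/-- Block `ξ → ξ^+` of all `Θ_i`. -/
def xx : Matrix (XAll S) (XAll S) ℝ :=
  blockDiagonal' fun i => (Θ i).submatrix Sum.inl Sum.inl
/-- Block `s → ξ^+`. -/
def xs : Matrix (XAll S) (SAll S) ℝ :=
  blockDiagonal' fun i => (Θ i).submatrix Sum.inl fun a => Sum.inr (Sum.inl a)
/-- Block `y → ξ^+`. -/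
def xy : Matrix (XAll S) (YAll S) ℝ :=
  blockDiagonal' fun i => (Θ i).submatrix Sum.inl fun a => Sum.inr (Sum.inr a)
/-- Block `ξ → o`. -/
def ox : Matrix (OAll S) (XAll S) ℝ :=
  blockDiagonal' fun i => (Θ i).submatrix (fun a => Sum.inr (Sum.inl a)) Sum.inl
/-- Block `s → o`. -/
def os : Matrix (OAll S) (SAll S) ℝ :=
  blockDiagonal' fun i =>
    (Θ i).submatrix (fun a => Sum.inr (Sum.inl a)) fun a => Sum.inr (Sum.inl a)
/-- Block `y → o`. -/
def oy : Matrix (OAll S) (YAll S) ℝ :=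
  blockDiagonal' fun i =>
    (Θ i).submatrix (fun a => Sum.inr (Sum.inl a)) fun a => Sum.inr (Sum.inr a)
/-- Block `ξ → u`. -/
def ux : Matrix (UAll S) (XAll S) ℝ :=
  blockDiagonal' fun i => (Θ i).submatrix (fun a => Sum.inr (Sum.inr a)) Sum.inl
/-- Block `s → u`. -/
def us : Matrix (UAll S) (SAll S) ℝ :=
  blockDiagonal' fun i =>
    (Θ i).submatrix (fun a => Sum.inr (Sum.inr a)) fun a => Sum.inr (Sum.inl a)
/-- Block `y → u`. -/
def uy : Matrix (UAll S) (YAll S) ℝ :=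
  blockDiagonal' fun i =>
    (Θ i).submatrix (fun a => Sum.inr (Sum.inr a)) fun a => Sum.inr (Sum.inr a)

/-- The equations `o = ox ξ + os s + oy y`, `s = link o` have exactly one solution for all
`ξ`, `y`. -/
def WellPosed : Prop := IsUnit (1 - Θ.os * link S).det

/-- `s = loop (ox ξ + oy y)` for a well-posed controller. -/
def loop : Matrix (SAll S) (OAll S) ℝ := link S * (1 - Θ.os * link S)⁻¹

/-- The interconnected controller is `ξ^+ = KA ξ + KB y`, `u = KC ξ + KD y`. -/
def KA : Matrix (XAll S) (XAll S) ℝ := Θ.xx + Θ.xs * Θ.loop * Θ.ox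
/-- See `KA`. -/
def KB : Matrix (XAll S) (YAll S) ℝ := Θ.xy + Θ.xs * Θ.loop * Θ.oy
/-- See `KA`. -/
def KC : Matrix (UAll S) (XAll S) ℝ := Θ.ux + Θ.us * Θ.loop * Θ.ox
/-- See `KA`. -/
def KD : Matrix (UAll S) (YAll S) ℝ := Θ.uy + Θ.us * Θ.loop * Θ.oy

end Controller

/-- State matrix of the closed loop, with state `(x, ξ)`. -/
def clA (M : (i : Fin L) → Subsystem S i) (O : (i : Fin L) → Outputs S i) (Θ : Controller S) :
    Matrix (XAll S ⊕ XAll S) (XAll S ⊕ XAll S) ℝ :=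
  fromBlocks (plantA M + plantB M * Θ.KD * plantC O) (plantB M * Θ.KC)
    (Θ.KB * plantC O) Θ.KA

/-- Input matrix of the closed loop, with input `w`. -/
def clB (S : Network L) : Matrix (XAll S ⊕ XAll S) (XAll S) ℝ := fromRows 1 0

/-- Output matrix of the closed loop, with output `z`. -/
def clC (O : (i : Fin L) → Outputs S i) (Θ : Controller S) :
    Matrix (ZAll S) (XAll S ⊕ XAll S) ℝ :=
  fromCols (plantCz O + plantDz O * Θ.KD * plantC O) (plantDz O * Θ.KC)

/-! ### Stability and the `H∞` norm of discrete-time systems -/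

section Hinf

variable {α β δ : Type} [Fintype α] [DecidableEq α] [Fintype β] [DecidableEq β] [Fintype δ]

/-- All eigenvalues of `A` have modulus less than one. -/
def SchurStable (A : Matrix α α ℝ) : Prop :=
  ∀ μ ∈ spectrum ℂ (A.map (algebraMap ℝ ℂ)), ‖μ‖ < 1

/-- The transfer matrix `C (q I - A)⁻¹ B + D`. -/
def transfer (A : Matrix α α ℝ) (B : Matrix α β ℝ) (C : Matrix δ α ℝ) (D : Matrix δ β ℝ) (q : ℂ) :
    Matrix δ β ℂ :=
  C.map (algebraMap ℝ ℂ) * (q • (1 : Matrix α α ℂ) - A.map (algebraMap ℝ ℂ))⁻¹ *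
    B.map (algebraMap ℝ ℂ) + D.map (algebraMap ℝ ℂ)

/-- The `H∞` norm: the supremum over `|q| > 1` of the largest singular value of the transfer
matrix. -/
def hinfNorm (A : Matrix α α ℝ) (B : Matrix α β ℝ) (C : Matrix δ α ℝ) (D : Matrix δ β ℝ) :
    ENNReal :=
  ⨆ (q : ℂ) (_ : 1 < ‖q‖),
    ENNReal.ofReal ‖LinearMap.toContinuousLinearMap (Matrix.toEuclideanLin (transfer A B C D q))‖

/-- The system is asymptotically stable and its `H∞` norm is less than `γ`. -/
def AchievesHinf (A : Matrix α α ℝ) (B : Matrix α β ℝ) (C : Matrix δ α ℝ) (D : Matrix δ β ℝ)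
    (γ : ℝ) : Prop :=
  SchurStable A ∧ hinfNorm A B C D < ENNReal.ofReal γ

end Hinf

end DistCtrl

end

open DistCtrl

/-! ### Linear algebra: inertia, perturbation and elimination -/

section LinearAlgebra

open Module Filter Topology

/-! The argument is robust dissipativity. With Δ_i = (A_i, A_{N_i}, B_i), p_i = (x_i, x_N, u_i) and
l_i = Δ_i p_i, the dynamics read x_i^+ = l_i + w_i. For a consistent Δ_i the data matrix is
nonnegative on im [-Δ_iᵀ; I] and negative definite on the regressor coordinates. This dualizes: the
multiplier T_i built from the inverse is nonnegative on the vectors (Δ_i p, p) (`inv_nonpos_graph`).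

Suppose that Θ_i achieves, for all nonzero (x_i, x_N, l_i, w_i, ξ_i, s_i) with l_i treated as
independent, V_i(x_i^+, ξ_i^+) - V_i(x_i, ξ_i) + ∑_j G_ij + T_i(l_i, p_i) - γ²|w_i|² + |z_i|² < 0,
where V_i is positive definite and G_ij is a form in (x_i, x_j, o_ij, s_ij) that cancels against
G_ji. Summing over i removes the edge terms, and T_i ≥ 0 can be dropped, so ∑ V_i is a storage
function of the network for every consistent plant (`network_dissipation`). The bounded real lemma
(`achievesHinf_of_dissipation`) gives stability and the norm bound. At zero state and noise the same
inequality excludes nontrivial solutions of the controller loop, which is well-posedness.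

The forms V_i and G_ij are completions: they extend P_i and the edge blocks of Z_i, and their
inverses extend the barred matrices. A Schur complement construction provides them once the barred
matrix Zb and Z - Zb⁻¹ are invertible, which a small perturbation of the strict inequalities ensures
(`exists_generic_solution`). The edge forms also need prescribed numbers of positive and negative
squares; the channel dimension 3 max(n_i, n_j) leaves room for them (`exists_edge_completion`).

Finally, Θ_i comes from elimination (`exists_elimination`). The primal inequality makes the form
negative on open-loop signals with zero controller input; the dual one makes it positive on the
orthogonal complement of all signals reachable by control. A maximal negative definite subspace in
between is, by inertia, at least as large as the space of free signals. An injection of the free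
signals into it, slightly perturbed, becomes a graph over them, and this graph is a closed loop. -/

/-- An injective linear map on a submodule extends to an injective linear map on the whole space
if the target is large enough. -/
theorem exists_injective_extension {E F : Type*} [AddCommGroup E] [Module ℝ E]
    [FiniteDimensional ℝ E] [AddCommGroup F] [Module ℝ F] [FiniteDimensional ℝ F]
    (hdim : finrank ℝ E ≤ finrank ℝ F) (p : Submodule ℝ E) (f : p →ₗ[ℝ] F)
    (hf : Function.Injective f) :
    ∃ g : E →ₗ[ℝ] F, Function.Injective g ∧ ∀ x : p, g x = f x := by
  obtain ⟨q, hq⟩ := p.exists_isCompl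
  obtain ⟨r, hr⟩ := (LinearMap.range f).exists_isCompl
  have h1 := Submodule.finrank_add_eq_of_isCompl hq
  have h2 := Submodule.finrank_add_eq_of_isCompl hr
  have h3 := LinearMap.finrank_range_of_inj hf
  -- Since `p` and the range of `f` have equal dimension, the complement `q` is no larger than `r`.
  obtain ⟨k, hk⟩ := (finrank_le_iff_exists_linearMap (R := ℝ) (M := q) (M' := r)).1 (by omega)
  refine ⟨LinearMap.ofIsCompl hq f (r.subtype ∘ₗ k), ?_, fun x => ?_⟩
  · rw [← LinearMap.ker_eq_bot, LinearMap.ker_eq_bot']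
    intro x hx
    obtain ⟨a, b, rfl⟩ : ∃ (a : p) (b : q), (a : E) + b = x := by
      have hx : x ∈ p ⊔ q := by rw [hq.sup_eq_top]; trivial
      obtain ⟨a, ha, b, hb, h⟩ := Submodule.mem_sup.1 hx
      exact ⟨⟨a, ha⟩, ⟨b, hb⟩, h⟩
    rw [map_add, LinearMap.ofIsCompl_apply_left, LinearMap.ofIsCompl_apply_right] at hx
    have hx' : f a + (k b : F) = 0 := hx
    have h4 : f a ∈ LinearMap.range f ⊓ r := by
      refine ⟨⟨a, rfl⟩, ?_⟩
      rw [eq_neg_of_add_eq_zero_left hx']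
      exact r.neg_mem (k b).2
    rw [hr.inf_eq_bot, Submodule.mem_bot] at h4
    have ha : a = 0 := hf (by rw [h4, map_zero])
    rw [h4, zero_add] at hx'
    have hb : b = 0 := hk (by rw [map_zero]; exact Subtype.ext hx')
    simp [ha, hb]
  · exact LinearMap.ofIsCompl_apply_left hq x

/-- A linear map that vanishes on `ker h` factors through `h`. -/
theorem exists_factor_of_ker_le {E F G : Type*} [AddCommGroup E] [Module ℝ E]
    [AddCommGroup F] [Module ℝ F] [AddCommGroup G] [Module ℝ G]
    (h : E →ₗ[ℝ] F) (f : E →ₗ[ℝ] G) (hf : ∀ x, h x = 0 → f x = 0) :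
    ∃ k : F →ₗ[ℝ] G, ∀ x, f x = k (h x) := by
  obtain ⟨s, hs⟩ := h.rangeRestrict.exists_rightInverse_of_surjective h.range_rangeRestrict
  obtain ⟨k, hk⟩ := (f ∘ₗ s).exists_extend
  refine ⟨k, fun x => ?_⟩
  have h1 : k (h x) = f (s (h.rangeRestrict x)) :=
    LinearMap.congr_fun hk (h.rangeRestrict x)
  have h2 : h (s (h.rangeRestrict x)) = h x :=
    congrArg Subtype.val (LinearMap.congr_fun hs (h.rangeRestrict x))
  rw [h1, ← sub_eq_zero, ← map_sub]
  exact hf _ (by rw [map_sub, h2, sub_self])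

/-- Negative definiteness on the range of a linear map is stable under small perturbations. -/
theorem eventually_negDef {E V : Type*} [NormedAddCommGroup E] [NormedSpace ℝ E]
    [FiniteDimensional ℝ E] [AddCommGroup V] [Module ℝ V]
    (B : LinearMap.BilinForm ℝ V) (f g : E →ₗ[ℝ] V)
    (hf : ∀ x, x ≠ 0 → B (f x) (f x) < 0) :
    ∀ᶠ t : ℝ in 𝓝 0, ∀ x, x ≠ 0 → B (f x + t • g x) (f x + t • g x) < 0 := by
  -- `V` carries no topology, so continuity is obtained on `E` after pulling `B` back along `u` and
  -- `v`.
  have hcont : ∀ u v : E →ₗ[ℝ] V, Continuous fun x => B (u x) (v x) := by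
    intro u v
    let b : E →ₗ[ℝ] (E →L[ℝ] ℝ) :=
      (LinearMap.toContinuousLinearMap : (E →ₗ[ℝ] ℝ) ≃ₗ[ℝ] (E →L[ℝ] ℝ)).toLinearMap ∘ₗ
        (B.compl₁₂ u v)
    have hb : Continuous b := b.continuous_of_finiteDimensional
    exact hb.clm_apply continuous_id
  have key : ∀ᶠ t : ℝ in 𝓝 0, ∀ x ∈ Metric.sphere (0 : E) 1,
      B (f x + t • g x) (f x + t • g x) < 0 := by
    refine (isCompact_sphere (0 : E) 1).eventually_forall_of_forall_eventually fun x hx => ?_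
    have hc : Continuous fun z : ℝ × E =>
        B (f z.2 + z.1 • g z.2) (f z.2 + z.1 • g z.2) := by
      have : (fun z : ℝ × E => B (f z.2 + z.1 • g z.2) (f z.2 + z.1 • g z.2)) = fun z =>
          B (f z.2) (f z.2) + z.1 * B (f z.2) (g z.2) + z.1 * B (g z.2) (f z.2)
            + z.1 * (z.1 * B (g z.2) (g z.2)) := by
        funext z
        simp only [map_add, map_smul, LinearMap.add_apply, LinearMap.smul_apply, smul_eq_mul]
        ring
      rw [this]
      have h1 := (hcont f f).comp (continuous_snd (X := ℝ) (Y := E))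
      have h2 := (hcont f g).comp (continuous_snd (X := ℝ) (Y := E))
      have h3 := (hcont g f).comp (continuous_snd (X := ℝ) (Y := E))
      have h4 := (hcont g g).comp (continuous_snd (X := ℝ) (Y := E))
      exact ((h1.add (continuous_fst.mul h2)).add (continuous_fst.mul h3)).add
        (continuous_fst.mul (continuous_fst.mul h4))
    refine hc.continuousAt.eventually_lt continuousAt_const ?_
    have hx0 : x ≠ 0 := by
      rintro rfl
      simp at hx
    simpa using hf x hx0
  filter_upwards [key] with t ht x hx
  have hx' : 0 < ‖x‖ := norm_pos_iff.2 hx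
  have h := ht (‖x‖⁻¹ • x) (by simp [norm_smul, hx'.ne'])
  have e : f (‖x‖⁻¹ • x) + t • g (‖x‖⁻¹ • x) = ‖x‖⁻¹ • (f x + t • g x) := by
    rw [map_smul, map_smul, smul_add, smul_comm t]
  rw [e, map_smul, map_smul, LinearMap.smul_apply, smul_eq_mul, smul_eq_mul] at h
  by_contra hcon
  push Not at hcon
  have := mul_nonneg (inv_pos.2 hx').le (mul_nonneg (inv_pos.2 hx').le hcon)
  linarith

/-- There are only finitely many eigenvalues, so f + t is injective for all small t > 0. This serves
both the graph argument in the elimination lemma and the generic invertibility of the edge matrices.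
-/
theorem eventually_not_hasEigenvalue_neg {E : Type*} [AddCommGroup E] [Module ℝ E]
    [FiniteDimensional ℝ E] (f : E →ₗ[ℝ] E) : ∀ᶠ t : ℝ in 𝓝[>] 0, ¬ End.HasEigenvalue f (-t) := by
  have hf : ((fun t : ℝ => -t) ⁻¹' {μ | End.HasEigenvalue f μ}).Finite :=
    (End.finite_hasEigenvalue _).preimage neg_injective.injOn
  -- Zero is removed because it may itself be an eigenvalue; what remains is closed and misses 0.
  have h1 : ∀ᶠ t : ℝ in 𝓝 0, t ∉ ((fun t : ℝ => -t) ⁻¹' {μ | End.HasEigenvalue f μ}) \ {0} :=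
    (hf.subset Set.sdiff_subset).isClosed.isOpen_compl.mem_nhds (by simp)
  filter_upwards [nhdsWithin_le_nhds h1, self_mem_nhdsWithin] with t ht (ht0 : 0 < t) hev
  exact ht ⟨hev, by simpa using ht0.ne'⟩

/-- If `B` is nondegenerate, positive definite on the orthogonal complement of `W`, and negative
definite on `K ≤ W` and on some subspace of dimension `d`, then `K` is contained in a negative
definite subspace of `W` of dimension at least `d`. -/
theorem exists_negDef_between {E V : Type*} [AddCommGroup E] [Module ℝ E]
    [FiniteDimensional ℝ E] [AddCommGroup V] [Module ℝ V] [FiniteDimensional ℝ V]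
    (B : LinearMap.BilinForm ℝ V) (hs : B.IsSymm) (hnd : B.Nondegenerate)
    (W K : Submodule ℝ V) (hKW : K ≤ W) (hK : ∀ v ∈ K, v ≠ 0 → B v v < 0)
    (hW : ∀ v ∈ B.orthogonal W, v ≠ 0 → 0 < B v v)
    (J : E →ₗ[ℝ] V) (hJ : ∀ x, x ≠ 0 → B (J x) (J x) < 0) :
    ∃ M : Submodule ℝ V, K ≤ M ∧ M ≤ W ∧ (∀ v ∈ M, v ≠ 0 → B v v < 0) ∧
      finrank ℝ E ≤ finrank ℝ M := by
  obtain ⟨M, ⟨hKM, hMW, hM⟩, hmax⟩ :=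
    (wellFounded_gt (α := Submodule ℝ V)).has_min
      {M | K ≤ M ∧ M ≤ W ∧ ∀ v ∈ M, v ≠ 0 → B v v < 0} ⟨K, le_rfl, hKW, hK⟩
  refine ⟨M, hKM, hMW, hM, ?_⟩
  -- A common vector would be orthogonal to itself, against positivity on the complement.
  have hcompl : IsCompl W (B.orthogonal W) := by
    rw [LinearMap.BilinForm.isCompl_orthogonal_iff_disjoint hs.isRefl, Submodule.disjoint_def]
    intro v hv hv'
    by_contra h0
    exact (hW v hv' h0).ne' (hv' v hv)
  -- the orthogonal complement of `M` is nonnegative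
  have hnonneg : ∀ v ∈ B.orthogonal M, 0 ≤ B v v := by
    intro v hv
    obtain ⟨a, ha, b, hb, rfl⟩ : ∃ a ∈ W, ∃ b ∈ B.orthogonal W, a + b = v := by
      have : v ∈ W ⊔ B.orthogonal W := by rw [hcompl.sup_eq_top]; trivial
      exact Submodule.mem_sup.1 this
    have hab : B a b = 0 := hb a ha
    have hba : B b a = 0 := by rw [hs.eq b a]; exact hab
    have hb' : 0 ≤ B b b := by
      by_cases h0 : b = 0
      · simp [h0]
      · exact (hW b hb h0).le
    have haM : ∀ m ∈ M, B m a = 0 := by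
      intro m hm
      have h1 : B m (a + b) = 0 := hv m hm
      have h2 : B m b = 0 := hb m (hMW hm)
      rwa [map_add, h2, add_zero] at h1
    have ha' : 0 ≤ B a a := by
      by_contra hneg
      push Not at hneg
      -- A negative `a` orthogonal to `M` could be added to `M`, against maximality.
      refine hmax (M ⊔ Submodule.span ℝ {a}) ⟨hKM.trans le_sup_left, ?_, ?_⟩ ?_
      · exact sup_le hMW (by simpa using ha)
      · intro w hw hw0
        obtain ⟨m, hm, n, hn, rfl⟩ := Submodule.mem_sup.1 hw
        obtain ⟨c, rfl⟩ := Submodule.mem_span_singleton.1 hn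
        have h1 := haM m hm
        have h2 : B a m = 0 := by rw [hs.eq a m]; exact h1
        have e : B (m + c • a) (m + c • a) = B m m + c * (c * B a a) := by
          simp [h1, h2]
        rw [e]
        by_cases hm0 : m = 0
        · have hc : c ≠ 0 := by
            rintro rfl
            simp [hm0] at hw0
          have : 0 < c * c := mul_self_pos.2 hc
          simp only [hm0, map_zero]
          nlinarith
        · have := hM m hm hm0
          nlinarith [mul_self_nonneg c]
      · refine lt_of_le_of_ne le_sup_left fun h => ?_
        have : a ∈ M := by
          rw [h]
          exact Submodule.mem_sup_right (Submodule.mem_span_singleton_self a)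
        exact hneg.ne (haM a this)
    have e : B (a + b) (a + b) = B a a + B b b := by simp [hab, hba]
    rw [e]
    exact add_nonneg ha' hb'
  have hJinj : Function.Injective J := by
    rw [← LinearMap.ker_eq_bot, LinearMap.ker_eq_bot']
    intro x hx
    by_contra h0
    have := hJ x h0
    simp [hx] at this
  -- A negative definite space meets a nonnegative one only in 0, hence dim E + (dim V - dim M) ≤
  -- dim V.
  have hdisj : Disjoint (LinearMap.range J) (B.orthogonal M) := by
    rw [Submodule.disjoint_def]
    rintro _ ⟨x, rfl⟩ hv
    by_contra h0
    have hx : x ≠ 0 := by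
      rintro rfl
      simp at h0
    exact absurd (hnonneg _ hv) (not_le.2 (hJ x hx))
  have h1 := Submodule.finrank_add_finrank_le_of_disjoint hdisj
  have h2 := LinearMap.BilinForm.finrank_orthogonal hnd M
  have h3 := LinearMap.finrank_range_of_inj hJinj
  have h4 := Submodule.finrank_le M
  omega

/-- **Elimination lemma.** The graph of the open loop is the range of `ι`; `g` is the effect of the
control input and `h` the measurement. -/
theorem exists_elimination {E V R C : Type*} [NormedAddCommGroup E] [NormedSpace ℝ E]
    [FiniteDimensional ℝ E] [AddCommGroup V] [Module ℝ V] [FiniteDimensional ℝ V]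
    [AddCommGroup R] [Module ℝ R] [AddCommGroup C] [Module ℝ C]
    (B : LinearMap.BilinForm ℝ V) (hs : B.IsSymm) (hnd : B.Nondegenerate)
    (ι : E →ₗ[ℝ] V) (g : R →ₗ[ℝ] V) (h : E →ₗ[ℝ] C) (π : V →ₗ[ℝ] E)
    (hι : ∀ x, π (ι x) = x) (hg : ∀ r, π (g r) = 0)
    (hprimal : ∀ x, h x = 0 → x ≠ 0 → B (ι x) (ι x) < 0)
    (hdual : ∀ v, (∀ x, B v (ι x) = 0) → (∀ r, B v (g r) = 0) → v ≠ 0 → 0 < B v v)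
    (J : E →ₗ[ℝ] V) (hJ : ∀ x, x ≠ 0 → B (J x) (J x) < 0) :
    ∃ Θ : C →ₗ[ℝ] R, ∀ x, x ≠ 0 → B (ι x + g (Θ (h x))) (ι x + g (Θ (h x))) < 0 := by
  have hιinj : Function.Injective ι := fun x y hxy => by rw [← hι x, ← hι y, hxy]
  obtain ⟨M, hKM, hMW, hM, hdim⟩ := exists_negDef_between B hs hnd
    (LinearMap.range ι ⊔ LinearMap.range g) ((LinearMap.ker h).map ι)
    (by
      rintro _ ⟨x, _, rfl⟩
      exact Submodule.mem_sup_left ⟨x, rfl⟩)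
    (by
      rintro _ ⟨x, hx, rfl⟩ h0
      exact hprimal x hx fun hx0 => h0 (by rw [hx0, map_zero]))
    (by
      intro v hv h0
      refine hdual v (fun x => ?_) (fun r => ?_) h0
      · rw [hs.eq v (ι x)]
        exact hv _ (Submodule.mem_sup_left ⟨x, rfl⟩)
      · rw [hs.eq v (g r)]
        exact hv _ (Submodule.mem_sup_right ⟨r, rfl⟩)) J hJ
  -- On ker h the values of ι already lie in `M`, and `M` is large enough to extend this to an
  -- injection of all of `E`.
  obtain ⟨Φ, hΦinj, hΦ⟩ := exists_injective_extension hdim (LinearMap.ker h)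
    ((ι ∘ₗ (LinearMap.ker h).subtype).codRestrict M
      fun x => hKM (Submodule.mem_map_of_mem x.2))
    (by
      intro x y hxy
      exact Subtype.ext (hιinj (congrArg Subtype.val hxy)))
  let φ : E →ₗ[ℝ] V := M.subtype ∘ₗ Φ
  have hφ : ∀ x, h x = 0 → φ x = ι x := fun x hx =>
    congrArg Subtype.val (hΦ ⟨x, hx⟩)
  have hφneg : ∀ x, x ≠ 0 → B (φ x) (φ x) < 0 := fun x hx =>
    hM _ (Φ x).2 fun h0 => hx (hΦinj (by rw [map_zero]; exact Subtype.ext h0))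
  -- π ∘ φ may be singular. Adding t ι adds t times the identity to it, which is harmless for
  -- negativity and makes it injective unless -t is an eigenvalue.
  have hev := eventually_negDef B φ ι hφneg
  have hfin := eventually_not_hasEigenvalue_neg (π ∘ₗ φ)
  obtain ⟨t, ⟨ht1, ht2⟩, ht3⟩ :=
    (((hev.filter_mono nhdsWithin_le_nhds).and hfin).and self_mem_nhdsWithin).exists
  have ht3 : (0 : ℝ) < t := ht3
  let φt : E →ₗ[ℝ] V := φ + t • ι
  have hbij : Function.Injective (π ∘ₗ φt) := by
    rw [← LinearMap.ker_eq_bot, LinearMap.ker_eq_bot']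
    intro x hx
    by_contra hx0
    refine ht2 (End.hasEigenvalue_of_hasEigenvector (x := x) ⟨?_, hx0⟩)
    rw [End.mem_eigenspace_iff]
    have hx' : π (φ x + t • ι x) = 0 := hx
    rw [map_add, map_smul, hι] at hx'
    rw [neg_smul]
    exact eq_neg_of_add_eq_zero_left hx'
  let e : E ≃ₗ[ℝ] E := LinearEquiv.ofInjectiveEndo (π ∘ₗ φt) hbij
  -- Reparametrizing by the π-component turns the subspace into a graph over `E`, with π ∘ ψ the
  -- identity.
  let ψ : E →ₗ[ℝ] V := φt ∘ₗ e.symm.toLinearMap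
  have he : ∀ x, π (φt (e.symm x)) = x := fun x => e.apply_symm_apply x
  have hψneg : ∀ x, x ≠ 0 → B (ψ x) (ψ x) < 0 := fun x hx =>
    ht1 _ fun h0 => hx (by simpa using h0)
  have hψι : ∀ x, h x = 0 → ψ x = ι x := by
    -- On ker h the perturbed map is (1 + t) ι, so the reparametrization restores ι exactly.
    intro x hx
    have h1 : e x = (1 + t) • x := by
      change π (φ x + t • ι x) = _
      rw [hφ x hx, map_add, map_smul, hι, add_smul, one_smul]
    have h2 : e.symm x = (1 + t)⁻¹ • x := by
      rw [LinearEquiv.symm_apply_eq, map_smul, h1, smul_smul, inv_mul_cancel₀ (by positivity),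
        one_smul]
    change φt (e.symm x) = _
    rw [h2, map_smul]
    change (1 + t)⁻¹ • (φ x + t • ι x) = _
    rw [hφ x hx, ← one_smul ℝ (ι x), smul_smul t, ← add_smul, smul_smul, mul_one,
      inv_mul_cancel₀ (by positivity), one_smul]
  -- ψ x lies in range ι + range g; as π kills g and π (ψ x) = x, its ι-part must be ι x.
  have hrange : ∀ x, ∃ r, g r = ψ x - ι x := by
    intro x
    have h1 : ψ x ∈ LinearMap.range ι ⊔ LinearMap.range g :=
      add_mem (hMW (Φ _).2) (Submodule.smul_mem _ _ (Submodule.mem_sup_left ⟨_, rfl⟩))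
    obtain ⟨_, ⟨y, rfl⟩, _, ⟨r, rfl⟩, hyr⟩ := Submodule.mem_sup.1 h1
    have h2 : π (ψ x) = x := he x
    have h3 : y = x := by
      rw [← hyr, map_add, hι, hg, add_zero] at h2
      exact h2
    exact ⟨r, by rw [← hyr, h3, add_sub_cancel_left]⟩
  obtain ⟨s, hs'⟩ := g.rangeRestrict.exists_rightInverse_of_surjective g.range_rangeRestrict
  let ρ : E →ₗ[ℝ] R := s ∘ₗ (ψ - ι).codRestrict (LinearMap.range g) fun x => hrange x
  have hρ : ∀ x, g (ρ x) = ψ x - ι x := fun x =>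
    congrArg Subtype.val (LinearMap.congr_fun hs' _)
  obtain ⟨Θ, hΘ⟩ := exists_factor_of_ker_le h ρ (by
    intro x hx
    have : (ψ - ι).codRestrict (LinearMap.range g) (fun x => hrange x) x = 0 :=
      Subtype.ext (by
        change ψ x - ι x = 0
        rw [hψι x hx, sub_self])
    change s _ = 0
    rw [this, map_zero])
  refine ⟨Θ, fun x hx => ?_⟩
  rw [← hΘ, hρ, add_sub_cancel]
  exact hψneg x hx

end LinearAlgebra

/-! ### Bounded real lemma -/

section BoundedReal

open Filter Topology

variable {α β : Type} [Fintype α] [Fintype β]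

/-- The standard inner product as a bilinear form. -/
def dotForm (α : Type) [Fintype α] : LinearMap.BilinForm ℝ (α → ℝ) :=
  LinearMap.mk₂ ℝ (fun x y => x ⬝ᵥ y) (fun x y z => add_dotProduct x y z)
    (fun c x y => smul_dotProduct c x y) (fun x y z => dotProduct_add x y z)
    (fun c x y => dotProduct_smul c x y)

theorem real_dotProduct_self_nonneg (x : α → ℝ) : 0 ≤ x ⬝ᵥ x :=
  Finset.sum_nonneg fun i _ => mul_self_nonneg (x i)

theorem dotProduct_self_pos {x : α → ℝ} (hx : x ≠ 0) : 0 < x ⬝ᵥ x :=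
  lt_of_le_of_ne (real_dotProduct_self_nonneg x) fun h => hx (dotProduct_self_eq_zero.1 h.symm)

/-- A strict dissipation inequality has a margin. -/
theorem exists_dissipation_margin {δ : Type} [Fintype δ]
    (A : Matrix α α ℝ) (B : Matrix α β ℝ) (C : Matrix δ α ℝ)
    (D : Matrix δ β ℝ) {γ : ℝ} (hγ : 0 < γ) (Q : LinearMap.BilinForm ℝ (α → ℝ))
    (hdiss : ∀ x w, (x ≠ 0 ∨ w ≠ 0) → Q (A *ᵥ x + B *ᵥ w) (A *ᵥ x + B *ᵥ w) - Q x x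
      + (C *ᵥ x + D *ᵥ w) ⬝ᵥ (C *ᵥ x + D *ᵥ w) - γ ^ 2 * (w ⬝ᵥ w) < 0) :
    ∃ g, 0 ≤ g ∧ g < γ ∧ ∀ x w, Q (A *ᵥ x + B *ᵥ w) (A *ᵥ x + B *ᵥ w) - Q x x
      + (C *ᵥ x + D *ᵥ w) ⬝ᵥ (C *ᵥ x + D *ᵥ w) ≤ g ^ 2 * (w ⬝ᵥ w) := by
  -- The last factor is a spare slot, zero along `f`, into which `g` inserts w; perturbing by t adds
  -- exactly t²|w|².
  let F : LinearMap.BilinForm ℝ (((α → ℝ) × (α → ℝ)) × ((δ → ℝ) × (β → ℝ)) × (β → ℝ)) :=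
    LinearMap.mk₂ ℝ (fun a b => Q a.1.1 b.1.1 - Q a.1.2 b.1.2 + a.2.1.1 ⬝ᵥ b.2.1.1
      - γ ^ 2 * (a.2.1.2 ⬝ᵥ b.2.1.2) + a.2.2 ⬝ᵥ b.2.2)
      (fun a b c => by simp [add_dotProduct]; ring) (fun r a b => by simp; ring)
      (fun a b c => by simp [dotProduct_add]; ring) (fun r a b => by simp; ring)
  let f : (α → ℝ) × (β → ℝ) →ₗ[ℝ] ((α → ℝ) × (α → ℝ)) × ((δ → ℝ) × (β → ℝ)) × (β → ℝ) :=
    ((A.mulVecLin.coprod B.mulVecLin).prod (LinearMap.fst ℝ _ _)).prod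
      (((C.mulVecLin.coprod D.mulVecLin).prod (LinearMap.snd ℝ _ _)).prod 0)
  let g : (α → ℝ) × (β → ℝ) →ₗ[ℝ] ((α → ℝ) × (α → ℝ)) × ((δ → ℝ) × (β → ℝ)) × (β → ℝ) :=
    LinearMap.prod 0 (LinearMap.prod 0 (LinearMap.snd ℝ _ _))
  have h := eventually_negDef F f g (by
    rintro ⟨x, w⟩ hxw
    have h1 := hdiss x w (by
      by_contra hcon
      push Not at hcon
      exact hxw (Prod.ext hcon.1 hcon.2))
    have e : F (f (x, w)) (f (x, w)) = Q (A *ᵥ x + B *ᵥ w) (A *ᵥ x + B *ᵥ w) - Q x x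
      + (C *ᵥ x + D *ᵥ w) ⬝ᵥ (C *ᵥ x + D *ᵥ w) - γ ^ 2 * (w ⬝ᵥ w) + (0 : β → ℝ) ⬝ᵥ 0 := rfl
    rw [e, zero_dotProduct, add_zero]
    exact h1)
  have h2 : ∀ᶠ t : ℝ in 𝓝 0, t < γ := (continuous_id.tendsto 0).eventually_lt_const hγ
  obtain ⟨t, ⟨ht, htγ⟩, ht0⟩ :=
    (((h.and h2).filter_mono nhdsWithin_le_nhds).and (self_mem_nhdsWithin (s := Set.Ioi 0))).exists
  have ht0 : 0 < t := ht0
  have hsq : 0 ≤ γ ^ 2 - t ^ 2 := by nlinarith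
  refine ⟨Real.sqrt (γ ^ 2 - t ^ 2), Real.sqrt_nonneg _, ?_, fun x w => ?_⟩
  · rw [Real.sqrt_lt' hγ]
    nlinarith
  · rw [Real.sq_sqrt hsq]
    by_cases h0 : (x, w) = (0 : (α → ℝ) × (β → ℝ))
    · obtain ⟨rfl, rfl⟩ := Prod.mk_eq_zero.1 h0
      simp
    · have h3 := ht (x, w) h0
      have e : F (f (x, w) + t • g (x, w)) (f (x, w) + t • g (x, w)) =
          Q (A *ᵥ x + B *ᵥ w + t • (0 : α → ℝ)) (A *ᵥ x + B *ᵥ w + t • (0 : α → ℝ))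
          - Q (x + t • (0 : α → ℝ)) (x + t • (0 : α → ℝ))
          + (C *ᵥ x + D *ᵥ w + t • (0 : δ → ℝ)) ⬝ᵥ (C *ᵥ x + D *ᵥ w + t • (0 : δ → ℝ))
          - γ ^ 2 * ((w + t • (0 : β → ℝ)) ⬝ᵥ (w + t • (0 : β → ℝ)))
          + ((0 : β → ℝ) + t • w) ⬝ᵥ ((0 : β → ℝ) + t • w) := rfl
      rw [e] at h3
      simp only [smul_zero, add_zero, zero_add, dotProduct_smul, smul_dotProduct,
        smul_eq_mul] at h3
      linarith

/-- Real part of a complex vector. -/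
def reVec (v : α → ℂ) : α → ℝ := fun i => (v i).re

/-- Imaginary part of a complex vector. -/
def imVec (v : α → ℂ) : α → ℝ := fun i => (v i).im

theorem reVec_mulVec {δ : Type} (A : Matrix δ α ℝ) (v : α → ℂ) :
    reVec (A.map (algebraMap ℝ ℂ) *ᵥ v) = A *ᵥ reVec v := by
  funext i
  simp [reVec, mulVec, dotProduct]

theorem imVec_mulVec {δ : Type} (A : Matrix δ α ℝ) (v : α → ℂ) :
    imVec (A.map (algebraMap ℝ ℂ) *ᵥ v) = A *ᵥ imVec v := by
  funext i
  simp [imVec, mulVec, dotProduct]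

theorem norm_sq_eq_re_add_im (v : EuclideanSpace ℂ α) :
    ‖v‖ ^ 2 = reVec v ⬝ᵥ reVec v + imVec v ⬝ᵥ imVec v := by
  rw [EuclideanSpace.norm_sq_eq, dotProduct, dotProduct, ← Finset.sum_add_distrib]
  refine Finset.sum_congr rfl fun i _ => ?_
  rw [← Complex.normSq_eq_norm_sq, Complex.normSq_apply]
  rfl

/-- Hermitian extension of a real quadratic form. -/
theorem form_re_add_im_smul {α : Type} (Q : LinearMap.BilinForm ℝ (α → ℝ)) (hs : Q.IsSymm) (q : ℂ)
    (v : α → ℂ) :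
    Q (reVec (q • v)) (reVec (q • v)) + Q (imVec (q • v)) (imVec (q • v)) =
      ‖q‖ ^ 2 * (Q (reVec v) (reVec v) + Q (imVec v) (imVec v)) := by
  have h1 : reVec (q • v) = q.re • reVec v - q.im • imVec v := by
    funext i; simp [reVec, imVec]
  have h2 : imVec (q • v) = q.re • imVec v + q.im • reVec v := by
    funext i; simp [reVec, imVec]
  have h3 : Q (imVec v) (reVec v) = Q (reVec v) (imVec v) := hs.eq _ _
  rw [h1, h2, ← Complex.normSq_eq_norm_sq, Complex.normSq_apply]
  simp only [map_add, map_sub, map_smul, LinearMap.add_apply, LinearMap.sub_apply,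
    LinearMap.smul_apply, smul_eq_mul, h3]
  ring

theorem form_re_add_im_pos {α : Type} (Q : LinearMap.BilinForm ℝ (α → ℝ)) (hpos : ∀ x, x ≠ 0 → 0 < Q x x)
    {v : α → ℂ} (hv : v ≠ 0) : 0 < Q (reVec v) (reVec v) + Q (imVec v) (imVec v) := by
  have hnn : ∀ x, 0 ≤ Q x x := fun x => by
    by_cases hx : x = 0
    · simp [hx]
    · exact (hpos x hx).le
  by_cases h1 : reVec v = 0
  · have h2 : imVec v ≠ 0 := fun h2 => hv (by
      funext i
      exact Complex.ext (congrFun h1 i) (congrFun h2 i))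
    exact add_pos_of_nonneg_of_pos (hnn _) (hpos _ h2)
  · exact add_pos_of_pos_of_nonneg (hpos _ h1) (hnn _)

variable [DecidableEq α] [DecidableEq β]

/-- **Bounded real lemma**, sufficiency. -/
theorem achievesHinf_of_dissipation {δ : Type} [Fintype δ]
    (A : Matrix α α ℝ) (B : Matrix α β ℝ) (C : Matrix δ α ℝ)
    (D : Matrix δ β ℝ) {γ : ℝ} (hγ : 0 < γ) (Q : LinearMap.BilinForm ℝ (α → ℝ)) (hs : Q.IsSymm)
    (hpos : ∀ x, x ≠ 0 → 0 < Q x x)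
    (hdiss : ∀ x w, (x ≠ 0 ∨ w ≠ 0) → Q (A *ᵥ x + B *ᵥ w) (A *ᵥ x + B *ᵥ w) - Q x x
      + (C *ᵥ x + D *ᵥ w) ⬝ᵥ (C *ᵥ x + D *ᵥ w) - γ ^ 2 * (w ⬝ᵥ w) < 0) :
    AchievesHinf A B C D γ := by
  have hstab : SchurStable A := by
    intro μ hμ
    rw [spectrum.mem_iff, Matrix.isUnit_iff_isUnit_det, isUnit_iff_ne_zero, not_not,
      ← Matrix.exists_mulVec_eq_zero_iff] at hμ
    obtain ⟨v, hv, hAv⟩ := hμ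
    have hAv : A.map (algebraMap ℝ ℂ) *ᵥ v = μ • v := by
      rw [sub_mulVec, sub_eq_zero, Algebra.algebraMap_eq_smul_one, smul_mulVec, one_mulVec] at hAv
      exact hAv.symm
    have hlt : ∀ x, x ≠ 0 → Q (A *ᵥ x) (A *ᵥ x) < Q x x := by
      intro x hx
      have := hdiss x 0 (Or.inl hx)
      simp only [mulVec_zero, add_zero, dotProduct_zero, mul_zero, sub_zero] at this
      linarith [real_dotProduct_self_nonneg (C *ᵥ x)]
    have h1 := form_re_add_im_smul Q hs μ v
    rw [← hAv, reVec_mulVec, imVec_mulVec] at h1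
    have h2 := form_re_add_im_pos Q hpos hv
    -- Q - Q ∘ A is positive definite. At an eigenvector its Hermitian extension is 1 - |μ|² times
    -- that of Q.
    have h3 := form_re_add_im_pos (Q - Q.comp A.mulVecLin A.mulVecLin)
      (fun x hx => by simpa using hlt x hx) hv
    simp only [LinearMap.sub_apply, LinearMap.BilinForm.comp_apply, mulVecLin_apply] at h3
    have h4 : ‖μ‖ ^ 2 < 1 := by
      by_contra hcon
      push Not at hcon
      nlinarith
    nlinarith [norm_nonneg μ]
  refine ⟨hstab, ?_⟩
  -- A strict bound at each q would only bound the supremum by γ; the uniform gain g < γ keeps it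
  -- strict.
  obtain ⟨g, hg0, hgγ, hg⟩ := exists_dissipation_margin A B C D hγ Q hdiss
  refine lt_of_le_of_lt ?_ ((ENNReal.ofReal_lt_ofReal_iff hγ).2 hgγ)
  refine iSup₂_le fun q hq => ENNReal.ofReal_le_ofReal ?_
  refine ContinuousLinearMap.opNorm_le_bound _ hg0 fun w => ?_
  have hinv : IsUnit (q • (1 : Matrix α α ℂ) - A.map (algebraMap ℝ ℂ)).det := by
    rw [← Matrix.isUnit_iff_isUnit_det, ← Algebra.algebraMap_eq_smul_one]
    by_contra hcon
    exact absurd (hstab q hcon) (not_lt.2 hq.le)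
  set x : α → ℂ := (q • (1 : Matrix α α ℂ) - A.map (algebraMap ℝ ℂ))⁻¹ *ᵥ
    (B.map (algebraMap ℝ ℂ) *ᵥ w) with hx
  -- With this x, the state map acts as multiplication by q, so the storage difference becomes (|q|²
  -- - 1) times a nonnegative number and can be discarded.
  have hqx : A.map (algebraMap ℝ ℂ) *ᵥ x + B.map (algebraMap ℝ ℂ) *ᵥ w = q • x := by
    have h1 : (q • (1 : Matrix α α ℂ) - A.map (algebraMap ℝ ℂ)) *ᵥ x =
        B.map (algebraMap ℝ ℂ) *ᵥ w := by
      rw [hx, mulVec_mulVec, mul_nonsing_inv _ hinv, one_mulVec]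
    rw [← h1, sub_mulVec, smul_mulVec, one_mulVec, add_sub_cancel]
  have hz : (transfer A B C D q) *ᵥ w =
      C.map (algebraMap ℝ ℂ) *ᵥ x + D.map (algebraMap ℝ ℂ) *ᵥ w := by
    rw [transfer, add_mulVec, hx, mulVec_mulVec, mulVec_mulVec]
  have hadd : ∀ {ι : Type} (u v : ι → ℂ), reVec (u + v) = reVec u + reVec v := fun _ _ => rfl
  have hadd' : ∀ {ι : Type} (u v : ι → ℂ), imVec (u + v) = imVec u + imVec v := fun _ _ => rfl
  have h1 := hg (reVec x) (reVec w)
  have h2 := hg (imVec x) (imVec w)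
  simp only [← reVec_mulVec, ← imVec_mulVec, ← hadd, ← hadd', hqx, ← hz] at h1 h2
  have h3 := form_re_add_im_smul Q hs q x
  have h4 : 0 ≤ Q (reVec x) (reVec x) + Q (imVec x) (imVec x) := by
    by_cases h0 : x = 0
    · rw [h0]
      have e1 : reVec (0 : α → ℂ) = 0 := rfl
      have e2 : imVec (0 : α → ℂ) = 0 := rfl
      simp [e1, e2]
    · exact (form_re_add_im_pos Q hpos h0).le
  have h5 := norm_sq_eq_re_add_im w
  have h6 := norm_sq_eq_re_add_im (Matrix.toEuclideanLin (transfer A B C D q) w)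
  have h7 : (Matrix.toEuclideanLin (transfer A B C D q) w : δ → ℂ) =
    transfer A B C D q *ᵥ w := rfl
  rw [h7] at h6
  have h8 : ‖Matrix.toEuclideanLin (transfer A B C D q) w‖ ^ 2 ≤ (g * ‖w‖) ^ 2 := by
    rw [mul_pow, h5, h6]
    nlinarith [mul_nonneg (by nlinarith : (0 : ℝ) ≤ ‖q‖ ^ 2 - 1) h4]
  exact le_of_sq_le_sq h8 (by positivity)

end BoundedReal

/-! ### Completion of a pair of forms, with control of the inertia -/

noncomputable section Completion

variable {α F : Type} [Fintype α] [AddCommGroup F] [Module ℝ F]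

/-- The symmetric nondegenerate form `G` extends the form of `Z`, and the inverse of `G` extends
the form of `Zb`. -/
structure IsCompletion (G : LinearMap.BilinForm ℝ ((α → ℝ) × F)) (Z Zb : Matrix α α ℝ) :
    Prop where
  symm : ∀ v w, G v w = G w v
  restrict : ∀ e, G (e, 0) (e, 0) = e ⬝ᵥ Z *ᵥ e
  dual : ∀ v η, (∀ e f, G v (e, f) = η ⬝ᵥ e) → G v v = η ⬝ᵥ Zb *ᵥ η
  nondeg : ∀ v, (∀ w, G v w = 0) → v = 0

theorem dotProduct_mulVec_symm {A : Matrix α α ℝ} (hA : A.IsSymm) (x y : α → ℝ) :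
    x ⬝ᵥ A *ᵥ y = y ⬝ᵥ A *ᵥ x := by
  conv_lhs => rw [← hA.eq]
  rw [mulVec_transpose, dotProduct_comm, ← dotProduct_mulVec]

theorem mulVec_dotProduct_of_symm {A : Matrix α α ℝ} (hA : A.IsSymm) (x y : α → ℝ) :
    (A *ᵥ x) ⬝ᵥ y = x ⬝ᵥ A *ᵥ y := by
  rw [dotProduct_comm, dotProduct_mulVec_symm hA]

theorem eq_of_dotProduct_eq {x y : α → ℝ} (h : ∀ z, x ⬝ᵥ z = y ⬝ᵥ z) : x = y := by
  have h1 : (x - y) ⬝ᵥ (x - y) = 0 := by rw [sub_dotProduct, h, sub_self]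
  exact sub_eq_zero.1 (dotProduct_self_eq_zero.1 h1)

/-- The bilinear form of a matrix. -/
def matForm (A : Matrix α α ℝ) : LinearMap.BilinForm ℝ (α → ℝ) :=
  LinearMap.mk₂ ℝ (fun x y => x ⬝ᵥ A *ᵥ y) (fun x y z => add_dotProduct x y _)
    (fun c x y => smul_dotProduct c x _) (fun x y z => by rw [mulVec_add, dotProduct_add])
    (fun c x y => by rw [mulVec_smul, dotProduct_smul])

/-- The form `A(e) + K⁻¹(f₁ + K e) + J(f₂)` on pairs `(e, f)`, where `f ≃ (f₁, f₂)`. -/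
def completionForm [DecidableEq α] {F₂ : Type} [AddCommGroup F₂] [Module ℝ F₂]
    (A K : Matrix α α ℝ)
    (J : LinearMap.BilinForm ℝ F₂) (φ : F →ₗ[ℝ] (α → ℝ) × F₂) :
    LinearMap.BilinForm ℝ ((α → ℝ) × F) :=
  LinearMap.mk₂ ℝ (fun v w => v.1 ⬝ᵥ A *ᵥ w.1 +
      matForm K⁻¹ ((φ v.2).1 + K *ᵥ v.1) ((φ w.2).1 + K *ᵥ w.1) + J (φ v.2).2 (φ w.2).2)
    (fun u v w => by
      simp only [Prod.fst_add, Prod.snd_add, map_add, add_dotProduct, mulVec_add,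
        LinearMap.add_apply]
      ring)
    (fun c v w => by
      simp only [Prod.smul_fst, Prod.smul_snd, map_smul, smul_dotProduct, mulVec_smul,
        map_add, LinearMap.add_apply, LinearMap.smul_apply, smul_eq_mul]
      ring)
    (fun u v w => by
      simp only [Prod.fst_add, Prod.snd_add, map_add, dotProduct_add, mulVec_add,
        LinearMap.add_apply]
      ring)
    (fun c v w => by
      simp only [Prod.smul_fst, Prod.smul_snd, map_smul, dotProduct_smul, mulVec_smul,
        map_add, LinearMap.add_apply, smul_eq_mul]
      ring)

theorem completionForm_apply [DecidableEq α] {F₂ : Type} [AddCommGroup F₂] [Module ℝ F₂]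
    (A K : Matrix α α ℝ)
    (J : LinearMap.BilinForm ℝ F₂) (φ : F →ₗ[ℝ] (α → ℝ) × F₂) (v w : (α → ℝ) × F) :
    completionForm A K J φ v w = v.1 ⬝ᵥ A *ᵥ w.1 +
      ((φ v.2).1 + K *ᵥ v.1) ⬝ᵥ K⁻¹ *ᵥ ((φ w.2).1 + K *ᵥ w.1) + J (φ v.2).2 (φ w.2).2 := rfl

/-- Completing the square: with K = Z - Zb⁻¹, putting f = 0 leaves Zb⁻¹ + K = Z. A vector orthogonal
to all of `F` has vanishing square and vanishing J-part, so only Zb⁻¹ is left, and its dual form is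
Zb. -/
theorem isCompletion_completionForm [DecidableEq α] {F₂ : Type} [AddCommGroup F₂] [Module ℝ F₂]
    {Z Zb : Matrix α α ℝ} (hZ : Z.IsSymm) (hZb : Zb.IsSymm) (hdet : IsUnit Zb.det)
    (hK : IsUnit (Z - Zb⁻¹).det) (J : LinearMap.BilinForm ℝ F₂) (hJs : ∀ v w, J v w = J w v)
    (hJ : ∀ v, (∀ w, J v w = 0) → v = 0) (φ : F ≃ₗ[ℝ] (α → ℝ) × F₂) :
    IsCompletion (completionForm Zb⁻¹ (Z - Zb⁻¹) J φ.toLinearMap) Z Zb := by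
  have hA : (Zb⁻¹).IsSymm := by
    rw [IsSymm, transpose_nonsing_inv, hZb.eq]
  have hKs : (Z - Zb⁻¹).IsSymm := hZ.sub hA
  have hKi : ((Z - Zb⁻¹)⁻¹).IsSymm := by
    rw [IsSymm, transpose_nonsing_inv, hKs.eq]
  set K := Z - Zb⁻¹ with hKdef
  -- if `v` is orthogonal to all of `F`, its `F`-components vanish
  have key : ∀ v : (α → ℝ) × F,
      (∀ f, completionForm Zb⁻¹ K J φ.toLinearMap v (0, f) = 0) →
      (φ v.2).1 + K *ᵥ v.1 = 0 ∧ (φ v.2).2 = 0 := by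
    intro v hv
    constructor
    · have h1 : K⁻¹ *ᵥ ((φ v.2).1 + K *ᵥ v.1) = 0 := by
        refine eq_of_dotProduct_eq fun z => ?_
        have := hv (φ.symm (z, 0))
        rw [completionForm_apply] at this
        simp only [mulVec_zero, dotProduct_zero, add_zero, zero_add, LinearEquiv.coe_coe,
          LinearEquiv.apply_symm_apply, map_zero] at this
        rw [mulVec_dotProduct_of_symm hKi, this, zero_dotProduct]
      have h2 := congrArg (fun y => K *ᵥ y) h1
      simpa only [mulVec_mulVec, mul_nonsing_inv _ hK, one_mulVec, mulVec_zero] using h2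
    · refine hJ _ fun z => ?_
      have := hv (φ.symm (0, z))
      rw [completionForm_apply] at this
      simpa only [mulVec_zero, dotProduct_zero, add_zero, zero_add, LinearEquiv.coe_coe,
          LinearEquiv.apply_symm_apply] using this
  refine ⟨fun v w => ?_, fun e => ?_, fun v η h => ?_, fun v hv => ?_⟩
  · rw [completionForm_apply, completionForm_apply, dotProduct_mulVec_symm hA,
      dotProduct_mulVec_symm hKi, hJs]
  · rw [completionForm_apply]
    simp only [map_zero, Prod.fst_zero, Prod.snd_zero, zero_add, add_zero]
    rw [mulVec_dotProduct_of_symm hKs, mulVec_mulVec, mul_nonsing_inv _ hK, one_mulVec,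
      ← dotProduct_add, ← add_mulVec, hKdef, add_sub_cancel]
  · obtain ⟨h1, h2⟩ := key v fun f => by rw [h 0 f, dotProduct_zero]
    have h3 : ∀ e f, completionForm Zb⁻¹ K J φ.toLinearMap v (e, f) = v.1 ⬝ᵥ Zb⁻¹ *ᵥ e := by
      intro e f
      rw [completionForm_apply]
      simp only [LinearEquiv.coe_coe, h1, h2, zero_dotProduct, map_zero, LinearMap.zero_apply,
        add_zero]
    have h4 : η = Zb⁻¹ *ᵥ v.1 := by
      refine eq_of_dotProduct_eq fun z => ?_
      rw [← h z 0, h3, mulVec_dotProduct_of_symm hA]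
    have h5 : v = (v.1, v.2) := rfl
    conv_lhs => rw [h5, h3]
    rw [h4, mulVec_mulVec, mul_nonsing_inv _ hdet, one_mulVec, dotProduct_comm]
  · obtain ⟨h1, h2⟩ := key v fun f => hv _
    have h4 : Zb⁻¹ *ᵥ v.1 = 0 := by
      refine eq_of_dotProduct_eq fun z => ?_
      have := hv (z, 0)
      rw [completionForm_apply] at this
      simp only [LinearEquiv.coe_coe, h1, h2, zero_dotProduct, map_zero, LinearMap.zero_apply,
        add_zero] at this
      rw [mulVec_dotProduct_of_symm hA, this, zero_dotProduct]
    have h5 : v.1 = 0 := by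
      have h2 := congrArg (fun y => Zb *ᵥ y) h4
      simpa only [mulVec_mulVec, mul_nonsing_inv _ hdet, one_mulVec, mulVec_zero] using h2
    rw [h5, mulVec_zero, add_zero] at h1
    have h6 : φ v.2 = 0 := Prod.ext h1 h2
    exact Prod.ext h5 (by simpa using h6)

/-- `A ⊕ -A` has the sign of `-s` on the vectors `(u - s A u, u + s A u)`. -/
theorem hyperbolic_form {A : Matrix α α ℝ} (hA : A.IsSymm) (s : ℝ) (u : α → ℝ) :
    (u - s • A *ᵥ u) ⬝ᵥ A *ᵥ (u - s • A *ᵥ u) - (u + s • A *ᵥ u) ⬝ᵥ A *ᵥ (u + s • A *ᵥ u) =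
      -(4 * s * ((A *ᵥ u) ⬝ᵥ (A *ᵥ u))) := by
  have h1 : u ⬝ᵥ A *ᵥ (A *ᵥ u) = (A *ᵥ u) ⬝ᵥ (A *ᵥ u) := (mulVec_dotProduct_of_symm hA _ _).symm
  simp only [mulVec_sub, mulVec_add, sub_dotProduct, dotProduct_sub, add_dotProduct,
    dotProduct_add, mulVec_smul, smul_dotProduct, dotProduct_smul, smul_eq_mul, h1]
  ring

theorem mulVec_ne_zero_of_isUnit_det [DecidableEq α] {A : Matrix α α ℝ} (hA : IsUnit A.det)
    {u : α → ℝ} (hu : u ≠ 0) : A *ᵥ u ≠ 0 := fun h =>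
  hA.ne_zero (Matrix.exists_mulVec_eq_zero_iff.1 ⟨u, hu, h⟩)

/-- The form used to balance the inertia of a completion. -/
def balanceForm (A K : Matrix α α ℝ) (p q : ℕ) :
    LinearMap.BilinForm ℝ ((α → ℝ) × (α → ℝ) × (Fin p → ℝ) × (Fin q → ℝ)) :=
  LinearMap.mk₂ ℝ (fun v w => -(v.1 ⬝ᵥ K *ᵥ w.1) - v.2.1 ⬝ᵥ A *ᵥ w.2.1
      - v.2.2.1 ⬝ᵥ w.2.2.1 + v.2.2.2 ⬝ᵥ w.2.2.2)
    (fun u v w => by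
      simp only [Prod.fst_add, Prod.snd_add, add_dotProduct]
      ring)
    (fun c v w => by
      simp only [Prod.smul_fst, Prod.smul_snd, smul_dotProduct, smul_eq_mul]
      ring)
    (fun u v w => by
      simp only [Prod.fst_add, Prod.snd_add, dotProduct_add, mulVec_add]
      ring)
    (fun c v w => by
      simp only [Prod.smul_fst, Prod.smul_snd, dotProduct_smul, mulVec_smul, smul_eq_mul]
      ring)

theorem balanceForm_apply (A K : Matrix α α ℝ) (p q : ℕ)
    (v w : (α → ℝ) × (α → ℝ) × (Fin p → ℝ) × (Fin q → ℝ)) :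
    balanceForm A K p q v w = -(v.1 ⬝ᵥ K *ᵥ w.1) - v.2.1 ⬝ᵥ A *ᵥ w.2.1
      - v.2.2.1 ⬝ᵥ w.2.2.1 + v.2.2.2 ⬝ᵥ w.2.2.2 := rfl

theorem balanceForm_nondeg [DecidableEq α] {A K : Matrix α α ℝ} (hAs : A.IsSymm) (hKs : K.IsSymm)
    (hA : IsUnit A.det) (hK : IsUnit K.det) {p q : ℕ}
    (v : (α → ℝ) × (α → ℝ) × (Fin p → ℝ) × (Fin q → ℝ))
    (hv : ∀ w, balanceForm A K p q v w = 0) : v = 0 := by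
  have h1 : v.1 = 0 := by
    by_contra h0
    have := hv (K *ᵥ v.1, 0, 0, 0)
    rw [balanceForm_apply] at this
    simp only [mulVec_zero, dotProduct_zero, add_zero, sub_zero, neg_eq_zero] at this
    rw [← mulVec_dotProduct_of_symm hKs] at this
    exact mulVec_ne_zero_of_isUnit_det hK h0 (dotProduct_self_eq_zero.1 this)
  have h2 : v.2.1 = 0 := by
    by_contra h0
    have := hv (0, A *ᵥ v.2.1, 0, 0)
    rw [balanceForm_apply] at this
    simp only [mulVec_zero, dotProduct_zero, add_zero, sub_zero, neg_zero, zero_sub,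
      neg_eq_zero] at this
    rw [← mulVec_dotProduct_of_symm hAs] at this
    exact mulVec_ne_zero_of_isUnit_det hA h0 (dotProduct_self_eq_zero.1 this)
  have h3 : v.2.2.1 = 0 := by
    have := hv (0, 0, v.2.2.1, 0)
    rw [balanceForm_apply] at this
    simp only [mulVec_zero, dotProduct_zero, add_zero, sub_zero, neg_zero, zero_sub,
      neg_eq_zero] at this
    exact dotProduct_self_eq_zero.1 this
  have h4 : v.2.2.2 = 0 := by
    have := hv (0, 0, 0, v.2.2.2)
    rw [balanceForm_apply] at this
    simp only [mulVec_zero, dotProduct_zero, sub_zero, neg_zero, zero_add] at this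
    exact dotProduct_self_eq_zero.1 this
  exact Prod.ext h1 (Prod.ext h2 (Prod.ext h3 h4))

/-- A family of directions on which a balanced completion has known values. -/
theorem exists_balanced_directions [DecidableEq α] {M : Type} [AddCommGroup M] [Module ℝ M]
    {A K : Matrix α α ℝ} (hA : A.IsSymm) (hK : (K⁻¹).IsSymm) {p q : ℕ}
    (φ : F ≃ₗ[ℝ] (α → ℝ) × ((α → ℝ) × (α → ℝ) × (Fin p → ℝ) × (Fin q → ℝ))) (s : ℝ)
    (m : M →ₗ[ℝ] (Fin p → ℝ) × (Fin q → ℝ)) :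
    ∃ J : ((α → ℝ) × (α → ℝ) × M) →ₗ[ℝ] (α → ℝ) × F, ∀ u,
      completionForm A K (balanceForm A K⁻¹ p q) φ.toLinearMap (J u) (J u) =
        -(4 * s * ((A *ᵥ u.1) ⬝ᵥ (A *ᵥ u.1))) - 4 * s * ((K⁻¹ *ᵥ u.2.1) ⬝ᵥ (K⁻¹ *ᵥ u.2.1))
          - (m u.2.2).1 ⬝ᵥ (m u.2.2).1 + (m u.2.2).2 ⬝ᵥ (m u.2.2).2 := by
  -- In the coordinates (e, f₁ + K e, f₂) the form is A ⊕ K⁻¹ ⊕ (-K⁻¹) ⊕ (-A) ⊕ (-I) ⊕ I.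
  -- Subtracting K e from f₁ gives direct access to the second coordinate, so that A and K⁻¹ each
  -- pair with their negatives as in `hyperbolic_form`.
  refine ⟨{ toFun := fun u => (u.1 - s • A *ᵥ u.1, φ.symm (u.2.1 - s • K⁻¹ *ᵥ u.2.1 -
          K *ᵥ (u.1 - s • A *ᵥ u.1), u.2.1 + s • K⁻¹ *ᵥ u.2.1, u.1 + s • A *ᵥ u.1, m u.2.2))
            map_add' := fun u v => ?_
            map_smul' := fun c u => ?_ }, fun u => ?_⟩
  · refine Prod.ext ?_ ?_
    · simp only [Prod.fst_add, mulVec_add, smul_add]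
      abel
    · simp only [Prod.snd_add]
      rw [← map_add]
      congr 1
      simp only [Prod.fst_add, mulVec_add, mulVec_sub, Prod.mk_add_mk, smul_add, map_add]
      refine Prod.ext ?_ (Prod.ext ?_ (Prod.ext ?_ rfl)) <;> dsimp only <;> abel
  · refine Prod.ext ?_ ?_
    · simp only [Prod.smul_fst, mulVec_smul, smul_sub, RingHom.id_apply, smul_comm s c]
    · simp only [Prod.smul_snd, RingHom.id_apply]
      rw [← map_smul]
      congr 1
      simp only [Prod.smul_fst, mulVec_smul, mulVec_sub, Prod.smul_mk,
        smul_sub, smul_add, smul_comm s c, map_smul]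
  · have h1 := hyperbolic_form hA s u.1
    have h2 := hyperbolic_form hK s u.2.1
    rw [completionForm_apply, balanceForm_apply]
    simp only [LinearMap.coe_mk, AddHom.coe_mk, LinearEquiv.coe_coe,
      LinearEquiv.apply_symm_apply, sub_add_cancel]
    linarith

/-- Completion of a pair of forms on `ℝᵃ × ℝᵇ` with prescribed inertia; the added space has
dimension `6 max(a, b)`. -/
theorem exists_edge_completion {a b N₁ N₂ : ℕ} (hN₁ : N₁ = 3 * max a b) (hN₂ : N₂ = 3 * max a b)
    {Z Zb : Matrix (Fin a ⊕ Fin b) (Fin a ⊕ Fin b) ℝ} (hZ : Z.IsSymm) (hZb : Zb.IsSymm)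
    (hdet : IsUnit Zb.det) (hK : IsUnit (Z - Zb⁻¹).det) :
    ∃ G : LinearMap.BilinForm ℝ ((Fin a ⊕ Fin b → ℝ) × (Fin N₁ → ℝ) × (Fin N₂ → ℝ)),
      IsCompletion G Z Zb ∧
      (∃ J : ((Fin b → ℝ) × (Fin N₂ → ℝ)) →ₗ[ℝ] _, ∀ x, x ≠ 0 → G (J x) (J x) < 0) ∧
      (∃ J : ((Fin a → ℝ) × (Fin N₁ → ℝ)) →ₗ[ℝ] _, ∀ x, x ≠ 0 → 0 < G (J x) (J x)) := by
  -- The form will have 2(a + b) + p negative and 2(a + b) + q positive squares; these numbers must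
  -- equal b + N₂ and a + N₁. That p and q are nonnegative is the reason for the factor 3.
  obtain ⟨p, hp⟩ : ∃ p, p + 2 * a + b = N₁ := ⟨N₁ - 2 * a - b, by omega⟩
  obtain ⟨q, hq⟩ : ∃ q, q + a + 2 * b = N₁ := ⟨N₁ - a - 2 * b, by omega⟩
  obtain ⟨φ⟩ : Nonempty (((Fin N₁ → ℝ) × (Fin N₂ → ℝ)) ≃ₗ[ℝ]
      (Fin a ⊕ Fin b → ℝ) × ((Fin a ⊕ Fin b → ℝ) × (Fin a ⊕ Fin b → ℝ) × (Fin p → ℝ) × (Fin q → ℝ))) := by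
    refine FiniteDimensional.nonempty_linearEquiv_of_finrank_eq ?_
    simp only [Module.finrank_prod, Module.finrank_fintype_fun_eq_card, Fintype.card_sum,
      Fintype.card_fin]
    omega
  obtain ⟨χn⟩ : Nonempty (((Fin b → ℝ) × (Fin N₂ → ℝ)) ≃ₗ[ℝ]
      (Fin a ⊕ Fin b → ℝ) × (Fin a ⊕ Fin b → ℝ) × (Fin p → ℝ)) := by
    refine FiniteDimensional.nonempty_linearEquiv_of_finrank_eq ?_
    simp only [Module.finrank_prod, Module.finrank_fintype_fun_eq_card, Fintype.card_sum,
      Fintype.card_fin]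
    omega
  obtain ⟨χp⟩ : Nonempty (((Fin a → ℝ) × (Fin N₁ → ℝ)) ≃ₗ[ℝ]
      (Fin a ⊕ Fin b → ℝ) × (Fin a ⊕ Fin b → ℝ) × (Fin q → ℝ)) := by
    refine FiniteDimensional.nonempty_linearEquiv_of_finrank_eq ?_
    simp only [Module.finrank_prod, Module.finrank_fintype_fun_eq_card, Fintype.card_sum,
      Fintype.card_fin]
    omega
  have hA : (Zb⁻¹).IsSymm := by
    rw [IsSymm, transpose_nonsing_inv, hZb.eq]
  have hKs : (Z - Zb⁻¹).IsSymm := hZ.sub hA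
  have hKi : ((Z - Zb⁻¹)⁻¹).IsSymm := by
    rw [IsSymm, transpose_nonsing_inv, hKs.eq]
  have hAu : IsUnit (Zb⁻¹).det := isUnit_nonsing_inv_det _ hdet
  have hKu : IsUnit ((Z - Zb⁻¹)⁻¹).det := isUnit_nonsing_inv_det _ hK
  have hcompl := isCompletion_completionForm hZ hZb hdet hK
    (balanceForm Zb⁻¹ (Z - Zb⁻¹)⁻¹ p q)
    (fun v w => by
      rw [balanceForm_apply, balanceForm_apply, dotProduct_mulVec_symm hA,
        dotProduct_mulVec_symm hKi, dotProduct_comm w.2.2.1, dotProduct_comm w.2.2.2])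
    (balanceForm_nondeg hA hKi hAu hKu) φ
  refine ⟨_, hcompl, ?_, ?_⟩
  -- s = 1 makes both hyperbolic pairs negative, whatever the signatures of A and K; the q positive
  -- squares are set to zero.
  · obtain ⟨J, hJ⟩ := exists_balanced_directions hA hKi φ 1 (LinearMap.inl ℝ _ _)
    refine ⟨J ∘ₗ χn.toLinearMap, fun x hx => ?_⟩
    have hx' : χn x ≠ 0 := fun h => hx (by simpa using h)
    rw [LinearMap.comp_apply, LinearEquiv.coe_coe, hJ]
    generalize χn x = u at hx'
    simp only [LinearMap.inl_apply, dotProduct_zero, add_zero, mul_one]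
    have h1 := real_dotProduct_self_nonneg (Zb⁻¹ *ᵥ u.1)
    have h2 := real_dotProduct_self_nonneg ((Z - Zb⁻¹)⁻¹ *ᵥ u.2.1)
    have h3 := real_dotProduct_self_nonneg u.2.2
    by_cases h4 : u.1 = 0
    · by_cases h5 : u.2.1 = 0
      · have h6 := dotProduct_self_pos fun h6 => hx' (Prod.ext h4 (Prod.ext h5 h6))
        linarith
      · have := dotProduct_self_pos (mulVec_ne_zero_of_isUnit_det hKu h5)
        linarith
    · have := dotProduct_self_pos (mulVec_ne_zero_of_isUnit_det hAu h4)
      linarith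
  · obtain ⟨J, hJ⟩ := exists_balanced_directions hA hKi φ (-1) (LinearMap.inr ℝ _ _)
    refine ⟨J ∘ₗ χp.toLinearMap, fun x hx => ?_⟩
    have hx' : χp x ≠ 0 := fun h => hx (by simpa using h)
    rw [LinearMap.comp_apply, LinearEquiv.coe_coe, hJ]
    generalize χp x = u at hx'
    simp only [LinearMap.inr_apply, dotProduct_zero]
    have h1 := real_dotProduct_self_nonneg (Zb⁻¹ *ᵥ u.1)
    have h2 := real_dotProduct_self_nonneg ((Z - Zb⁻¹)⁻¹ *ᵥ u.2.1)
    have h3 := real_dotProduct_self_nonneg u.2.2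
    by_cases h4 : u.1 = 0
    · by_cases h5 : u.2.1 = 0
      · have h6 := dotProduct_self_pos fun h6 => hx' (Prod.ext h4 (Prod.ext h5 h6))
        linarith
      · have := dotProduct_self_pos (mulVec_ne_zero_of_isUnit_det hKu h5)
        linarith
    · have := dotProduct_self_pos (mulVec_ne_zero_of_isUnit_det hAu h4)
      linarith

/-- The completion for the reversed edge. -/
theorem IsCompletion.neg_swap {β F' : Type} [Fintype β] [AddCommGroup F'] [Module ℝ F']
    {G : LinearMap.BilinForm ℝ ((α → ℝ) × F)} {Z Zb : Matrix α α ℝ} (h : IsCompletion G Z Zb)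
    (e : β ≃ α) (ψ : F' ≃ₗ[ℝ] F) :
    IsCompletion (-(G.comp ((LinearMap.funLeft ℝ ℝ e.symm).prodMap ψ.toLinearMap)
      ((LinearMap.funLeft ℝ ℝ e.symm).prodMap ψ.toLinearMap)))
      (-(Z.submatrix e e)) (-(Zb.submatrix e e)) := by
  have hform : ∀ (A : Matrix α α ℝ) (x : β → ℝ), x ⬝ᵥ (-(A.submatrix e e)) *ᵥ x =
      -((x ∘ e.symm) ⬝ᵥ A *ᵥ (x ∘ e.symm)) := by
    intro A x
    rw [neg_mulVec, dotProduct_neg, submatrix_mulVec_equiv, ← comp_equiv_symm_dotProduct]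
  have happ : ∀ v w, (-(G.comp ((LinearMap.funLeft ℝ ℝ e.symm).prodMap ψ.toLinearMap)
      ((LinearMap.funLeft ℝ ℝ e.symm).prodMap ψ.toLinearMap))) v w =
      -(G (v.1 ∘ e.symm, ψ v.2) (w.1 ∘ e.symm, ψ w.2)) := fun v w => rfl
  refine ⟨fun v w => ?_, fun x => ?_, fun v η hv => ?_, fun v hv => ?_⟩
  · rw [happ, happ, h.symm]
  · rw [happ, hform, ← h.restrict]
    simp
  · rw [happ, hform]
    congr 1
    -- The sign of the form passes to the functional, where the quadratic dual value does not see
    -- it.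
    have := h.dual (v.1 ∘ e.symm, ψ v.2) (-(η ∘ e.symm)) (fun x f => by
      have h1 := hv (x ∘ e) (ψ.symm f)
      rw [happ] at h1
      have h2 : (x ∘ e) ∘ e.symm = x := by funext i; simp
      rw [h2, LinearEquiv.apply_symm_apply] at h1
      rw [neg_dotProduct, comp_equiv_symm_dotProduct, ← h1, neg_neg])
    rw [this]
    simp [mulVec_neg]
  · have := h.nondeg (v.1 ∘ e.symm, ψ v.2) (fun w => by
      have h1 := hv (w.1 ∘ e, ψ.symm w.2)
      rw [happ] at h1
      have h2 : (w.1 ∘ e) ∘ e.symm = w.1 := by funext i; simp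
      rw [h2, LinearEquiv.apply_symm_apply] at h1
      exact neg_eq_zero.1 h1)
    obtain ⟨h1, h2⟩ := Prod.mk_eq_zero.1 this
    refine Prod.ext ?_ (by simpa using h2)
    funext i
    simpa using congrFun h1 (e i)

end Completion

/-! ### Storage functions of the subsystems -/

noncomputable section StateCompletion

variable {α : Type} [Fintype α]

theorem posDef_iff_real {A : Matrix α α ℝ} :
    A.PosDef ↔ A.IsSymm ∧ ∀ x, x ≠ 0 → 0 < x ⬝ᵥ A *ᵥ x := by
  rw [posDef_iff_dotProduct_mulVec, IsHermitian, conjTranspose_eq_transpose_of_trivial]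
  exact Iff.rfl

theorem Matrix.PosDef.isSymm_real {A : Matrix α α ℝ} (h : A.PosDef) : A.IsSymm :=
  (posDef_iff_real.1 h).1

/-- Positive definite completion of a pair of state forms. -/
theorem exists_state_completion [DecidableEq α] {P Pb : Matrix α α ℝ} (hP : P.IsSymm)
    (hPb : Pb.PosDef) (hK : (P - Pb⁻¹).PosDef) :
    ∃ G : LinearMap.BilinForm ℝ ((α → ℝ) × (α → ℝ)), IsCompletion G P Pb ∧
      ∀ v, v ≠ 0 → 0 < G v v := by
  have hPbu : IsUnit Pb.det := (Matrix.isUnit_iff_isUnit_det _).1 hPb.isUnit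
  have hKu : IsUnit (P - Pb⁻¹).det := (Matrix.isUnit_iff_isUnit_det _).1 hK.isUnit
  -- No balancing summand is needed: the completion is already definite, so a controller state of
  -- dimension n_i suffices.
  let φ : (α → ℝ) ≃ₗ[ℝ] (α → ℝ) × PUnit.{1} := LinearEquiv.prodUnique.symm
  refine ⟨_, isCompletion_completionForm hP hPb.isSymm_real hPbu hKu 0 (fun _ _ => rfl)
    (fun _ _ => rfl) φ, ?_⟩
  rintro ⟨e, f⟩ hv
  rw [completionForm_apply, LinearMap.zero_apply, LinearMap.zero_apply, add_zero]
  change 0 < e ⬝ᵥ Pb⁻¹ *ᵥ e +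
    (f + (P - Pb⁻¹) *ᵥ e) ⬝ᵥ (P - Pb⁻¹)⁻¹ *ᵥ (f + (P - Pb⁻¹) *ᵥ e)
  have h1 : ∀ x, x ≠ 0 → 0 < x ⬝ᵥ Pb⁻¹ *ᵥ x := (posDef_iff_real.1 hPb.inv).2
  have h2 : ∀ x, x ≠ 0 → 0 < x ⬝ᵥ (P - Pb⁻¹)⁻¹ *ᵥ x := (posDef_iff_real.1 hK.inv).2
  by_cases he : e = 0
  · have hf : f ≠ 0 := fun hf => hv (by rw [he, hf]; rfl)
    simpa [he] using h2 f hf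
  · refine add_pos_of_pos_of_nonneg (h1 e he) ?_
    by_cases h0 : f + (P - Pb⁻¹) *ᵥ e = 0
    · simp [h0]
    · exact (h2 _ h0).le

end StateCompletion

/-! ### Dualization of the data inequality -/

section DataSet

/-- A symmetric invertible matrix that is negative definite on the first coordinates and
nonnegative on `im [-Δᵀ; I]` has an inverse that is positive definite on the last coordinates. -/
theorem inv_pos_right {α β : Type} [Fintype α] [Fintype β] [DecidableEq α] [DecidableEq β]
    {G : Matrix (α ⊕ β) (α ⊕ β) ℝ} (hG : G.IsSymm) (hdet : IsUnit G.det)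
    (hneg : ∀ p : α → ℝ, p ≠ 0 → Sum.elim p 0 ⬝ᵥ G *ᵥ Sum.elim p 0 < 0) (Δ : Matrix β α ℝ)
    (hΔ : ∀ z : β → ℝ, 0 ≤ Sum.elim (-(Δᵀ *ᵥ z)) z ⬝ᵥ G *ᵥ Sum.elim (-(Δᵀ *ᵥ z)) z) :
    ∀ z : β → ℝ, z ≠ 0 → 0 < z ⬝ᵥ (G⁻¹).toBlocks₂₂ *ᵥ z := by
  have hGi : (G⁻¹).IsSymm := by rw [IsSymm, transpose_nonsing_inv, hG.eq]
  -- the last components of `v = G⁻¹ (0, z)` are given by the block of the inverse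
  have hblock : ∀ z : β → ℝ, (G⁻¹).toBlocks₂₂ *ᵥ z = (G⁻¹ *ᵥ Sum.elim (0 : α → ℝ) z) ∘ Sum.inr := by
    intro z
    conv_rhs => rw [← fromBlocks_toBlocks G⁻¹, fromBlocks_mulVec]
    funext i
    simp
  have hGv : ∀ z : β → ℝ, G *ᵥ (G⁻¹ *ᵥ Sum.elim (0 : α → ℝ) z) = Sum.elim (0 : α → ℝ) z := by
    intro z
    rw [mulVec_mulVec, mul_nonsing_inv _ hdet, one_mulVec]
  have hval : ∀ z : β → ℝ, z ⬝ᵥ (G⁻¹).toBlocks₂₂ *ᵥ z =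
      (G⁻¹ *ᵥ Sum.elim (0 : α → ℝ) z) ⬝ᵥ G *ᵥ (G⁻¹ *ᵥ Sum.elim (0 : α → ℝ) z) := by
    intro z
    rw [hGv, hblock, dotProduct_comm (G⁻¹ *ᵥ _), dotProduct_block]
    simp
  have hnonneg : ∀ z : β → ℝ, 0 ≤ z ⬝ᵥ (G⁻¹).toBlocks₂₂ *ᵥ z := by
    intro z
    rw [hval]
    set v := G⁻¹ *ᵥ Sum.elim (0 : α → ℝ) z with hv
    -- Since G v = (0, z), v is G-orthogonal to the first coordinates. Shifting it by t into im
    -- [-Δᵀ; I] gives G(v) + G(t) ≥ 0 with G(t) ≤ 0.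
    set t : α → ℝ := -(Δᵀ *ᵥ (v ∘ Sum.inr)) - v ∘ Sum.inl with ht
    have h1 : Sum.elim (-(Δᵀ *ᵥ (v ∘ Sum.inr))) (v ∘ Sum.inr) = v + Sum.elim t 0 := by
      funext i
      rcases i with i | i <;> simp [ht]
    have h2 := hΔ (v ∘ Sum.inr)
    rw [h1] at h2
    have h3 : Sum.elim t (0 : β → ℝ) ⬝ᵥ G *ᵥ v = 0 := by
      rw [hv, hGv, sumElim_dotProduct_sumElim]
      simp
    have h4 : v ⬝ᵥ G *ᵥ Sum.elim t (0 : β → ℝ) = 0 := by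
      rw [dotProduct_mulVec_symm hG, h3]
    have h5 : Sum.elim t (0 : β → ℝ) ⬝ᵥ G *ᵥ Sum.elim t 0 ≤ 0 := by
      by_cases h0 : t = 0
      · have : Sum.elim t (0 : β → ℝ) = 0 := by
          rw [h0]
          funext i
          rcases i with i | i <;> rfl
        simp [this]
      · exact (hneg t h0).le
    rw [mulVec_add, dotProduct_add, add_dotProduct, add_dotProduct, h3, h4] at h2
    linarith
  have hsymm : ((G⁻¹).toBlocks₂₂).IsSymm := by
    ext i j
    exact hGi.apply _ _
  have hpsd : ((G⁻¹).toBlocks₂₂).PosSemidef :=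
    PosSemidef.of_dotProduct_mulVec_nonneg (by
      rw [IsHermitian, conjTranspose_eq_transpose_of_trivial]
      exact hsymm) hnonneg
  intro z hz
  refine lt_of_le_of_ne (hnonneg z) fun h0 => hz ?_
  -- A null vector of the semidefinite block is in its kernel; then v lies in the first coordinates,
  -- where G is definite, so v = 0.
  have h1 : (G⁻¹).toBlocks₂₂ *ᵥ z = 0 :=
    (hpsd.dotProduct_mulVec_zero_iff z).1 h0.symm
  rw [hblock] at h1
  set v := G⁻¹ *ᵥ Sum.elim (0 : α → ℝ) z with hv
  have h2 : v = Sum.elim (v ∘ Sum.inl) 0 := by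
    rw [← h1]
    exact (Sum.elim_comp_inl_inr v).symm
  have h3 : v ∘ Sum.inl = 0 := by
    by_contra hne
    have := hneg _ hne
    rw [← h2] at this
    rw [hval] at h0
    exact this.ne h0.symm
  have h4 : v = 0 := by
    rw [h2, h3]
    funext i
    rcases i with i | i <;> rfl
  have h5 := hGv z
  rw [← hv, h4, mulVec_zero] at h5
  funext i
  exact (congrFun h5 (Sum.inr i)).symm

/-- Dualization: under the same hypotheses the inverse is nonpositive on `im [I; Δ]`. -/
theorem inv_nonpos_graph {α β : Type} [Fintype α] [Fintype β] [DecidableEq α] [DecidableEq β]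
    {G : Matrix (α ⊕ β) (α ⊕ β) ℝ} (hG : G.IsSymm) (hdet : IsUnit G.det)
    (hneg : ∀ p : α → ℝ, p ≠ 0 → Sum.elim p 0 ⬝ᵥ G *ᵥ Sum.elim p 0 < 0) (Δ : Matrix β α ℝ)
    (hΔ : ∀ z : β → ℝ, 0 ≤ Sum.elim (-(Δᵀ *ᵥ z)) z ⬝ᵥ G *ᵥ Sum.elim (-(Δᵀ *ᵥ z)) z)
    (p : α → ℝ) : Sum.elim p (Δ *ᵥ p) ⬝ᵥ G⁻¹ *ᵥ Sum.elim p (Δ *ᵥ p) ≤ 0 := by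
  set a := Sum.elim p (Δ *ᵥ p) with ha
  set u := G⁻¹ *ᵥ a with hu
  have hGu : G *ᵥ u = a := by
    rw [hu, mulVec_mulVec, mul_nonsing_inv _ hdet, one_mulVec]
  have h0 : a ⬝ᵥ u = u ⬝ᵥ G *ᵥ u := by rw [hGu, dotProduct_comm]
  rw [h0]
  -- This z makes u + w a vector in the first coordinates. As im [-Δᵀ; I] is orthogonal to the graph
  -- of Δ, w is G-orthogonal to u, so G(u) + G(w) ≤ 0 with G(w) ≥ 0.
  set z : β → ℝ := -(u ∘ Sum.inr) with hz
  set w := Sum.elim (-(Δᵀ *ᵥ z)) z with hw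
  have h1 : w ⬝ᵥ G *ᵥ u = 0 := by
    rw [hGu, hw, ha, sumElim_dotProduct_sumElim, neg_dotProduct, mulVec_transpose,
      ← dotProduct_mulVec, neg_add_cancel]
  have h2 : u ⬝ᵥ G *ᵥ w = 0 := by rw [dotProduct_mulVec_symm hG, h1]
  have h3 := hΔ z
  rw [← hw] at h3
  have h4 : u + w = Sum.elim (u ∘ Sum.inl - Δᵀ *ᵥ z) 0 := by
    funext i
    rcases i with i | i <;> simp [hw, hz, sub_eq_add_neg]
  have h5 : (u + w) ⬝ᵥ G *ᵥ (u + w) ≤ 0 := by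
    rw [h4]
    by_cases h0 : u ∘ Sum.inl - Δᵀ *ᵥ z = 0
    · have : Sum.elim (u ∘ Sum.inl - Δᵀ *ᵥ z) (0 : β → ℝ) = 0 := by
        rw [h0]
        funext i
        rcases i with i | i <;> rfl
      simp [this]
    · exact (hneg _ h0).le
  rw [mulVec_add, dotProduct_add, add_dotProduct, add_dotProduct, h1, h2] at h5
  linarith

variable {L N : ℕ} {S : Network L}

theorem dataBar_isSymm (d : Data S N) {i : Fin L} {ν : NoiseModel S N i} (hQ : ν.Qw.IsSymm)
    (hR : ν.Rw.IsSymm) : (dataBar d ν).IsSymm := by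
  have h : ν.mat.IsSymm := by
    rw [NoiseModel.mat, IsSymm, fromBlocks_transpose, hQ.eq, hR.eq, transpose_transpose]
  rw [dataBar, IsSymm, transpose_mul, transpose_mul, h.eq, transpose_transpose, Matrix.mul_assoc]

theorem dataBar_form (d : Data S N) {i : Fin L} (ν : NoiseModel S N i)
    (x : RegIdx S i ⊕ Fin (S.n i) → ℝ) :
    x ⬝ᵥ dataBar d ν *ᵥ x = ((dataFactor d i)ᵀ *ᵥ x) ⬝ᵥ ν.mat *ᵥ ((dataFactor d i)ᵀ *ᵥ x) := by
  rw [dataBar, ← mulVec_mulVec, ← mulVec_mulVec, dotProduct_mulVec, ← mulVec_transpose]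

/-- The transposed data factor sends (p, 0) to (regᵀ p, 0), so only Q_w enters; full row rank keeps
regᵀ p nonzero. -/
theorem dataBar_neg (d : Data S N) {i : Fin L} {ν : NoiseModel S N i} (hQ : (-ν.Qw).PosDef)
    (hrank : (d.reg i).rank = Fintype.card (RegIdx S i)) (p : RegIdx S i → ℝ) (hp : p ≠ 0) :
    Sum.elim p 0 ⬝ᵥ dataBar d ν *ᵥ Sum.elim p 0 < 0 := by
  have hinj : Function.Injective (d.reg i).vecMul := by
    rw [vecMul_injective_iff, linearIndependent_iff_card_eq_finrank_span, Set.finrank,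
      ← rank_eq_finrank_span_row, hrank]
  have h1 : (d.reg i)ᵀ *ᵥ p ≠ 0 := by
    rw [mulVec_transpose]
    intro h0
    exact hp (hinj (h0.trans (zero_vecMul _).symm))
  rw [dataBar_form, dataFactor, fromBlocks_transpose, fromBlocks_mulVec, NoiseModel.mat,
    fromBlocks_mulVec, sumElim_dotProduct_sumElim]
  have h2 := (posDef_iff_real.1 hQ).2 _ h1
  rw [neg_mulVec, dotProduct_neg] at h2
  simpa using h2

/-- The map `(x, x_N, u) ↦ A x + A_N x_N + B u`. -/
def DistCtrl.Subsystem.mat {i : Fin L} (M : Subsystem S i) : Matrix (Fin (S.n i)) (RegIdx S i) ℝ :=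
  fromCols M.A (fromCols M.AN M.B)

/-- By the data equation the transposed data factor sends (-Δᵀ z, z) to (Wᵀ z, z), which is where
the noise bound lives. -/
theorem dataBar_nonneg_of_consistent (d : Data S N) {i : Fin L} {ν : NoiseModel S N i}
    {M : Subsystem S i} (hM : M ∈ consistent d ν) (z : Fin (S.n i) → ℝ) :
    0 ≤ Sum.elim (-(M.matᵀ *ᵥ z)) z ⬝ᵥ dataBar d ν *ᵥ Sum.elim (-(M.matᵀ *ᵥ z)) z := by
  obtain ⟨W, hW, hX⟩ := hM
  have h1 : (dataFactor d i)ᵀ *ᵥ Sum.elim (-(M.matᵀ *ᵥ z)) z = noiseFactor W *ᵥ z := by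
    have h2 : Wᵀ = (d.Xp i)ᵀ - (d.reg i)ᵀ * M.matᵀ := by
      rw [← transpose_mul, ← transpose_sub, Subsystem.mat, Data.reg, fromCols_mul_fromRows,
        fromCols_mul_fromRows, hX, ← add_assoc, add_sub_cancel_left]
    rw [dataFactor, noiseFactor, fromBlocks_transpose, fromBlocks_mulVec, fromRows_mulVec, h2,
      sub_mulVec, ← mulVec_mulVec]
    funext i
    rcases i with i | i <;> simp [mulVec_neg, sub_eq_neg_add]
  rw [dataBar_form, h1]
  have h3 := PosSemidef.dotProduct_mulVec_nonneg hW z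
  rw [← mulVec_mulVec, ← mulVec_mulVec, mulVec_transpose, dotProduct_comm, ← dotProduct_mulVec,
    dotProduct_comm] at h3
  simpa using h3

end DataSet

/-! ### The two matrix inequalities as statements about quadratic forms -/

noncomputable section LocalForms

variable {L : ℕ} {S : Network L}

theorem blockDiagonal'_mulVec_apply {ι : Type} [Fintype ι] [DecidableEq ι] {μ ν : ι → Type}
    [∀ i, Fintype (ν i)] (A : ∀ i, Matrix (μ i) (ν i) ℝ) (v : (Σ i, ν i) → ℝ) (i : ι) (a : μ i) :
    (blockDiagonal' A *ᵥ v) ⟨i, a⟩ = (A i *ᵥ fun b => v ⟨i, b⟩) a := by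
  simp only [mulVec, dotProduct, Fintype.sum_sigma]
  rw [Finset.sum_eq_single i]
  · simp [blockDiagonal'_apply_eq]
  · intro j _ hj
    refine Finset.sum_eq_zero fun b _ => ?_
    rw [blockDiagonal'_apply_ne _ _ _ hj.symm, zero_mul]
  · simp

/-- The part of the scale `Z_i` that belongs to the edge from `i` to `j`. -/
def DistCtrl.Scales.edge (X : Scales S) (i j : Fin L) :
    Matrix (Fin (S.n i) ⊕ Fin (S.n j)) (Fin (S.n i) ⊕ Fin (S.n j)) ℝ :=
  fromBlocks (-X.X11 i j) (if j ≤ i then -X.X12 i j else (X.X12 j i)ᵀ)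
    (if j ≤ i then -X.X12 i j else (X.X12 j i)ᵀ)ᵀ (X.X11 j i)

/-- The components of a vector of signals that belong to the edge from `i` to `j`. -/
def edgeSig {i : Fin L} (y : OwnX S i ⊕ NbrX S i → ℝ) (j : Nbr S i) :
    Fin (S.n i) ⊕ Fin (S.n j.1) → ℝ :=
  Sum.elim (fun a => y (Sum.inl ⟨j, a⟩)) fun b => y (Sum.inr ⟨j, b⟩)

/-- All four blocks of the scale are diagonal over the neighbours, so it decouples into one small
matrix per edge, and completions can be built edge by edge. -/
theorem Scales.Z_form (X : Scales S) (i : Fin L) (y : OwnX S i ⊕ NbrX S i → ℝ) :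
    y ⬝ᵥ X.Z i *ᵥ y = ∑ j : Nbr S i, edgeSig y j ⬝ᵥ X.edge i j.1 *ᵥ edgeSig y j := by
  have hT : (X.Z12 i)ᵀ = blockDiagonal' fun j : Nbr S i =>
      (if j.1 ≤ i then -X.X12 i j.1 else (X.X12 j.1 i)ᵀ)ᵀ := by
    rw [Scales.Z12, blockDiagonal'_transpose]
  rw [Scales.Z, hT, Scales.Z11, Scales.Z12, Scales.Z22, ← blockDiagonal'_neg, fromBlocks_mulVec,
    dotProduct_block]
  simp only [Sum.elim_comp_inl, Sum.elim_comp_inr, edgeSig, Scales.edge, fromBlocks_mulVec,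
    sumElim_dotProduct_sumElim, Finset.sum_add_distrib]
  simp only [dotProduct, Fintype.sum_sigma, Pi.add_apply, blockDiagonal'_mulVec_apply,
    Function.comp_apply]
  rfl

/-- Value of the form of `middle`. -/
theorem middle_form {i : Fin L} (P : Matrix (Fin (S.n i)) (Fin (S.n i)) ℝ)
    (Z : Matrix (OwnX S i ⊕ NbrX S i) (OwnX S i ⊕ NbrX S i) ℝ) (a : ℝ)
    (D : Matrix (RegIdx S i ⊕ Fin (S.n i)) (RegIdx S i ⊕ Fin (S.n i)) ℝ) (g : ℝ)
    (x x' : Fin (S.n i) → ℝ) (y : OwnX S i ⊕ NbrX S i → ℝ) (f : Fin (S.n i) ⊕ RegIdx S i → ℝ)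
    (w : Fin (S.n i) → ℝ) (z : Fin (S.r i) → ℝ) :
    Sum.elim (Sum.elim x x') (Sum.elim y (Sum.elim f (Sum.elim w z))) ⬝ᵥ middle P Z a D g *ᵥ
      Sum.elim (Sum.elim x x') (Sum.elim y (Sum.elim f (Sum.elim w z))) =
    -(x ⬝ᵥ P *ᵥ x) + x' ⬝ᵥ P *ᵥ x' + y ⬝ᵥ Z *ᵥ y + f ⬝ᵥ flipScale a D *ᵥ f - g * (w ⬝ᵥ w)
      + z ⬝ᵥ z := by
  simp only [middle, fromBlocks_mulVec, sumElim_dotProduct_sumElim, Sum.elim_comp_inl,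
    Sum.elim_comp_inr, zero_mulVec, add_zero, zero_add, neg_mulVec, dotProduct_neg, smul_mulVec,
    one_mulVec, dotProduct_smul, smul_eq_mul]
  ring

theorem flipScale_eq {i : Fin L} (a : ℝ)
    {D : Matrix (RegIdx S i ⊕ Fin (S.n i)) (RegIdx S i ⊕ Fin (S.n i)) ℝ} (hD : D.IsSymm) :
    flipScale a D = -(a • D.submatrix (Equiv.sumComm _ _) (Equiv.sumComm _ _)) := by
  ext x y
  rcases x with x | x <;> rcases y with y | y <;> simp [flipScale, toBlocks₁₁, toBlocks₁₂,
    toBlocks₂₂, hD.apply]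

theorem flipScale_isSymm {i : Fin L} (a : ℝ)
    {D : Matrix (RegIdx S i ⊕ Fin (S.n i)) (RegIdx S i ⊕ Fin (S.n i)) ℝ} (hD : D.IsSymm) :
    (flipScale a D).IsSymm := by
  rw [flipScale_eq a hD]
  exact ((hD.submatrix _).smul a).neg

/-- Flipping is a permutation with a factor -a, and the two signs cancel in the product. Hence α
with the inverse data matrix in the primal inequality is matched by α⁻¹ with the data matrix itself
in the dual one. -/
theorem flipScale_mul_inv {i : Fin L} {a : ℝ} (ha : a ≠ 0)
    {D : Matrix (RegIdx S i ⊕ Fin (S.n i)) (RegIdx S i ⊕ Fin (S.n i)) ℝ} (hD : D.IsSymm)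
    (hdet : IsUnit D.det) : flipScale a⁻¹ D * flipScale a D⁻¹ = 1 := by
  have hDi : (D⁻¹).IsSymm := by rw [IsSymm, transpose_nonsing_inv, hD.eq]
  rw [flipScale_eq _ hD, flipScale_eq _ hDi, neg_mul_neg, smul_mul_smul_comm,
    inv_mul_cancel₀ ha, one_smul, submatrix_mul_equiv, mul_nonsing_inv _ hdet,
    submatrix_one_equiv]

/-- The sign turns nonpositivity on (p, Δ p) into nonnegativity of the multiplier on (Δ p, p). -/
theorem flipScale_form {i : Fin L} (a : ℝ)
    {D : Matrix (RegIdx S i ⊕ Fin (S.n i)) (RegIdx S i ⊕ Fin (S.n i)) ℝ} (hD : D.IsSymm)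
    (l : Fin (S.n i) → ℝ) (p : RegIdx S i → ℝ) :
    Sum.elim l p ⬝ᵥ flipScale a D *ᵥ Sum.elim l p =
      -(a * (Sum.elim p l ⬝ᵥ D *ᵥ Sum.elim p l)) := by
  rw [flipScale_eq a hD, neg_mulVec, dotProduct_neg, smul_mulVec, dotProduct_smul,
    submatrix_mulVec_equiv, ← comp_equiv_symm_dotProduct]
  have : Sum.elim l p ∘ (Equiv.sumComm (Fin (S.n i)) (RegIdx S i)).symm = Sum.elim p l := by
    funext k
    rcases k with k | k <;> rfl
  rw [this, smul_eq_mul]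

/-- The direction in which the input `u_i` acts. -/
def inputCol {i : Fin L} (O : Outputs S i) (u : Fin (S.m i) → ℝ) : MidIdx S i → ℝ :=
  Sum.elim 0 (Sum.elim 0 (Sum.elim (Sum.elim 0 (Sum.elim 0 (Sum.elim 0 u)))
    (Sum.elim 0 (O.Dz *ᵥ u))))

theorem onesKron_mulVec (i : Fin L) (x : Fin (S.n i) → ℝ) :
    onesKron S i *ᵥ x = fun a => x a.2 := by
  funext a
  simp [onesKron, mulVec, dotProduct]

theorem outer_mulVec {i : Fin L} (O : Outputs S i) (x : Fin (S.n i) → ℝ) (xN : NbrX S i → ℝ)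
    (l w : Fin (S.n i) → ℝ) :
    outer O *ᵥ Sum.elim x (Sum.elim xN (Sum.elim l w)) =
      Sum.elim (Sum.elim x (l + w)) (Sum.elim (Sum.elim (fun a => x a.2) xN)
        (Sum.elim (Sum.elim l (Sum.elim x (Sum.elim xN 0)))
          (Sum.elim w (O.Cz *ᵥ x + O.CzN *ᵥ xN)))) := by
  simp only [outer, inRow, fromRows_mulVec, fromCols_mulVec_sumElim, one_mulVec, zero_mulVec,
    add_zero, zero_add, onesKron_mulVec]
  congr 5
  funext k
  rcases k with k | k | k <;> simp

theorem measMat_mulVec {i : Fin L} (O : Outputs S i) (x : Fin (S.n i) → ℝ) (xN : NbrX S i → ℝ)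
    (l w : Fin (S.n i) → ℝ) :
    measMat O *ᵥ Sum.elim x (Sum.elim xN (Sum.elim l w)) = O.C *ᵥ x := by
  simp [measMat, inRow]

theorem exists_basis_coords {α β δ : Type} [Fintype β] [Fintype δ] {M : Matrix α β ℝ}
    {K : Matrix β δ ℝ} (h : IsKerBasis M K) {x : β → ℝ} (hx : M *ᵥ x = 0) :
    ∃ c, K *ᵥ c = x := by
  have h1 : x ∈ Submodule.span ℝ (Set.range K.col) := by
    rw [h.2]
    exact hx
  rw [← range_mulVecLin] at h1
  exact h1

theorem primal_neg_of_basis {i : Fin L} {O : Outputs S i} {k : ℕ}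
    {Ψ : Matrix (InIdx S i) (Fin k) ℝ} (hΨ : IsKerBasis (measMat O) Ψ)
    {A : Matrix (MidIdx S i) (MidIdx S i) ℝ}
    (h : ∀ c, c ≠ 0 → 0 < c ⬝ᵥ (-(Ψᵀ * ((outer O)ᵀ * A * outer O) * Ψ)) *ᵥ c) (y : InIdx S i → ℝ)
    (hy : measMat O *ᵥ y = 0) (hy0 : y ≠ 0) : (outer O *ᵥ y) ⬝ᵥ A *ᵥ (outer O *ᵥ y) < 0 := by
  obtain ⟨c, rfl⟩ := exists_basis_coords hΨ hy
  have hc : c ≠ 0 := by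
    rintro rfl
    exact hy0 (mulVec_zero _)
  have h1 := h c hc
  rw [neg_mulVec, dotProduct_neg, ← mulVec_mulVec, ← mulVec_mulVec, ← mulVec_mulVec,
    ← mulVec_mulVec, dotProduct_mulVec, vecMul_transpose, dotProduct_mulVec, vecMul_transpose]
    at h1
  linarith

/-- Each of the four column blocks of `outer` contains one identity row block that determines the
components x_i, x_N, l_i, w_i of η from the other four. So η is recovered from those, and
`outerPerp` reaches the whole kernel. -/
theorem outerPerp_mulVec {i : Fin L} (O : Outputs S i) (η : MidIdx S i → ℝ)
    (h : (outer O)ᵀ *ᵥ η = 0) :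
    outerPerp O *ᵥ Sum.elim (fun a => η (Sum.inl (Sum.inr a)))
      (Sum.elim (fun a => η (Sum.inr (Sum.inl (Sum.inl a))))
        (Sum.elim (fun a => η (Sum.inr (Sum.inr (Sum.inl (Sum.inr a)))))
          (fun a => η (Sum.inr (Sum.inr (Sum.inr (Sum.inr a))))))) = η := by
  have e : η = Sum.elim (Sum.elim (fun a => η (Sum.inl (Sum.inl a)))
        (fun a => η (Sum.inl (Sum.inr a))))
      (Sum.elim (Sum.elim (fun a => η (Sum.inr (Sum.inl (Sum.inl a))))
        (fun a => η (Sum.inr (Sum.inl (Sum.inr a)))))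
        (Sum.elim (Sum.elim (fun a => η (Sum.inr (Sum.inr (Sum.inl (Sum.inl a)))))
          (Sum.elim (fun a => η (Sum.inr (Sum.inr (Sum.inl (Sum.inr (Sum.inl a))))))
            (Sum.elim (fun a => η (Sum.inr (Sum.inr (Sum.inl (Sum.inr (Sum.inr (Sum.inl a)))))))
             (fun a => η (Sum.inr (Sum.inr (Sum.inl (Sum.inr (Sum.inr (Sum.inr a))))))))))
          (Sum.elim (fun a => η (Sum.inr (Sum.inr (Sum.inr (Sum.inl a)))))
            (fun a => η (Sum.inr (Sum.inr (Sum.inr (Sum.inr a)))))))) := by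
    funext k
    rcases k with (k | k) | (k | k) | (k | k | k | k) | (k | k) <;> rfl
  have e3 : (fun a => η (Sum.inr (Sum.inr (Sum.inl (Sum.inr a))))) =
      Sum.elim (fun a => η (Sum.inr (Sum.inr (Sum.inl (Sum.inr (Sum.inl a))))))
            (Sum.elim (fun a => η (Sum.inr (Sum.inr (Sum.inl (Sum.inr (Sum.inr (Sum.inl a)))))))
             (fun a => η (Sum.inr (Sum.inr (Sum.inl (Sum.inr (Sum.inr (Sum.inr a)))))))) := by
    funext k
    rcases k with k | k | k <;> rfl
  rw [e3]
  rw [e] at h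
  conv_rhs => rw [e]
  generalize (fun a => η (Sum.inl (Sum.inl a))) = ηx at *
  generalize (fun a => η (Sum.inl (Sum.inr a))) = ηx' at *
  generalize (fun a => η (Sum.inr (Sum.inl (Sum.inl a)))) = ηo at *
  generalize (fun a => η (Sum.inr (Sum.inl (Sum.inr a)))) = ηn at *
  generalize (fun a => η (Sum.inr (Sum.inr (Sum.inl (Sum.inl a))))) = ηl at *
  generalize (fun a => η (Sum.inr (Sum.inr (Sum.inl (Sum.inr (Sum.inl a)))))) = ηp at *
  generalize (fun a => η (Sum.inr (Sum.inr (Sum.inl (Sum.inr (Sum.inr (Sum.inl a))))))) = ηq at *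
  generalize (fun a => η (Sum.inr (Sum.inr (Sum.inl (Sum.inr (Sum.inr (Sum.inr a))))))) = ηu at *
  generalize (fun a => η (Sum.inr (Sum.inr (Sum.inr (Sum.inl a))))) = ηw at *
  generalize (fun a => η (Sum.inr (Sum.inr (Sum.inr (Sum.inr a))))) = ηz at *
  clear e e3
  simp only [outer, inRow, transpose_fromRows, transpose_fromCols, fromRows_mulVec,
    fromCols_mulVec_sumElim, transpose_one, transpose_zero, one_mulVec, zero_mulVec, add_zero,
    zero_add] at h
  simp only [outerPerp, outRow, fromRows_mulVec, fromCols_mulVec_sumElim, one_mulVec, zero_mulVec,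
    add_zero, zero_add, neg_mulVec]
  have h1 : ∀ k, _ = (0 : ℝ) := fun k => congrFun h (Sum.inl k)
  have h2 : ∀ k, _ = (0 : ℝ) := fun k => congrFun h (Sum.inr (Sum.inl k))
  have h3 : ∀ k, _ = (0 : ℝ) := fun k => congrFun h (Sum.inr (Sum.inr (Sum.inl k)))
  have h4 : ∀ k, _ = (0 : ℝ) := fun k => congrFun h (Sum.inr (Sum.inr (Sum.inr k)))
  simp only [Pi.add_apply, Sum.elim_inl, Sum.elim_inr, Pi.zero_apply, add_zero, zero_add]
    at h1 h2 h3 h4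
  congr 1
  · congr 1
    funext k
    simp only [Pi.add_apply, Pi.neg_apply]
    linarith [h1 k]
  · congr 1
    · congr 1
      funext k
      simp only [Pi.add_apply, Pi.neg_apply]
      linarith [h2 k]
    · congr 1
      · congr 1
        funext k
        simp only [Pi.neg_apply]
        linarith [h3 k]
      · congr 1
        funext k
        simp only [Pi.neg_apply]
        linarith [h4 k]

/-- In the coordinates provided by `outerPerp`, annihilating the input directions is the equation of
the kernel of `actMat`, for which Φ is a basis. -/
theorem dual_pos_of_basis {i : Fin L} {O : Outputs S i} {k : ℕ}
    {Φ : Matrix (OutIdx S i) (Fin k) ℝ} (hΦ : IsKerBasis (actMat O) Φ)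
    {A : Matrix (MidIdx S i) (MidIdx S i) ℝ}
    (h : ∀ c, c ≠ 0 → 0 < c ⬝ᵥ (Φᵀ * ((outerPerp O)ᵀ * A * outerPerp O) * Φ) *ᵥ c) (η : MidIdx S i → ℝ)
    (hη : ∀ y, η ⬝ᵥ outer O *ᵥ y = 0) (hu : ∀ u, η ⬝ᵥ inputCol O u = 0) (hη0 : η ≠ 0) :
    0 < η ⬝ᵥ A *ᵥ η := by
  have h1 : (outer O)ᵀ *ᵥ η = 0 := eq_of_dotProduct_eq fun z => by
    rw [mulVec_transpose, ← dotProduct_mulVec, hη, zero_dotProduct]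
  have h2 := outerPerp_mulVec O η h1
  set ζ : OutIdx S i → ℝ := Sum.elim (fun a => η (Sum.inl (Sum.inr a)))
      (Sum.elim (fun a => η (Sum.inr (Sum.inl (Sum.inl a))))
        (Sum.elim (fun a => η (Sum.inr (Sum.inr (Sum.inl (Sum.inr a)))))
          (fun a => η (Sum.inr (Sum.inr (Sum.inr (Sum.inr a))))))) with hζ
  have h3 : actMat O *ᵥ ζ = 0 := eq_of_dotProduct_eq fun u => by
    have h4 := hu u
    simp only [inputCol, dotProduct_block, Sum.elim_comp_inl, Sum.elim_comp_inr,
      dotProduct_zero, zero_add, dotProduct_mulVec] at h4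
    rw [zero_dotProduct, ← h4, hζ, actMat, outRow, fromCols_mulVec_sumElim,
      fromCols_mulVec_sumElim, fromCols_mulVec_sumElim, fromCols_mulVec, fromCols_mulVec,
      mulVec_transpose]
    simp only [zero_mulVec, zero_add, one_mulVec, add_dotProduct]
    rfl
  obtain ⟨c, hc⟩ := exists_basis_coords hΦ h3
  have hc0 : c ≠ 0 := by
    rintro rfl
    rw [mulVec_zero] at hc
    rw [← hc, mulVec_zero] at h2
    exact hη0 h2.symm
  have h6 := h c hc0
  rw [← mulVec_mulVec, ← mulVec_mulVec, ← mulVec_mulVec, ← mulVec_mulVec, dotProduct_mulVec,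
    vecMul_transpose, dotProduct_mulVec, vecMul_transpose, hc, h2] at h6
  exact h6

end LocalForms

/-! ### The supply and storage form of one controlled subsystem -/

noncomputable section LocalSynthesis

variable {L : ℕ} {S : Network L}

/-- All signals of the controlled subsystem `i`: `(x_i, ξ_i)`, `(x_i^+, ξ_i^+)`, for each
neighbour `((x_i, x_j), (o_ij, s_ij))`, `(l_i, p_i)`, `w_i`, `z_i`. -/
abbrev Signals (S : Network L) (i : Fin L) : Type :=
  ((Fin (S.n i) → ℝ) × (Fin (S.n i) → ℝ)) × ((Fin (S.n i) → ℝ) × (Fin (S.n i) → ℝ)) ×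
    ((j : Nbr S i) → (Fin (S.n i) ⊕ Fin (S.n j.1) → ℝ) ×
      ((Fin (chan S i j.1) → ℝ) × (Fin (chan S j.1 i) → ℝ))) ×
    (Fin (S.n i) ⊕ RegIdx S i → ℝ) × (Fin (S.n i) → ℝ) × (Fin (S.r i) → ℝ)

/-- The signals of the uncontrolled subsystem together with the controller signals
`ξ_i`, `ξ_i^+`, `o_i`, `s_i`. -/
abbrev SplitSignals (S : Network L) (i : Fin L) : Type :=
  (MidIdx S i → ℝ) × (Fin (S.n i) → ℝ) × (Fin (S.n i) → ℝ) × (OIdx S i → ℝ) × (SIdx S i → ℝ)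

/-- Regrouping of the signals. -/
def toSignals (S : Network L) (i : Fin L) : SplitSignals S i →ₗ[ℝ] Signals S i where
  toFun v := ((fun a => v.1 (Sum.inl (Sum.inl a)), v.2.1),
    (fun a => v.1 (Sum.inl (Sum.inr a)), v.2.2.1),
    (fun j => (edgeSig (fun a => v.1 (Sum.inr (Sum.inl a))) j,
      (fun c => v.2.2.2.1 ⟨j, c⟩, fun c => v.2.2.2.2 ⟨j, c⟩))),
    fun a => v.1 (Sum.inr (Sum.inr (Sum.inl a))),
    fun a => v.1 (Sum.inr (Sum.inr (Sum.inr (Sum.inl a)))),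
    fun a => v.1 (Sum.inr (Sum.inr (Sum.inr (Sum.inr a)))))
  map_add' v w := by
    refine Prod.ext rfl (Prod.ext rfl (Prod.ext ?_ rfl))
    funext j
    refine Prod.ext ?_ rfl
    funext a
    rcases a with a | a <;> rfl
  map_smul' c v := by
    refine Prod.ext rfl (Prod.ext rfl (Prod.ext ?_ rfl))
    funext j
    refine Prod.ext ?_ rfl
    funext a
    rcases a with a | a <;> rfl

/-- The signals of the uncontrolled subsystem. -/
def Signals.mid {i : Fin L} (v : Signals S i) : MidIdx S i → ℝ :=
  Sum.elim (Sum.elim v.1.1 v.2.1.1)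
    (Sum.elim (Sum.elim (fun a => (v.2.2.1 a.1).1 (Sum.inl a.2))
      (fun a => (v.2.2.1 a.1).1 (Sum.inr a.2)))
    (Sum.elim v.2.2.2.1 (Sum.elim v.2.2.2.2.1 v.2.2.2.2.2)))

/-- `toSignals` is onto, with an explicit preimage. -/
theorem toSignals_mid {i : Fin L} (v : Signals S i) :
    toSignals S i (v.mid, v.1.2, v.2.1.2, fun a => (v.2.2.1 a.1).2.1 a.2,
      fun a => (v.2.2.1 a.1).2.2 a.2) = v := by
  refine Prod.ext rfl (Prod.ext rfl (Prod.ext ?_ rfl))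
  funext j
  refine Prod.ext ?_ rfl
  funext a
  rcases a with a | a <;> rfl

/-- Pairing of the uncontrolled signals, by groups. -/
theorem dotProduct_mid {i : Fin L} (η : MidIdx S i → ℝ) (v : Signals S i) :
    η ⬝ᵥ v.mid = (fun a => η (Sum.inl (Sum.inl a))) ⬝ᵥ v.1.1 +
      (fun a => η (Sum.inl (Sum.inr a))) ⬝ᵥ v.2.1.1 +
      ∑ j, edgeSig (fun a => η (Sum.inr (Sum.inl a))) j ⬝ᵥ (v.2.2.1 j).1 +
      (fun a => η (Sum.inr (Sum.inr (Sum.inl a)))) ⬝ᵥ v.2.2.2.1 +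
      (fun a => η (Sum.inr (Sum.inr (Sum.inr (Sum.inl a))))) ⬝ᵥ v.2.2.2.2.1 +
      (fun a => η (Sum.inr (Sum.inr (Sum.inr (Sum.inr a))))) ⬝ᵥ v.2.2.2.2.2 := by
  have h : ∀ j, edgeSig (fun a => η (Sum.inr (Sum.inl a))) j ⬝ᵥ (v.2.2.1 j).1 =
      (fun a => η (Sum.inr (Sum.inl (Sum.inl ⟨j, a⟩)))) ⬝ᵥ (fun a => (v.2.2.1 j).1 (Sum.inl a)) +
      (fun a => η (Sum.inr (Sum.inl (Sum.inr ⟨j, a⟩)))) ⬝ᵥ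
        (fun a => (v.2.2.1 j).1 (Sum.inr a)) := by
    intro j
    rw [dotProduct_block]
    rfl
  simp only [h, Finset.sum_add_distrib]
  simp only [Signals.mid, dotProduct, Fintype.sum_sum_type, Fintype.sum_sigma, Sum.elim_inl,
    Sum.elim_inr]
  ring

/-- The supply and storage form of the controlled subsystem. -/
def localForm {i : Fin L}
    (GP : LinearMap.BilinForm ℝ ((Fin (S.n i) → ℝ) × (Fin (S.n i) → ℝ)))
    (G : (j : Nbr S i) → LinearMap.BilinForm ℝ ((Fin (S.n i) ⊕ Fin (S.n j.1) → ℝ) ×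
      ((Fin (chan S i j.1) → ℝ) × (Fin (chan S j.1 i) → ℝ))))
    (T : Matrix (Fin (S.n i) ⊕ RegIdx S i) (Fin (S.n i) ⊕ RegIdx S i) ℝ) (g : ℝ) :
    LinearMap.BilinForm ℝ (Signals S i) :=
  LinearMap.mk₂ ℝ (fun v w => -GP v.1 w.1 + GP v.2.1 w.2.1 + ∑ j, G j (v.2.2.1 j) (w.2.2.1 j) +
      matForm T v.2.2.2.1 w.2.2.2.1 - g * (v.2.2.2.2.1 ⬝ᵥ w.2.2.2.2.1) +
      v.2.2.2.2.2 ⬝ᵥ w.2.2.2.2.2)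
    (fun u v w => by
      simp only [Prod.fst_add, Prod.snd_add, map_add, LinearMap.add_apply, Pi.add_apply,
        Finset.sum_add_distrib, add_dotProduct]
      ring)
    (fun c v w => by
      simp only [Prod.smul_fst, Prod.smul_snd, map_smul, LinearMap.smul_apply, Pi.smul_apply,
        smul_dotProduct, smul_eq_mul, ← Finset.mul_sum]
      ring)
    (fun u v w => by
      simp only [Prod.fst_add, Prod.snd_add, map_add, Pi.add_apply,
        Finset.sum_add_distrib, dotProduct_add]
      ring)
    (fun c v w => by
      simp only [Prod.smul_fst, Prod.smul_snd, map_smul, Pi.smul_apply,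
        dotProduct_smul, smul_eq_mul, ← Finset.mul_sum]
      ring)

section

variable {i : Fin L}
  {GP : LinearMap.BilinForm ℝ ((Fin (S.n i) → ℝ) × (Fin (S.n i) → ℝ))}
  {G : (j : Nbr S i) → LinearMap.BilinForm ℝ ((Fin (S.n i) ⊕ Fin (S.n j.1) → ℝ) ×
      ((Fin (chan S i j.1) → ℝ) × (Fin (chan S j.1 i) → ℝ)))}
  {T : Matrix (Fin (S.n i) ⊕ RegIdx S i) (Fin (S.n i) ⊕ RegIdx S i) ℝ} {g : ℝ}

theorem localForm_apply (v w : Signals S i) : localForm GP G T g v w =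
    -GP v.1 w.1 + GP v.2.1 w.2.1 + ∑ j, G j (v.2.2.1 j) (w.2.2.1 j) +
      v.2.2.2.1 ⬝ᵥ T *ᵥ w.2.2.2.1 - g * (v.2.2.2.2.1 ⬝ᵥ w.2.2.2.2.1) +
      v.2.2.2.2.2 ⬝ᵥ w.2.2.2.2.2 := rfl

/-- The components of the functional `localForm v`. -/
theorem localForm_components (hT : T.IsSymm) (v : Signals S i) (η : MidIdx S i → ℝ)
    (h : ∀ w, localForm GP G T g v w = η ⬝ᵥ w.mid) :
    (∀ e f, GP v.1 (e, f) = (-fun a => η (Sum.inl (Sum.inl a))) ⬝ᵥ e) ∧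
    (∀ e f, GP v.2.1 (e, f) = (fun a => η (Sum.inl (Sum.inr a))) ⬝ᵥ e) ∧
    (∀ j e f, G j (v.2.2.1 j) (e, f) = edgeSig (fun a => η (Sum.inr (Sum.inl a))) j ⬝ᵥ e) ∧
    T *ᵥ v.2.2.2.1 = (fun a => η (Sum.inr (Sum.inr (Sum.inl a)))) ∧
    (-g) • v.2.2.2.2.1 = (fun a => η (Sum.inr (Sum.inr (Sum.inr (Sum.inl a))))) ∧
    v.2.2.2.2.2 = (fun a => η (Sum.inr (Sum.inr (Sum.inr (Sum.inr a))))) := by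
  simp only [localForm_apply, dotProduct_mid] at h
  refine ⟨fun e f => ?_, fun e f => ?_, fun j e f => ?_, ?_, ?_, ?_⟩
  -- Test signals supported in a single group isolate its component; the sign here stems from -GP.
  · have := h ((e, f), 0, 0, 0, 0, 0)
    simp at this
    rw [neg_dotProduct, ← this, neg_neg]
  · have := h (0, (e, f), 0, 0, 0, 0)
    simpa using this
  · have := h (0, 0, Pi.single j (e, f), 0, 0, 0)
    dsimp only at this
    rw [Finset.sum_eq_single j (fun k _ hk => by rw [Pi.single_eq_of_ne hk, map_zero]) (by simp),
      Finset.sum_eq_single j (fun k _ hk => by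
        rw [Pi.single_eq_of_ne hk, Prod.fst_zero, dotProduct_zero]) (by simp),
      Pi.single_eq_same] at this
    simpa using this
  · refine eq_of_dotProduct_eq fun z => ?_
    have := h (0, 0, 0, z, 0, 0)
    rw [mulVec_dotProduct_of_symm hT]
    simpa using this
  · refine eq_of_dotProduct_eq fun z => ?_
    have := h (0, 0, 0, 0, z, 0)
    simpa using this
  · refine eq_of_dotProduct_eq fun z => ?_
    have := h (0, 0, 0, 0, 0, z)
    simpa using this

theorem localForm_symm (hGP : ∀ v w, GP v w = GP w v) (hG : ∀ j v w, G j v w = G j w v)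
    (hT : T.IsSymm) (v w : Signals S i) :
    localForm GP G T g v w = localForm GP G T g w v := by
  rw [localForm_apply, localForm_apply, hGP v.1, hGP v.2.1, dotProduct_mulVec_symm hT,
    dotProduct_comm v.2.2.2.2.1, dotProduct_comm v.2.2.2.2.2]
  simp only [hG _ (v.2.2.1 _)]

/-- On the signals of the uncontrolled subsystem `localForm` is the form of `middle`. -/
theorem localForm_restrict {P Pb : Matrix (Fin (S.n i)) (Fin (S.n i)) ℝ} {X Xb : Scales S} {a : ℝ}
    {D : Matrix (RegIdx S i ⊕ Fin (S.n i)) (RegIdx S i ⊕ Fin (S.n i)) ℝ}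
    (hGP : IsCompletion GP P Pb)
    (hG : ∀ j : Nbr S i, IsCompletion (G j) (X.edge i j.1) (Xb.edge i j.1)) (y : MidIdx S i → ℝ) :
    localForm GP G (flipScale a D) g (toSignals S i (y, 0)) (toSignals S i (y, 0)) =
      y ⬝ᵥ middle P (X.Z i) a D g *ᵥ y := by
  have hy : y = Sum.elim (Sum.elim (fun a => y (Sum.inl (Sum.inl a)))
      (fun a => y (Sum.inl (Sum.inr a)))) (Sum.elim (fun a => y (Sum.inr (Sum.inl a)))
        (Sum.elim (fun a => y (Sum.inr (Sum.inr (Sum.inl a))))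
          (Sum.elim (fun a => y (Sum.inr (Sum.inr (Sum.inr (Sum.inl a)))))
            (fun a => y (Sum.inr (Sum.inr (Sum.inr (Sum.inr a)))))))) := by
    funext k
    rcases k with (k | k) | k | k | (k | k) <;> rfl
  have h := middle_form P (X.Z i) a D g (fun a => y (Sum.inl (Sum.inl a)))
    (fun a => y (Sum.inl (Sum.inr a))) (fun a => y (Sum.inr (Sum.inl a)))
    (fun a => y (Sum.inr (Sum.inr (Sum.inl a))))
    (fun a => y (Sum.inr (Sum.inr (Sum.inr (Sum.inl a)))))
    (fun a => y (Sum.inr (Sum.inr (Sum.inr (Sum.inr a)))))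
  rw [← hy, Scales.Z_form, ← hGP.restrict, ← hGP.restrict] at h
  simp only [← (hG _).restrict] at h
  exact h.symm

/-- On functionals that vanish on the controller signals the dual of `localForm` is the form of
the dual `middle`. -/
theorem localForm_dual {P Pb : Matrix (Fin (S.n i)) (Fin (S.n i)) ℝ} {X Xb : Scales S} {a : ℝ}
    (ha : a ≠ 0) {D : Matrix (RegIdx S i ⊕ Fin (S.n i)) (RegIdx S i ⊕ Fin (S.n i)) ℝ}
    (hD : D.IsSymm) (hdet : IsUnit D.det) (hGP : IsCompletion GP P Pb)
    (hG : ∀ j : Nbr S i, IsCompletion (G j) (X.edge i j.1) (Xb.edge i j.1)) (v : Signals S i)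
    (η : MidIdx S i → ℝ) (h : ∀ w, localForm GP G (flipScale a D⁻¹) g v w = η ⬝ᵥ w.mid) :
    localForm GP G (flipScale a D⁻¹) g v v =
      η ⬝ᵥ middle Pb (Xb.Z i) a⁻¹ D g⁻¹ *ᵥ η := by
  have hDi : (D⁻¹).IsSymm := by rw [IsSymm, transpose_nonsing_inv, hD.eq]
  obtain ⟨h1, h2, h3, h4, h5, h6⟩ := localForm_components (flipScale_isSymm a hDi) v η h
  have hy : η = Sum.elim (Sum.elim (fun a => η (Sum.inl (Sum.inl a)))
      (fun a => η (Sum.inl (Sum.inr a)))) (Sum.elim (fun a => η (Sum.inr (Sum.inl a)))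
        (Sum.elim (fun a => η (Sum.inr (Sum.inr (Sum.inl a))))
          (Sum.elim (fun a => η (Sum.inr (Sum.inr (Sum.inr (Sum.inl a)))))
            (fun a => η (Sum.inr (Sum.inr (Sum.inr (Sum.inr a)))))))) := by
    funext k
    rcases k with (k | k) | k | k | (k | k) <;> rfl
  have h7 := middle_form Pb (Xb.Z i) a⁻¹ D g⁻¹ (fun a => η (Sum.inl (Sum.inl a)))
    (fun a => η (Sum.inl (Sum.inr a))) (fun a => η (Sum.inr (Sum.inl a)))
    (fun a => η (Sum.inr (Sum.inr (Sum.inl a))))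
    (fun a => η (Sum.inr (Sum.inr (Sum.inr (Sum.inl a)))))
    (fun a => η (Sum.inr (Sum.inr (Sum.inr (Sum.inr a)))))
  rw [← hy, Scales.Z_form] at h7
  -- Group by group the form is replaced by its inverse: the completions supply the barred matrices,
  -- the multiplier its explicit inverse, and -g becomes -g⁻¹.
  rw [h7, localForm_apply, hGP.dual _ _ h1, hGP.dual _ _ h2,
    Finset.sum_congr rfl fun j _ => (hG j).dual _ _ (h3 j), ← h4, ← h5, ← h6]
  rw [mulVec_mulVec (v := v.2.2.2.1), flipScale_mul_inv ha hD hdet, one_mulVec,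
    dotProduct_comm (flipScale a D⁻¹ *ᵥ _) v.2.2.2.1]
  simp only [mulVec_neg, dotProduct_neg, neg_dotProduct, neg_neg, dotProduct_smul, smul_dotProduct,
    smul_eq_mul]
  field_simp

theorem localForm_nondeg {P Pb : Matrix (Fin (S.n i)) (Fin (S.n i)) ℝ} {X Xb : Scales S}
    (hT : T.IsSymm) (hdet : IsUnit T.det) (hg : g ≠ 0) (hGP : IsCompletion GP P Pb)
    (hG : ∀ j : Nbr S i, IsCompletion (G j) (X.edge i j.1) (Xb.edge i j.1)) (v : Signals S i)
    (h : ∀ w, localForm GP G T g v w = 0) : v = 0 := by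
  obtain ⟨h1, h2, h3, h4, h5, h6⟩ := localForm_components hT v 0
    fun w => by rw [h, zero_dotProduct]
  refine Prod.ext (hGP.nondeg _ fun w => ?_) (Prod.ext (hGP.nondeg _ fun w => ?_)
    (Prod.ext (funext fun j => (hG j).nondeg _ fun w => ?_) (Prod.ext ?_ (Prod.ext ?_ h6))))
  · rw [h1 w.1 w.2]
    exact neg_dotProduct .. |>.trans (by rw [neg_eq_zero]; exact zero_dotProduct _)
  · rw [h2 w.1 w.2]
    exact zero_dotProduct _
  · rw [h3 j w.1 w.2, dotProduct_block]
    exact (congrArg₂ (· + ·) (zero_dotProduct _) (zero_dotProduct _)).trans (add_zero 0)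
  · by_contra h0
    exact mulVec_ne_zero_of_isUnit_det hdet h0 h4
  · exact (smul_eq_zero_iff_right (neg_ne_zero.2 hg)).1 h5

end

end LocalSynthesis

/-! ### Controller synthesis for one subsystem -/

noncomputable section LocalController

variable {L : ℕ} {S : Network L} {i : Fin L}

/-- The free signals of subsystem `i`: `(x_i, x_N, l_i, w_i)`, `ξ_i` and `s_i`. -/
abbrev FreeSignals (S : Network L) (i : Fin L) : Type :=
  (InIdx S i → ℝ) × (Fin (S.n i) → ℝ) × (SIdx S i → ℝ)

/-- The signals of subsystem `i` with `(ξ_i^+, o_i, u_i) = 0`. -/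
def openLoop (O : Outputs S i) : FreeSignals S i →ₗ[ℝ] Signals S i :=
  toSignals S i ∘ₗ
    { toFun := fun x => (outer O *ᵥ x.1, x.2.1, 0, 0, x.2.2)
      map_add' := fun x y => by
        simp only [Prod.fst_add, Prod.snd_add, mulVec_add, Prod.mk_add_mk, add_zero]
      map_smul' := fun c x => by
        simp only [Prod.smul_fst, Prod.smul_snd, mulVec_smul, Prod.smul_mk, smul_zero,
          RingHom.id_apply] }

/-- The effect of `(ξ_i^+, o_i, u_i)` on the signals of subsystem `i`. -/
def controlEffect (O : Outputs S i) :
    (Fin (S.n i) ⊕ (OIdx S i ⊕ Fin (S.m i)) → ℝ) →ₗ[ℝ] Signals S i :=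
  toSignals S i ∘ₗ
    { toFun := fun r => (inputCol O (fun a => r (Sum.inr (Sum.inr a))), 0,
        fun a => r (Sum.inl a), fun a => r (Sum.inr (Sum.inl a)), 0)
      map_add' := fun r t => by
        refine Prod.ext ?_ (Prod.ext (add_zero 0).symm (Prod.ext rfl (Prod.ext rfl
          (add_zero 0).symm)))
        have h := congrFun (mulVec_add O.Dz (fun a => r (Sum.inr (Sum.inr a)))
          fun a => t (Sum.inr (Sum.inr a)))
        funext k
        simp only [inputCol, Prod.fst_add, Pi.add_apply]
        rcases k with k | k | (k | k | k | k) | (k | k)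
        case inr.inr.inr.inr => exact h k
        all_goals simp
      map_smul' := fun c r => by
        refine Prod.ext ?_ (Prod.ext (smul_zero c).symm (Prod.ext rfl (Prod.ext rfl
          (smul_zero c).symm)))
        have h := congrFun (mulVec_smul O.Dz c fun a => r (Sum.inr (Sum.inr a)))
        funext k
        simp only [inputCol, Prod.smul_fst, Pi.smul_apply]
        rcases k with k | k | (k | k | k | k) | (k | k)
        case inr.inr.inr.inr => exact h k
        all_goals simp }

/-- The controller input `(ξ_i, s_i, y_i)`. -/
def controlInput (O : Outputs S i) :
    FreeSignals S i →ₗ[ℝ] (Fin (S.n i) ⊕ (SIdx S i ⊕ Fin (S.p i)) → ℝ) where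
  toFun x := Sum.elim x.2.1 (Sum.elim x.2.2 (measMat O *ᵥ x.1))
  map_add' x y := by
    simp only [Prod.fst_add, Prod.snd_add, mulVec_add]
    funext k
    rcases k with k | k | k <;> rfl
  map_smul' c x := by
    simp only [Prod.smul_fst, Prod.smul_snd, mulVec_smul]
    funext k
    rcases k with k | k | k <;> rfl

/-- Recovery of the free signals. -/
def freePart (S : Network L) (i : Fin L) : Signals S i →ₗ[ℝ] FreeSignals S i where
  toFun v := (Sum.elim v.1.1 (Sum.elim (fun b => (v.2.2.1 b.1).1 (Sum.inr b.2))
    (Sum.elim (fun a => v.2.2.2.1 (Sum.inl a)) v.2.2.2.2.1)), v.1.2,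
    fun c => (v.2.2.1 c.1).2.2 c.2)
  map_add' v w := by
    refine Prod.ext ?_ rfl
    funext k
    rcases k with k | k | k | k <;> rfl
  map_smul' c v := by
    refine Prod.ext ?_ rfl
    funext k
    rcases k with k | k | k | k <;> rfl

theorem elim_inIdx (y : InIdx S i → ℝ) : Sum.elim (fun a => y (Sum.inl a))
    (Sum.elim (fun a => y (Sum.inr (Sum.inl a))) (Sum.elim
      (fun a => y (Sum.inr (Sum.inr (Sum.inl a)))) fun a => y (Sum.inr (Sum.inr (Sum.inr a))))) =
      y := by
  funext k
  rcases k with k | k | k | k <;> rfl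

/-- Together with `freePart_controlEffect` this makes `freePart` the projection π of the elimination
lemma: the control variables leave the free signals untouched. -/
theorem freePart_openLoop (O : Outputs S i) (x : FreeSignals S i) :
    freePart S i (openLoop O x) = x := by
  obtain ⟨y, ξ, s⟩ := x
  refine Prod.ext ?_ rfl
  rw [← elim_inIdx y]
  simp only [openLoop, LinearMap.comp_apply, LinearMap.coe_mk, AddHom.coe_mk, outer_mulVec]
  rfl

theorem freePart_controlEffect (O : Outputs S i) (r) :
    freePart S i (controlEffect O r) = 0 := by
  refine Prod.ext ?_ rfl
  funext k
  rcases k with k | k | k | k <;> rfl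

/-- Directions of all free signals on which `localForm` is negative. -/
theorem exists_negative_directions
    {GP : LinearMap.BilinForm ℝ ((Fin (S.n i) → ℝ) × (Fin (S.n i) → ℝ))}
    {G : (j : Nbr S i) → LinearMap.BilinForm ℝ ((Fin (S.n i) ⊕ Fin (S.n j.1) → ℝ) ×
      ((Fin (chan S i j.1) → ℝ) × (Fin (chan S j.1 i) → ℝ)))}
    {T : Matrix (Fin (S.n i) ⊕ RegIdx S i) (Fin (S.n i) ⊕ RegIdx S i) ℝ} {g : ℝ} (hg : 0 < g)
    (hGP : ∀ v, v ≠ 0 → 0 < GP v v)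
    (hT : ∀ l : Fin (S.n i) → ℝ, l ≠ 0 → Sum.elim l 0 ⬝ᵥ T *ᵥ Sum.elim l 0 < 0)
    (hJ : ∀ j : Nbr S i, ∃ J : ((Fin (S.n j.1) → ℝ) × (Fin (chan S j.1 i) → ℝ)) →ₗ[ℝ] _,
      ∀ x, x ≠ 0 → G j (J x) (J x) < 0) :
    ∃ J : FreeSignals S i →ₗ[ℝ] Signals S i, ∀ x, x ≠ 0 → localForm GP G T g (J x) (J x) < 0 := by
  choose J hJ using hJ
  -- This is the inertia count: -GP is negative in (x, ξ), each edge form in as many directions as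
  -- (x_j, s_ij) has components, T in l, and -g|w|² in w. Together they match the free signals
  -- exactly.
  refine ⟨{ toFun := fun x => ((fun a => x.1 (Sum.inl a), x.2.1), 0,
      (fun j => J j (fun b => x.1 (Sum.inr (Sum.inl ⟨j, b⟩)), fun c => x.2.2 ⟨j, c⟩)),
      Sum.elim (fun a => x.1 (Sum.inr (Sum.inr (Sum.inl a)))) 0,
      fun a => x.1 (Sum.inr (Sum.inr (Sum.inr a))), 0)
            map_add' := fun x y => ?_
            map_smul' := fun c x => ?_ }, ?_⟩
  · refine Prod.ext rfl (Prod.ext (add_zero 0).symm (Prod.ext ?_ (Prod.ext ?_ (Prod.ext rfl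
      (add_zero 0).symm))))
    · funext j
      exact (J j).map_add (fun b => x.1 (Sum.inr (Sum.inl ⟨j, b⟩)), fun c => x.2.2 ⟨j, c⟩)
        (fun b => y.1 (Sum.inr (Sum.inl ⟨j, b⟩)), fun c => y.2.2 ⟨j, c⟩)
    · funext k
      rcases k with k | k
      · rfl
      · exact (add_zero (0 : ℝ)).symm
  · refine Prod.ext rfl (Prod.ext (smul_zero c).symm (Prod.ext ?_ (Prod.ext ?_ (Prod.ext rfl
      (smul_zero c).symm))))
    · funext j
      exact (J j).map_smul c (fun b => x.1 (Sum.inr (Sum.inl ⟨j, b⟩)), fun c => x.2.2 ⟨j, c⟩)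
    · funext k
      rcases k with k | k
      · rfl
      · exact (smul_zero c).symm
  · rintro ⟨y, ξ, s⟩ hx
    rw [localForm_apply]
    simp only [LinearMap.coe_mk, AddHom.coe_mk]
    rw [LinearMap.map_zero, dotProduct_zero]
    set x := fun a => y (Sum.inl a) with hxdef
    set l := fun a => y (Sum.inr (Sum.inr (Sum.inl a))) with hl
    set w := fun a => y (Sum.inr (Sum.inr (Sum.inr a))) with hw
    set e := fun j : Nbr S i => ((fun b => y (Sum.inr (Sum.inl ⟨j, b⟩)), fun c => s ⟨j, c⟩) :
      (Fin (S.n j.1) → ℝ) × (Fin (chan S j.1 i) → ℝ)) with he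
    have h1 : 0 ≤ GP (x, ξ) (x, ξ) := by
      by_cases h : (x, ξ) = 0
      · rw [h, LinearMap.map_zero]
      · exact (hGP _ h).le
    have h2 : ∀ j, G j (J j (e j)) (J j (e j)) ≤ 0 := by
      intro j
      by_cases h : e j = 0
      · rw [h, LinearMap.map_zero, LinearMap.map_zero]
      · exact (hJ j _ h).le
    have h2' := Finset.sum_nonpos (s := Finset.univ) fun j _ => h2 j
    have h3 : Sum.elim l 0 ⬝ᵥ T *ᵥ Sum.elim l 0 ≤ 0 := by
      by_cases h : l = 0
      · rw [h, Sum.elim_zero_zero, zero_dotProduct]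
      · exact (hT _ h).le
    have h4 : 0 ≤ g * (w ⬝ᵥ w) := mul_nonneg hg.le (real_dotProduct_self_nonneg w)
    by_contra hcon
    push Not at hcon
    have e1 : (x, ξ) = 0 := by
      by_contra h
      linarith [hGP _ h]
    have e2 : ∀ j, e j = 0 := by
      intro j
      by_contra h
      have := Finset.single_le_sum (f := fun j => -(G j (J j (e j)) (J j (e j))))
        (fun j _ => neg_nonneg.2 (h2 j)) (Finset.mem_univ j)
      rw [Finset.sum_neg_distrib] at this
      linarith [hJ j _ h]
    have e3 : l = 0 := by
      by_contra h
      linarith [hT _ h]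
    have e4 : w = 0 := by
      by_contra h
      linarith [mul_pos hg (dotProduct_self_pos h)]
    obtain ⟨e5, e6⟩ := Prod.mk_eq_zero.1 e1
    refine hx (Prod.ext ?_ (Prod.ext e6 ?_))
    · funext k
      rcases k with k | k | k | k
      · exact congrFun e5 k
      · exact congrFun (congrArg Prod.fst (e2 k.1)) k.2
      · exact congrFun e3 k
      · exact congrFun e4 k
    · funext k
      exact congrFun (congrArg Prod.snd (e2 k.1)) k.2

/-- Synthesis for one subsystem. -/
theorem exists_local_controller (O : Outputs S i)
    {GP : LinearMap.BilinForm ℝ ((Fin (S.n i) → ℝ) × (Fin (S.n i) → ℝ))}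
    {G : (j : Nbr S i) → LinearMap.BilinForm ℝ ((Fin (S.n i) ⊕ Fin (S.n j.1) → ℝ) ×
      ((Fin (chan S i j.1) → ℝ) × (Fin (chan S j.1 i) → ℝ)))}
    {P Pb : Matrix (Fin (S.n i)) (Fin (S.n i)) ℝ} {X Xb : Scales S} {a g : ℝ}
    (ha : a ≠ 0) (hg : 0 < g)
    {D : Matrix (RegIdx S i ⊕ Fin (S.n i)) (RegIdx S i ⊕ Fin (S.n i)) ℝ}
    (hD : D.IsSymm) (hdet : IsUnit D.det) (hGP : IsCompletion GP P Pb)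
    (hGPpos : ∀ v, v ≠ 0 → 0 < GP v v)
    (hG : ∀ j : Nbr S i, IsCompletion (G j) (X.edge i j.1) (Xb.edge i j.1))
    (hT : ∀ l : Fin (S.n i) → ℝ, l ≠ 0 →
      Sum.elim l 0 ⬝ᵥ flipScale a D⁻¹ *ᵥ Sum.elim l 0 < 0)
    (hJ : ∀ j : Nbr S i, ∃ J : ((Fin (S.n j.1) → ℝ) × (Fin (chan S j.1 i) → ℝ)) →ₗ[ℝ] _,
      ∀ x, x ≠ 0 → G j (J x) (J x) < 0)
    (hprimal : ∀ y, measMat O *ᵥ y = 0 → y ≠ 0 →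
      (outer O *ᵥ y) ⬝ᵥ middle P (X.Z i) a D⁻¹ g *ᵥ (outer O *ᵥ y) < 0)
    (hdual : ∀ η, (∀ y, η ⬝ᵥ outer O *ᵥ y = 0) → (∀ u, η ⬝ᵥ inputCol O u = 0) → η ≠ 0 →
      0 < η ⬝ᵥ middle Pb (Xb.Z i) a⁻¹ D g⁻¹ *ᵥ η) :
    ∃ Θ : Matrix (Fin (S.n i) ⊕ (OIdx S i ⊕ Fin (S.m i))) (Fin (S.n i) ⊕ (SIdx S i ⊕ Fin (S.p i))) ℝ,
      ∀ x : FreeSignals S i, x ≠ 0 → localForm GP G (flipScale a D⁻¹) g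
        (openLoop O x + controlEffect O (Θ *ᵥ controlInput O x))
        (openLoop O x + controlEffect O (Θ *ᵥ controlInput O x)) < 0 := by
  have hDi : (D⁻¹).IsSymm := by rw [IsSymm, transpose_nonsing_inv, hD.eq]
  have hTs := flipScale_isSymm a hDi
  have hTdet : IsUnit (flipScale a D⁻¹).det :=
    isUnit_det_of_left_inverse (flipScale_mul_inv ha hD hdet)
  have hsymm := localForm_symm (g := g) hGP.symm (fun j => (hG j).symm) hTs
  have hnd := localForm_nondeg hTs hTdet hg.ne' hGP hG
  obtain ⟨J, hJ⟩ := exists_negative_directions hg hGPpos hT hJ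
  -- Zero controller input forces ξ = 0, s = 0 and y = 0, so only plant signals remain and the
  -- primal inequality applies.
  have hker : ∀ x, controlInput O x = 0 → x ≠ 0 →
      localForm GP G (flipScale a D⁻¹) g (openLoop O x) (openLoop O x) < 0 := by
    rintro ⟨y, ξ, s⟩ h0 hx
    have e1 : ξ = 0 := funext fun a => congrFun h0 (Sum.inl a)
    have e2 : s = 0 := funext fun a => congrFun h0 (Sum.inr (Sum.inl a))
    have e3 : measMat O *ᵥ y = 0 := funext fun a => congrFun h0 (Sum.inr (Sum.inr a))
    subst e1 e2
    have hy : y ≠ 0 := by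
      rintro rfl
      exact hx rfl
    have := hprimal y e3 hy
    rw [← localForm_restrict hGP hG] at this
    exact this
  have horth : ∀ v, (∀ x, localForm GP G (flipScale a D⁻¹) g v (openLoop O x) = 0) →
      (∀ r, localForm GP G (flipScale a D⁻¹) g v (controlEffect O r) = 0) → v ≠ 0 →
      0 < localForm GP G (flipScale a D⁻¹) g v v := by
    intro v h1 h2 hv
    set B := localForm GP G (flipScale a D⁻¹) g with hB
    -- the functional `B v` vanishes on controller signals
    let η : MidIdx S i → ℝ := fun k => B v (toSignals S i (Pi.single k 1, 0))
    have hη : ∀ y : MidIdx S i → ℝ, B v (toSignals S i (y, 0)) = η ⬝ᵥ y := by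
      intro y
      have h3 := LinearMap.pi_apply_eq_sum_univ
        (B v ∘ₗ toSignals S i ∘ₗ LinearMap.inl ℝ _ _) y
      have h4 : ∀ k : MidIdx S i, (fun j => if k = j then (1 : ℝ) else 0) = Pi.single k 1 := by
        intro k
        funext j
        simp [Pi.single_apply, eq_comm]
      simp only [h4, LinearMap.comp_apply, LinearMap.inl_apply, smul_eq_mul] at h3
      rw [h3, dotProduct_comm]
      rfl
    -- ξ and s are free, ξ' and o are manipulated, so every controller signal is a sum of an
    -- open-loop signal and a control effect.
    have hext : ∀ ξ ξ' o s, B v (toSignals S i (0, ξ, ξ', o, s)) = 0 := by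
      intro ξ ξ' o s
      have h3 := h1 (0, ξ, s)
      have h4 := h2 (Sum.elim ξ' (Sum.elim o 0))
      have h5 : toSignals S i (0, ξ, ξ', o, s) = openLoop O (0, ξ, s) +
          controlEffect O (Sum.elim ξ' (Sum.elim o 0)) := by
        rw [openLoop, controlEffect, LinearMap.comp_apply, LinearMap.comp_apply, ← map_add]
        congr 1
        simp only [LinearMap.coe_mk, AddHom.coe_mk, mulVec_zero, Prod.mk_add_mk, zero_add,
          add_zero]
        refine Prod.ext ?_ rfl
        funext k
        simp only [inputCol]
        rcases k with k | k | (k | k | k | k) | (k | k)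
        case inr.inr.inr.inr => exact (congrFun (mulVec_zero O.Dz) k).symm
        all_goals simp
      rw [h5, map_add, h3, h4, add_zero]
    have hfun : ∀ w, B v w = η ⬝ᵥ w.mid := by
      intro w
      have h3 : toSignals S i (w.mid, w.1.2, w.2.1.2, (fun a => (w.2.2.1 a.1).2.1 a.2),
          fun a => (w.2.2.1 a.1).2.2 a.2) = toSignals S i (w.mid, 0) +
          toSignals S i (0, w.1.2, w.2.1.2, (fun a => (w.2.2.1 a.1).2.1 a.2),
          fun a => (w.2.2.1 a.1).2.2 a.2) := by
        rw [← map_add]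
        simp only [Prod.mk_add_mk, add_zero, zero_add]
      conv_lhs => rw [← toSignals_mid w, h3]
      rw [map_add, hext, hη, add_zero]
    rw [hB, localForm_dual ha hD hdet hGP hG v η hfun]
    refine hdual η (fun y => ?_) (fun u => ?_) ?_
    · rw [← hη]
      exact h1 (y, 0, 0)
    · rw [← hη]
      exact h2 (Sum.elim 0 (Sum.elim 0 u))
    · intro h0
      exact hv (hnd v fun w => by
        have := hfun w
        rw [hB] at this
        rw [this, h0, zero_dotProduct])
  obtain ⟨Θ, hΘ⟩ := exists_elimination (localForm GP G (flipScale a D⁻¹) g) ⟨hsymm⟩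
    ⟨hnd, fun v hv => hnd v fun w => by rw [hsymm, hv]⟩
    (openLoop O) (controlEffect O) (controlInput O) (freePart S i)
    (freePart_openLoop O) (freePart_controlEffect O) hker horth J hJ
  refine ⟨LinearMap.toMatrix' Θ, fun x hx => ?_⟩
  rw [← toLin'_apply, toLin'_toMatrix']
  exact hΘ x hx

end LocalController

/-! ### Perturbation to general position -/

noncomputable section Perturbation

open Filter Topology

theorem eventually_pos_form {m : Type} [Fintype m] {f : ℝ → Matrix m m ℝ} (hf : Continuous f)
    (h0 : (f 0).PosDef) : ∀ᶠ t in 𝓝 0, ∀ x, x ≠ 0 → 0 < x ⬝ᵥ f t *ᵥ x := by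
  have key : ∀ᶠ t in 𝓝 0, ∀ x ∈ Metric.sphere (0 : m → ℝ) 1, 0 < x ⬝ᵥ f t *ᵥ x := by
    refine (isCompact_sphere (0 : m → ℝ) 1).eventually_forall_of_forall_eventually fun x hx => ?_
    have hc : Continuous fun z : ℝ × (m → ℝ) => z.2 ⬝ᵥ f z.1 *ᵥ z.2 :=
      continuous_snd.dotProduct ((hf.comp continuous_fst).matrix_mulVec continuous_snd)
    refine continuousAt_const.eventually_lt hc.continuousAt ((posDef_iff_real.1 h0).2 x ?_)
    rintro rfl
    simp at hx
  filter_upwards [key] with t ht x hx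
  have hx' : 0 < ‖x‖ := norm_pos_iff.2 hx
  have h := ht (‖x‖⁻¹ • x) (by simp [norm_smul, hx'.ne'])
  rw [mulVec_smul, dotProduct_smul, smul_dotProduct, smul_eq_mul, smul_eq_mul] at h
  by_contra hcon
  push Not at hcon
  nlinarith [mul_nonneg (inv_pos.2 hx').le (mul_nonneg (inv_pos.2 hx').le (neg_nonneg.2 hcon))]

/-- A vanishing determinant means that -t is an eigenvalue of A. -/
theorem eventually_isUnit_det_add {m : Type} [Fintype m] [DecidableEq m] (A : Matrix m m ℝ) :
    ∀ᶠ t : ℝ in 𝓝[>] 0, IsUnit (A + t • (1 : Matrix m m ℝ)).det := by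
  filter_upwards [eventually_not_hasEigenvalue_neg (toLin' A)] with t ht
  rw [isUnit_iff_ne_zero]
  intro h0
  obtain ⟨v, hv, hAv⟩ := exists_mulVec_eq_zero_iff.2 h0
  refine ht (Module.End.hasEigenvalue_of_hasEigenvector (x := v) ⟨?_, hv⟩)
  rw [Module.End.mem_eigenspace_iff, toLin'_apply, neg_smul]
  rw [add_mulVec, smul_mulVec, one_mulVec] at hAv
  exact eq_neg_of_add_eq_zero_left hAv

variable {L : ℕ} {S : Network L}

/-- Perturbation of the scales that adds `t I` to the edge matrices with `j < i`. -/
def DistCtrl.Scales.shift (X : Scales S) (t : ℝ) : Scales S where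
  X11 i j := X.X11 i j - (if j < i then t else -t) • (1 : Matrix _ _ ℝ)
  X12 := X.X12

/-- The matrices X^{11} of the two ends enter an edge matrix with opposite signs, so opposite shifts
of them add up to a multiple of the identity. -/
theorem Scales.shift_edge (X : Scales S) (t : ℝ) {i j : Fin L} (hij : j < i) :
    (X.shift t).edge i j = X.edge i j + t • (1 : Matrix _ _ ℝ) := by
  ext x y
  rcases x with x | x <;> rcases y with y | y <;>
    simp [Scales.edge, Scales.shift, hij, hij.not_gt, one_apply, add_comm, sub_eq_add_neg]

theorem Scales.shift_zero (X : Scales S) : X.shift 0 = X := by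
  simp [Scales.shift]

theorem Scales.shift_isSymm {X : Scales S} {i j : Fin L} (h : (X.X11 i j).IsSymm) (t : ℝ) :
    ((X.shift t).X11 i j).IsSymm :=
  h.sub (isSymm_one.smul _)

theorem Scales.continuous_shift_Z (X : Scales S) (i : Fin L) :
    Continuous fun t => (X.shift t).Z i := by
  have h : ∀ i j : Fin L, Continuous fun t : ℝ => (X.shift t).X11 i j := by
    intro i j
    have : Continuous fun t : ℝ => if j < i then t else -t := by
      split_ifs
      exacts [continuous_id, continuous_neg]
    exact continuous_const.sub (this.smul continuous_const)
  have h11 : Continuous fun t => (X.shift t).Z11 i :=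
    (Continuous.matrix_blockDiagonal' (continuous_pi fun j : Nbr S i => h i j.1)).neg
  have h22 : Continuous fun t => (X.shift t).Z22 i :=
    Continuous.matrix_blockDiagonal' (continuous_pi fun j : Nbr S i => h j.1 i)
  exact h11.matrix_fromBlocks (continuous_const : Continuous fun _ => X.Z12 i)
    (continuous_const : Continuous fun _ => (X.Z12 i)ᵀ) h22

theorem continuous_middle {i : Fin L} {P : ℝ → Matrix (Fin (S.n i)) (Fin (S.n i)) ℝ}
    (hP : Continuous P) {Z : ℝ → Matrix (OwnX S i ⊕ NbrX S i) (OwnX S i ⊕ NbrX S i) ℝ}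
    (hZ : Continuous Z) (a : ℝ)
    (D : Matrix (RegIdx S i ⊕ Fin (S.n i)) (RegIdx S i ⊕ Fin (S.n i)) ℝ) (g : ℝ) :
    Continuous fun t => middle (P t) (Z t) a D g :=
  (hP.neg.matrix_fromBlocks continuous_const continuous_const hP).matrix_fromBlocks
    continuous_const continuous_const (hZ.matrix_fromBlocks continuous_const continuous_const
      continuous_const)

/-- The Schur complement of the coupling condition gives only P - Pb⁻¹ ≥ 0; the added multiple of
the identity makes it strict. -/
theorem posDef_sub_inv {m : Type} [Fintype m] [DecidableEq m] {P Pb : Matrix m m ℝ}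
    (hPb : Pb.PosDef) (h : (fromBlocks P 1 1 Pb).PosSemidef) {t : ℝ} (ht : 0 < t) :
    (P + t • (1 : Matrix m m ℝ) - Pb⁻¹).PosDef := by
  have : Invertible Pb := hPb.isUnit.invertible
  have h1 : (P - Pb⁻¹).PosSemidef := by
    have := (PosDef.fromBlocks₂₂ P 1 hPb).1 (by rwa [conjTranspose_one])
    simpa using this
  rw [add_sub_right_comm]
  exact PosDef.posSemidef_add h1 (PosDef.one.smul ht)

/-- The solutions of the two inequalities can be chosen in general position. -/
theorem exists_generic_solution {O : (i : Fin L) → Outputs S i} {γ : ℝ}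
    {D : (i : Fin L) → Matrix (RegIdx S i ⊕ Fin (S.n i)) (RegIdx S i ⊕ Fin (S.n i)) ℝ}
    {kΨ kΦ : Fin L → ℕ}
    {Ψ : (i : Fin L) → Matrix (InIdx S i) (Fin (kΨ i)) ℝ}
    (hΨ : ∀ i, IsKerBasis (measMat (O i)) (Ψ i))
    {Φ : (i : Fin L) → Matrix (OutIdx S i) (Fin (kΦ i)) ℝ}
    (hΦ : ∀ i, IsKerBasis (actMat (O i)) (Φ i))
    {P Pb : (i : Fin L) → Matrix (Fin (S.n i)) (Fin (S.n i)) ℝ} {X Xb : Scales S} {α : Fin L → ℝ}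
    (hsymm : ∀ i j, S.graph.Adj i j → (X.X11 i j).IsSymm ∧ (Xb.X11 i j).IsSymm)
    (hP : ∀ i, (P i).PosDef) (hPb : ∀ i, (Pb i).PosDef)
    (hprimal : ∀ i, (-((Ψ i)ᵀ * ((outer (O i))ᵀ * middle (P i) (X.Z i) (α i) (D i)⁻¹ (γ ^ 2) *
      outer (O i)) * Ψ i)).PosDef)
    (hdual : ∀ i, ((Φ i)ᵀ * ((outerPerp (O i))ᵀ * middle (Pb i) (Xb.Z i) (α i)⁻¹ (D i)
      (γ ^ 2)⁻¹ * outerPerp (O i)) * Φ i).PosDef)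
    (hcoup : ∀ i, (fromBlocks (P i) 1 1 (Pb i)).PosSemidef) :
    ∃ (P' : (i : Fin L) → Matrix (Fin (S.n i)) (Fin (S.n i)) ℝ) (X' Xb' : Scales S),
      (∀ i j, S.graph.Adj i j → (X'.X11 i j).IsSymm ∧ (Xb'.X11 i j).IsSymm) ∧
      (∀ i, (P' i).IsSymm ∧ (P' i - (Pb i)⁻¹).PosDef) ∧
      (∀ i y, measMat (O i) *ᵥ y = 0 → y ≠ 0 → (outer (O i) *ᵥ y) ⬝ᵥ
        middle (P' i) (X'.Z i) (α i) (D i)⁻¹ (γ ^ 2) *ᵥ (outer (O i) *ᵥ y) < 0) ∧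
      (∀ i η, (∀ y, η ⬝ᵥ outer (O i) *ᵥ y = 0) → (∀ u, η ⬝ᵥ inputCol (O i) u = 0) → η ≠ 0 →
        0 < η ⬝ᵥ middle (Pb i) (Xb'.Z i) (α i)⁻¹ (D i) (γ ^ 2)⁻¹ *ᵥ η) ∧
      ∀ i j, j < i → IsUnit (Xb'.edge i j).det ∧
        IsUnit (X'.edge i j - (Xb'.edge i j)⁻¹).det := by
  have h1 : ∀ᶠ t : ℝ in 𝓝[>] 0, ∀ i, ∀ c, c ≠ 0 → 0 < c ⬝ᵥ ((Φ i)ᵀ * ((outerPerp (O i))ᵀ *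
      middle (Pb i) ((Xb.shift t).Z i) (α i)⁻¹ (D i) (γ ^ 2)⁻¹ * outerPerp (O i)) * Φ i) *ᵥ c := by
    refine eventually_all.2 fun i => nhdsWithin_le_nhds (eventually_pos_form ?_ ?_)
    · exact (continuous_const.matrix_mul ((continuous_const.matrix_mul (continuous_middle
        continuous_const (Scales.continuous_shift_Z Xb i) _ _ _)).matrix_mul
          continuous_const)).matrix_mul continuous_const
    · rw [Scales.shift_zero]
      exact hdual i
  have h2 : ∀ᶠ t : ℝ in 𝓝[>] 0, ∀ i j, j < i → IsUnit ((Xb.shift t).edge i j).det := by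
    refine eventually_all.2 fun i => eventually_all.2 fun j => ?_
    filter_upwards [eventually_isUnit_det_add (Xb.edge i j)] with t ht hij
    rwa [Scales.shift_edge _ _ hij]
  -- The barred scales are fixed first, because the second genericity condition involves the
  -- inverses of their edge matrices.
  obtain ⟨t, ht1, ht2⟩ := (h1.and h2).exists
  set Xb' := Xb.shift t with hXb'
  have h3 : ∀ᶠ t : ℝ in 𝓝[>] 0, ∀ i, ∀ c, c ≠ 0 → 0 < c ⬝ᵥ (-((Ψ i)ᵀ * ((outer (O i))ᵀ *
      middle (P i + t • (1 : Matrix _ _ ℝ)) ((X.shift t).Z i) (α i) (D i)⁻¹ (γ ^ 2) *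
        outer (O i)) * Ψ i)) *ᵥ c := by
    refine eventually_all.2 fun i => nhdsWithin_le_nhds (eventually_pos_form ?_ ?_)
    · exact ((continuous_const.matrix_mul ((continuous_const.matrix_mul (continuous_middle
        (continuous_const.add (continuous_id.smul continuous_const))
          (Scales.continuous_shift_Z X i) _ _ _)).matrix_mul
          continuous_const)).matrix_mul continuous_const).neg
    · rw [Scales.shift_zero, zero_smul, add_zero]
      exact hprimal i
  have h4 : ∀ᶠ t : ℝ in 𝓝[>] 0, ∀ i j, j < i →
      IsUnit ((X.shift t).edge i j - (Xb'.edge i j)⁻¹).det := by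
    refine eventually_all.2 fun i => eventually_all.2 fun j => ?_
    filter_upwards [eventually_isUnit_det_add (X.edge i j - (Xb'.edge i j)⁻¹)] with t ht hij
    rwa [Scales.shift_edge _ _ hij, add_sub_right_comm]
  -- One r serves P and the unbarred scales; Pb and the barred scales stay put, so the dual
  -- inequality is unaffected.
  obtain ⟨r, ⟨hr1, hr2⟩, hr3⟩ := ((h3.and h4).and self_mem_nhdsWithin).exists
  exact ⟨fun i => P i + r • (1 : Matrix _ _ ℝ), X.shift r, Xb',
    fun i j hij => ⟨Scales.shift_isSymm (hsymm i j hij).1 r,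
      Scales.shift_isSymm (hsymm i j hij).2 t⟩,
    fun i => ⟨(hP i).isSymm_real.add (isSymm_one.smul r), posDef_sub_inv (hPb i) (hcoup i) hr3⟩,
    fun i => primal_neg_of_basis (hΨ i) (hr1 i), fun i => dual_pos_of_basis (hΦ i) (ht1 i),
    fun i j hij => ⟨ht2 i j hij, hr2 i j hij⟩⟩

end Perturbation

/-! ### Edge forms that cancel in pairs -/

noncomputable section Edges

variable {L : ℕ} {S : Network L}

theorem Scales.edge_isSymm {X : Scales S} {i j : Fin L} (h : (X.X11 i j).IsSymm)
    (h' : (X.X11 j i).IsSymm) : (X.edge i j).IsSymm := by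
  rw [Scales.edge, IsSymm, fromBlocks_transpose, transpose_neg, h.eq, h'.eq, transpose_transpose]

/-- The signs and the case distinction j ≤ i in the scales are designed for this antisymmetry, which
allows the supplies at the two ends of an edge to cancel. -/
theorem Scales.edge_swap (X : Scales S) {i j : Fin L} (hij : i < j) :
    X.edge i j = -((X.edge j i).submatrix (Equiv.sumComm _ _) (Equiv.sumComm _ _)) := by
  ext x y
  rcases x with x | x <;> rcases y with y | y <;>
    simp [Scales.edge, hij.le, hij.not_ge]

/-- Signals of the edge from `i` to `j`: `((x_i, x_j), (o_ij, s_ij))`. -/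
abbrev EdgeSignals (S : Network L) (i j : Fin L) : Type :=
  (Fin (S.n i) ⊕ Fin (S.n j) → ℝ) × ((Fin (chan S i j) → ℝ) × (Fin (chan S j i) → ℝ))

/-- The change of direction of an edge. -/
def edgeFlip (S : Network L) (i j : Fin L) : EdgeSignals S i j →ₗ[ℝ] EdgeSignals S j i :=
  (LinearMap.funLeft ℝ ℝ (Equiv.sumComm _ _).symm).prodMap
    (LinearEquiv.prodComm ℝ (Fin (chan S i j) → ℝ) (Fin (chan S j i) → ℝ)).toLinearMap

theorem edgeFlip_apply (i j : Fin L) (a b o s) : edgeFlip S i j (Sum.elim a b, (o, s)) =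
    (Sum.elim b a, (s, o)) := by
  refine Prod.ext ?_ rfl
  funext k
  rcases k with k | k <;> rfl

theorem edgeFlip_edgeFlip (i j : Fin L) (v : EdgeSignals S i j) :
    edgeFlip S j i (edgeFlip S i j v) = v := by
  refine Prod.ext ?_ rfl
  funext k
  rcases k with k | k <;> rfl

/-- Forms on the edges that complete the scales and cancel in pairs. -/
theorem exists_edge_forms {X Xb : Scales S}
    (hsymm : ∀ i j, S.graph.Adj i j → (X.X11 i j).IsSymm ∧ (Xb.X11 i j).IsSymm)
    (hgen : ∀ i j, j < i → IsUnit (Xb.edge i j).det ∧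
        IsUnit (X.edge i j - (Xb.edge i j)⁻¹).det) :
    ∃ G : (i j : Fin L) → LinearMap.BilinForm ℝ (EdgeSignals S i j),
      (∀ i j, S.graph.Adj i j → IsCompletion (G i j) (X.edge i j) (Xb.edge i j)) ∧
      (∀ i j, S.graph.Adj i j → ∃ J : ((Fin (S.n j) → ℝ) × (Fin (chan S j i) → ℝ)) →ₗ[ℝ] _,
        ∀ x, x ≠ 0 → G i j (J x) (J x) < 0) ∧
      ∀ i j, S.graph.Adj i j → ∀ v,
        G i j v v + G j i (edgeFlip S i j v) (edgeFlip S i j v) = 0 := by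
  have key : ∀ i j : Fin L, ∃ G : LinearMap.BilinForm ℝ (EdgeSignals S i j),
      S.graph.Adj i j → j < i → IsCompletion G (X.edge i j) (Xb.edge i j) ∧
      (∃ J : ((Fin (S.n j) → ℝ) × (Fin (chan S j i) → ℝ)) →ₗ[ℝ] _,
        ∀ x, x ≠ 0 → G (J x) (J x) < 0) ∧
      (∃ J : ((Fin (S.n i) → ℝ) × (Fin (chan S i j) → ℝ)) →ₗ[ℝ] _,
        ∀ x, x ≠ 0 → 0 < G (J x) (J x)) := by
    intro i j
    by_cases h : S.graph.Adj i j ∧ j < i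
    · obtain ⟨hadj, hij⟩ := h
      obtain ⟨G, hG⟩ := exists_edge_completion (N₁ := chan S i j) (N₂ := chan S j i) rfl
        (by rw [chan, max_comm])
        (Scales.edge_isSymm (hsymm i j hadj).1 (hsymm j i hadj.symm).1)
        (Scales.edge_isSymm (hsymm i j hadj).2 (hsymm j i hadj.symm).2)
        (hgen i j hij).1 (hgen i j hij).2
      exact ⟨G, fun _ _ => hG⟩
    · exact ⟨0, fun h1 h2 => absurd ⟨h1, h2⟩ h⟩
  choose H hH using key
  -- Only the direction j < i is constructed, and the other is its negative. This is why positive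
  -- directions were counted too: they become the negative directions of the reversed edge.
  let G : (i j : Fin L) → LinearMap.BilinForm ℝ (EdgeSignals S i j) := fun i j =>
    if j < i then H i j else -((H j i).comp (edgeFlip S i j) (edgeFlip S i j))
  have hlt : ∀ {i j : Fin L}, j < i → G i j = H i j := fun h => if_pos h
  have hgt : ∀ {i j : Fin L}, i < j →
      G i j = -((H j i).comp (edgeFlip S i j) (edgeFlip S i j)) := fun h => if_neg h.not_gt
  refine ⟨G, fun i j hadj => ?_, fun i j hadj => ?_, fun i j hadj v => ?_⟩
  all_goals rcases lt_or_gt_of_ne hadj.ne with hij | hij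
  · rw [hgt hij, Scales.edge_swap _ hij, Scales.edge_swap _ hij]
    exact (hH j i hadj.symm hij).1.neg_swap _ _
  · rw [hlt hij]
    exact (hH i j hadj hij).1
  · obtain ⟨J, hJ⟩ := (hH j i hadj.symm hij).2.2
    refine ⟨edgeFlip S j i ∘ₗ J, fun x hx => ?_⟩
    rw [hgt hij, LinearMap.neg_apply, LinearMap.neg_apply, LinearMap.BilinForm.comp_apply,
      LinearMap.comp_apply, edgeFlip_edgeFlip]
    exact neg_neg_of_pos (hJ x hx)
  · rw [hlt hij]
    exact (hH i j hadj hij).2.1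
  · rw [hgt hij, hlt hij]
    exact neg_add_cancel _
  · rw [hlt hij, hgt hij, LinearMap.neg_apply, LinearMap.neg_apply,
      LinearMap.BilinForm.comp_apply, edgeFlip_edgeFlip]
    exact add_neg_cancel _

/-- Reversal of the directed edges. -/
def reverseEdge (S : Network L) : Equiv.Perm (Σ i, Nbr S i) where
  toFun e := ⟨e.2.1, e.1, e.2.2.symm⟩
  invFun e := ⟨e.2.1, e.1, e.2.2.symm⟩
  left_inv _ := rfl
  right_inv _ := rfl

/-- The edge terms cancel. -/
theorem sum_edge_forms {G : (i j : Fin L) → LinearMap.BilinForm ℝ (EdgeSignals S i j)}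
    (hG : ∀ i j, S.graph.Adj i j → ∀ v,
      G i j v v + G j i (edgeFlip S i j v) (edgeFlip S i j v) = 0)
    (v : (i : Fin L) → (j : Nbr S i) → EdgeSignals S i j.1)
    (hv : ∀ i (j : Nbr S i), v j.1 ⟨i, j.2.symm⟩ = edgeFlip S i j.1 (v i j)) :
    ∑ i, ∑ j : Nbr S i, G i j.1 (v i j) (v i j) = 0 := by
  have h1 : ∑ i, ∑ j : Nbr S i, G i j.1 (v i j) (v i j) =
      ∑ e : Σ i, Nbr S i, G e.1 e.2.1 (v e.1 e.2) (v e.1 e.2) := by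
    rw [Fintype.sum_sigma]
  have h2 : ∑ e : Σ i, Nbr S i, G e.1 e.2.1 (v e.1 e.2) (v e.1 e.2) =
      -∑ e : Σ i, Nbr S i, G e.1 e.2.1 (v e.1 e.2) (v e.1 e.2) := by
    conv_lhs => rw [← Equiv.sum_comp (reverseEdge S)]
    rw [← Finset.sum_neg_distrib]
    refine Finset.sum_congr rfl fun e _ => ?_
    have h := hG e.1 e.2.1 e.2.2 (v e.1 e.2)
    rw [← hv] at h
    exact eq_neg_of_add_eq_zero_right h
  rw [h1]
  linarith

end Edges

/-! ### From local to global dissipation -/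

noncomputable section GlobalDissipation

variable {L : ℕ} {S : Network L}

/-- The signals of a controlled subsystem. -/
theorem openLoop_add_controlEffect {i : Fin L} (O : Outputs S i) (x : Fin (S.n i) → ℝ)
    (xN : NbrX S i → ℝ) (l w ξ : Fin (S.n i) → ℝ) (s : SIdx S i → ℝ) (ξ' : Fin (S.n i) → ℝ)
    (o : OIdx S i → ℝ) (u : Fin (S.m i) → ℝ) :
    openLoop O (Sum.elim x (Sum.elim xN (Sum.elim l w)), ξ, s) +
        controlEffect O (Sum.elim ξ' (Sum.elim o u)) =
      ((x, ξ), (l + w, ξ'), (fun j => (Sum.elim x fun b => xN ⟨j, b⟩,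
        (fun c => o ⟨j, c⟩, fun c => s ⟨j, c⟩))), Sum.elim l (Sum.elim x (Sum.elim xN u)), w,
        O.Cz *ᵥ x + O.CzN *ᵥ xN + O.Dz *ᵥ u) := by
  rw [openLoop, controlEffect, LinearMap.comp_apply, LinearMap.comp_apply, ← map_add]
  simp only [LinearMap.coe_mk, AddHom.coe_mk, outer_mulVec, Prod.mk_add_mk, zero_add, add_zero,
    Sum.elim_inl, Sum.elim_inr, inputCol, toSignals, Pi.add_apply]
  refine Prod.ext ?_ (Prod.ext ?_ (Prod.ext ?_ (Prod.ext ?_ (Prod.ext ?_ ?_))))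
  · simp
  · refine Prod.ext ?_ rfl
    funext a
    simp
  · funext j
    refine Prod.ext ?_ rfl
    funext k
    rcases k with k | k <;> simp [edgeSig]
  · funext k
    rcases k with k | k | k | k <;> simp
  · funext k
    simp
  · rfl

/-- Dissipation in one controlled subsystem. -/
theorem local_dissipation {i : Fin L} {O : Outputs S i}
    {GP : LinearMap.BilinForm ℝ ((Fin (S.n i) → ℝ) × (Fin (S.n i) → ℝ))}
    {G : (j : Nbr S i) → LinearMap.BilinForm ℝ ((Fin (S.n i) ⊕ Fin (S.n j.1) → ℝ) ×
      ((Fin (chan S i j.1) → ℝ) × (Fin (chan S j.1 i) → ℝ)))}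
    {T : Matrix (Fin (S.n i) ⊕ RegIdx S i) (Fin (S.n i) ⊕ RegIdx S i) ℝ} {g : ℝ}
    {Θ : Matrix (Fin (S.n i) ⊕ (OIdx S i ⊕ Fin (S.m i)))
      (Fin (S.n i) ⊕ (SIdx S i ⊕ Fin (S.p i))) ℝ}
    (hΘ : ∀ x : FreeSignals S i, x ≠ 0 → localForm GP G T g
      (openLoop O x + controlEffect O (Θ *ᵥ controlInput O x))
      (openLoop O x + controlEffect O (Θ *ᵥ controlInput O x)) < 0)
    {M : Subsystem S i} (hM : ∀ p, 0 ≤ Sum.elim (M.mat *ᵥ p) p ⬝ᵥ T *ᵥ Sum.elim (M.mat *ᵥ p) p)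
    (x : Fin (S.n i) → ℝ) (xN : NbrX S i → ℝ) (w ξ : Fin (S.n i) → ℝ) (s : SIdx S i → ℝ)
    (ξ' : Fin (S.n i) → ℝ) (o : OIdx S i → ℝ) (u : Fin (S.m i) → ℝ)
    (hc : Sum.elim ξ' (Sum.elim o u) = Θ *ᵥ Sum.elim ξ (Sum.elim s (O.C *ᵥ x))) (r : ℝ)
    (hr : r = GP (M.A *ᵥ x + M.AN *ᵥ xN + M.B *ᵥ u + w, ξ')
        (M.A *ᵥ x + M.AN *ᵥ xN + M.B *ᵥ u + w, ξ') - GP (x, ξ) (x, ξ) +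
      ∑ j : Nbr S i, G j (Sum.elim x fun b => xN ⟨j, b⟩, (fun c => o ⟨j, c⟩, fun c => s ⟨j, c⟩))
        (Sum.elim x fun b => xN ⟨j, b⟩, (fun c => o ⟨j, c⟩, fun c => s ⟨j, c⟩)) +
      (O.Cz *ᵥ x + O.CzN *ᵥ xN + O.Dz *ᵥ u) ⬝ᵥ (O.Cz *ᵥ x + O.CzN *ᵥ xN + O.Dz *ᵥ u) -
      g * (w ⬝ᵥ w)) :
    r ≤ 0 ∧ ((x ≠ 0 ∨ ξ ≠ 0 ∨ s ≠ 0 ∨ w ≠ 0) → r < 0) := by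
  have hl : M.mat *ᵥ Sum.elim x (Sum.elim xN u) = M.A *ᵥ x + M.AN *ᵥ xN + M.B *ᵥ u := by
    rw [Subsystem.mat, fromCols_mulVec_sumElim, fromCols_mulVec_sumElim, add_assoc]
  have h1 := hM (Sum.elim x (Sum.elim xN u))
  rw [hl] at h1
  set l := M.A *ᵥ x + M.AN *ᵥ xN + M.B *ᵥ u with hldef
  -- In the synthesis l was free. On a trajectory l = Δ p, the multiplier term is nonnegative, and
  -- it may be dropped.
  have h2 : ∀ y : FreeSignals S i, y = (Sum.elim x (Sum.elim xN (Sum.elim l w)), ξ, s) →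
      r ≤ localForm GP G T g (openLoop O y + controlEffect O (Θ *ᵥ controlInput O y))
        (openLoop O y + controlEffect O (Θ *ᵥ controlInput O y)) := by
    rintro y rfl
    have h3 : controlInput O (Sum.elim x (Sum.elim xN (Sum.elim l w)), ξ, s) =
        Sum.elim ξ (Sum.elim s (O.C *ᵥ x)) := by
      simp only [controlInput, LinearMap.coe_mk, AddHom.coe_mk, measMat_mulVec]
    rw [h3, ← hc, openLoop_add_controlEffect, localForm_apply]
    dsimp only
    linarith
  refine ⟨?_, fun h => ?_⟩
  -- A subsystem at rest gives no strict inequality; in the sum over the network one active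
  -- subsystem is enough.
  · by_cases h0 : (Sum.elim x (Sum.elim xN (Sum.elim l w)), ξ, s) = (0 : FreeSignals S i)
    · have := h2 0 h0.symm
      simpa using this
    · exact (h2 _ rfl).trans (hΘ _ h0).le
  · refine (h2 _ rfl).trans_lt (hΘ _ fun h0 => ?_)
    have e1 := congrArg Prod.fst h0
    have e2 := congrArg Prod.snd h0
    rcases h with h | h | h | h
    · exact h (funext fun a => congrFun e1 (Sum.inl a))
    · exact h (congrArg Prod.fst e2)
    · exact h (congrArg Prod.snd e2)
    · exact h (funext fun a => congrFun e1 (Sum.inr (Sum.inr (Sum.inr a))))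

/-- The component of a stacked vector that belongs to subsystem `i`. -/
def part {μ : Fin L → Type} (x : (Σ i, μ i) → ℝ) (i : Fin L) : μ i → ℝ := fun a => x ⟨i, a⟩

theorem nbrSel_mulVec (x : XAll S → ℝ) :
    nbrSel S *ᵥ x = fun a => x ⟨a.2.1.1, a.2.2⟩ := by
  funext a
  simp [nbrSel, mulVec, dotProduct]

theorem link_mulVec (o : OAll S → ℝ) :
    link S *ᵥ o = fun a => o ⟨a.2.1.1, ⟨⟨a.1, a.2.1.2.symm⟩, a.2.2⟩⟩ := by
  funext a
  simp [link, mulVec, dotProduct]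

theorem part_blockDiagonal'_mulVec {μ ν : Fin L → Type} [∀ i, Fintype (ν i)]
    (A : ∀ i, Matrix (μ i) (ν i) ℝ) (v : (Σ i, ν i) → ℝ) (i : Fin L) :
    part (blockDiagonal' A *ᵥ v) i = A i *ᵥ part v i :=
  funext fun a => blockDiagonal'_mulVec_apply A v i a

theorem part_add {μ : Fin L → Type} (x y : (Σ i, μ i) → ℝ) (i : Fin L) :
    part (x + y) i = part x i + part y i := rfl

theorem exists_part_ne_zero {μ : Fin L → Type} {x : (Σ i, μ i) → ℝ} (hx : x ≠ 0) :
    ∃ i, part x i ≠ 0 := by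
  by_contra! h
  exact hx (funext fun a => congrFun (h a.1) a.2)

theorem dotProduct_eq_sum_part {μ : Fin L → Type} [∀ i, Fintype (μ i)]
    (x y : (Σ i, μ i) → ℝ) : x ⬝ᵥ y = ∑ i, part x i ⬝ᵥ part y i := by
  simp only [dotProduct, Fintype.sum_sigma, part]

theorem mulVec_elim_elim {ρ κ α β δ : Type} [Fintype α] [Fintype β] [Fintype δ]
    (A : Matrix ρ (α ⊕ (β ⊕ δ)) ℝ) (f : κ → ρ) (a : α → ℝ) (b : β → ℝ) (c : δ → ℝ) :
    (fun k => (A *ᵥ Sum.elim a (Sum.elim b c)) (f k)) =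
      A.submatrix f Sum.inl *ᵥ a + A.submatrix f (fun k => Sum.inr (Sum.inl k)) *ᵥ b +
        A.submatrix f (fun k => Sum.inr (Sum.inr k)) *ᵥ c := by
  funext k
  simp only [mulVec, dotProduct, Fintype.sum_sum_type, Sum.elim_inl, Sum.elim_inr, Pi.add_apply,
    submatrix_apply, add_assoc]

/-- The pair `(x_i, ξ_i)` of local states. -/
def statePart (S : Network L) (i : Fin L) :
    (XAll S ⊕ XAll S → ℝ) →ₗ[ℝ] (Fin (S.n i) → ℝ) × (Fin (S.n i) → ℝ) :=
  (LinearMap.funLeft ℝ ℝ fun a => Sum.inl ⟨i, a⟩).prod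
    (LinearMap.funLeft ℝ ℝ fun a => Sum.inr ⟨i, a⟩)

theorem statePart_elim (i : Fin L) (x ξ : XAll S → ℝ) :
    statePart S i (Sum.elim x ξ) = (part x i, part ξ i) := rfl

/-- The sum of the local storage functions. -/
def storage (GP : (i : Fin L) →
    LinearMap.BilinForm ℝ ((Fin (S.n i) → ℝ) × (Fin (S.n i) → ℝ))) :
    LinearMap.BilinForm ℝ (XAll S ⊕ XAll S → ℝ) :=
  ∑ i, (GP i).comp (statePart S i) (statePart S i)

theorem storage_apply (GP : (i : Fin L) →
    LinearMap.BilinForm ℝ ((Fin (S.n i) → ℝ) × (Fin (S.n i) → ℝ))) (x y : XAll S ⊕ XAll S → ℝ) :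
    storage GP x y = ∑ i, GP i (statePart S i x) (statePart S i y) := by
  simp [storage, LinearMap.sum_apply]

theorem storage_pos {GP : (i : Fin L) →
    LinearMap.BilinForm ℝ ((Fin (S.n i) → ℝ) × (Fin (S.n i) → ℝ))}
    (h : ∀ i v, v ≠ 0 → 0 < GP i v v) (x : XAll S ⊕ XAll S → ℝ) (hx : x ≠ 0) :
    0 < storage GP x x := by
  rw [storage_apply]
  refine Finset.sum_pos' (fun i _ => ?_) ?_
  · by_cases h0 : statePart S i x = 0
    · rw [h0, LinearMap.map_zero]
    · exact (h i _ h0).le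
  · by_contra! hcon
    refine hx (funext fun a => ?_)
    have h0 : ∀ i, statePart S i x = 0 := fun i => by
      by_contra h0
      exact (hcon i (Finset.mem_univ i)).not_gt (h i _ h0)
    rcases a with a | a
    · exact congrFun (congrArg Prod.fst (h0 a.1)) a.2
    · exact congrFun (congrArg Prod.snd (h0 a.1)) a.2

/-- Dissipation in the controlled network. -/
theorem network_dissipation {O : (i : Fin L) → Outputs S i}
    {GP : (i : Fin L) → LinearMap.BilinForm ℝ ((Fin (S.n i) → ℝ) × (Fin (S.n i) → ℝ))}
    {G : (i j : Fin L) → LinearMap.BilinForm ℝ (EdgeSignals S i j)}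
    (hG : ∀ i j, S.graph.Adj i j → ∀ v,
      G i j v v + G j i (edgeFlip S i j v) (edgeFlip S i j v) = 0)
    {T : (i : Fin L) → Matrix (Fin (S.n i) ⊕ RegIdx S i) (Fin (S.n i) ⊕ RegIdx S i) ℝ} {g : ℝ}
    {Θ : Controller S}
    (hΘ : ∀ i, ∀ x : FreeSignals S i, x ≠ 0 → localForm (GP i) (fun j => G i j.1) (T i) g
      (openLoop (O i) x + controlEffect (O i) (Θ i *ᵥ controlInput (O i) x))
      (openLoop (O i) x + controlEffect (O i) (Θ i *ᵥ controlInput (O i) x)) < 0)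
    {M : (i : Fin L) → Subsystem S i}
    (hM : ∀ i p, 0 ≤ Sum.elim ((M i).mat *ᵥ p) p ⬝ᵥ T i *ᵥ Sum.elim ((M i).mat *ᵥ p) p)
    (x ξ w : XAll S → ℝ) (o : OAll S → ℝ)
    (ho : o = Θ.ox *ᵥ ξ + Θ.os *ᵥ (link S *ᵥ o) + Θ.oy *ᵥ (plantC O *ᵥ x))
    (ξ' : XAll S → ℝ)
    (hξ' : ξ' = Θ.xx *ᵥ ξ + Θ.xs *ᵥ (link S *ᵥ o) + Θ.xy *ᵥ (plantC O *ᵥ x)) (u : UAll S → ℝ)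
    (hu : u = Θ.ux *ᵥ ξ + Θ.us *ᵥ (link S *ᵥ o) + Θ.uy *ᵥ (plantC O *ᵥ x))
    (h0 : x ≠ 0 ∨ ξ ≠ 0 ∨ link S *ᵥ o ≠ 0 ∨ w ≠ 0) :
    storage GP (Sum.elim (plantA M *ᵥ x + plantB M *ᵥ u + w) ξ')
        (Sum.elim (plantA M *ᵥ x + plantB M *ᵥ u + w) ξ') -
      storage GP (Sum.elim x ξ) (Sum.elim x ξ) +
      (plantCz O *ᵥ x + plantDz O *ᵥ u) ⬝ᵥ (plantCz O *ᵥ x + plantDz O *ᵥ u) -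
      g * (w ⬝ᵥ w) < 0 := by
  -- Here `o` is any solution of the loop equations and no inverse is formed, so the estimate can be
  -- used to prove well-posedness.
  set s := link S *ᵥ o with hs
  set xN := nbrSel S *ᵥ x with hxN
  have hc : ∀ i, Sum.elim (part ξ' i) (Sum.elim (part o i) (part u i)) =
      Θ i *ᵥ Sum.elim (part ξ i) (Sum.elim (part s i) ((O i).C *ᵥ part x i)) := by
    intro i
    have e1 : part (plantC O *ᵥ x) i = (O i).C *ᵥ part x i := part_blockDiagonal'_mulVec _ _ _
    have e2 : part ξ' i = _ := congrArg (part · i) hξ'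
    have e3 : part o i = _ := congrArg (part · i) ho
    have e4 : part u i = _ := congrArg (part · i) hu
    simp only [Controller.xx, Controller.xs, Controller.xy, Controller.ox, Controller.os,
      Controller.oy, Controller.ux, Controller.us, Controller.uy, part_add,
      part_blockDiagonal'_mulVec, e1, ← mulVec_elim_elim] at e2 e3 e4
    funext k
    rcases k with k | k | k
    exacts [congrFun e2 k, congrFun e3 k, congrFun e4 k]
  have hx' : ∀ i, part (plantA M *ᵥ x + plantB M *ᵥ u + w) i = (M i).A *ᵥ part x i +
      (M i).AN *ᵥ part xN i + (M i).B *ᵥ part u i + part w i := by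
    intro i
    simp only [plantA, plantB, add_mulVec, ← mulVec_mulVec, part_add, part_blockDiagonal'_mulVec,
      ← hxN]
  have hz : ∀ i, part (plantCz O *ᵥ x + plantDz O *ᵥ u) i = (O i).Cz *ᵥ part x i +
      (O i).CzN *ᵥ part xN i + (O i).Dz *ᵥ part u i := by
    intro i
    simp only [plantCz, plantDz, add_mulVec, ← mulVec_mulVec, part_add,
      part_blockDiagonal'_mulVec, ← hxN]
  have hloc := fun i => local_dissipation (hΘ i) (hM i) (part x i) (part xN i) (part w i)
    (part ξ i) (part s i) (part ξ' i) (part o i) (part u i) (hc i) _ rfl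
  have hneg : ∑ i, _ < ∑ i : Fin L, (0 : ℝ) :=
    Finset.sum_lt_sum (fun i _ => (hloc i).1) (by
      have : ∃ i, part x i ≠ 0 ∨ part ξ i ≠ 0 ∨ part s i ≠ 0 ∨ part w i ≠ 0 := by
        rcases h0 with h | h | h | h <;> obtain ⟨i, hi⟩ := exists_part_ne_zero h
        exacts [⟨i, .inl hi⟩, ⟨i, .inr (.inl hi)⟩, ⟨i, .inr (.inr (.inl hi))⟩,
          ⟨i, .inr (.inr (.inr hi))⟩]
      obtain ⟨i, hi⟩ := this
      exact ⟨i, Finset.mem_univ i, (hloc i).2 hi⟩)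
  -- Because s_ij = o_ji, the edge signals seen from the two ends are flips of each other.
  have hedge := sum_edge_forms hG (fun i j => (Sum.elim (part x i) fun b => part xN i ⟨j, b⟩,
    (fun c => part o i ⟨j, c⟩, fun c => part s i ⟨j, c⟩))) (fun i j => by
      rw [edgeFlip_apply, hs, hxN, link_mulVec, nbrSel_mulVec]
      rfl)
  simp only [Finset.sum_add_distrib, Finset.sum_sub_distrib, Finset.sum_const_zero,
    ← Finset.mul_sum] at hneg
  rw [storage_apply, storage_apply, dotProduct_eq_sum_part, dotProduct_eq_sum_part w]
  simp only [statePart_elim, hx', hz]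
  linarith

/-- Dissipation for a solvable loop implies well-posedness. -/
theorem wellPosed_of_dissipation {O : (i : Fin L) → Outputs S i}
    {GP : (i : Fin L) → LinearMap.BilinForm ℝ ((Fin (S.n i) → ℝ) × (Fin (S.n i) → ℝ))}
    (hGP : ∀ i v, v ≠ 0 → 0 < GP i v v)
    {G : (i j : Fin L) → LinearMap.BilinForm ℝ (EdgeSignals S i j)}
    (hG : ∀ i j, S.graph.Adj i j → ∀ v,
      G i j v v + G j i (edgeFlip S i j v) (edgeFlip S i j v) = 0)
    {T : (i : Fin L) → Matrix (Fin (S.n i) ⊕ RegIdx S i) (Fin (S.n i) ⊕ RegIdx S i) ℝ} {g : ℝ}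
    {Θ : Controller S}
    (hΘ : ∀ i, ∀ x : FreeSignals S i, x ≠ 0 → localForm (GP i) (fun j => G i j.1) (T i) g
      (openLoop (O i) x + controlEffect (O i) (Θ i *ᵥ controlInput (O i) x))
      (openLoop (O i) x + controlEffect (O i) (Θ i *ᵥ controlInput (O i) x)) < 0)
    {M : (i : Fin L) → Subsystem S i}
    (hM : ∀ i p, 0 ≤ Sum.elim ((M i).mat *ᵥ p) p ⬝ᵥ T i *ᵥ Sum.elim ((M i).mat *ᵥ p) p) :
    Θ.WellPosed := by
  rw [Controller.WellPosed, isUnit_iff_ne_zero]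
  intro hdet
  obtain ⟨o, ho0, ho⟩ := exists_mulVec_eq_zero_iff.2 hdet
  rw [sub_mulVec, one_mulVec, ← mulVec_mulVec, sub_eq_zero] at ho
  have hs : link S *ᵥ o ≠ 0 := fun h => ho0 (by rw [ho, h, mulVec_zero])
  -- From zero state and noise, a nontrivial loop solution would make the sum of the next storage
  -- and |z|² negative.
  have h := network_dissipation hG hΘ hM 0 0 0 o (by simpa using ho) _ rfl _ rfl
    (.inr (.inr (.inl hs)))
  have h1 : storage GP (Sum.elim (0 : XAll S → ℝ) 0) (Sum.elim (0 : XAll S → ℝ) 0) = 0 := by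
    rw [Sum.elim_zero_zero, LinearMap.map_zero]
  have h2 : ∀ v, 0 ≤ storage GP v v := fun v => by
    by_cases h0 : v = 0
    · rw [h0, LinearMap.map_zero]
    · exact (storage_pos hGP v h0).le
  rw [h1, dotProduct_zero, mul_zero] at h
  have h4 := real_dotProduct_self_nonneg (plantCz O *ᵥ 0 + plantDz O *ᵥ
    (Θ.ux *ᵥ 0 + Θ.us *ᵥ (link S *ᵥ o) + Θ.uy *ᵥ (plantC O *ᵥ 0)))
  linarith [h2 (Sum.elim (plantA M *ᵥ 0 + plantB M *ᵥ
    (Θ.ux *ᵥ 0 + Θ.us *ᵥ (link S *ᵥ o) + Θ.uy *ᵥ (plantC O *ᵥ 0)) + 0)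
    (Θ.xx *ᵥ 0 + Θ.xs *ᵥ (link S *ᵥ o) + Θ.xy *ᵥ (plantC O *ᵥ 0)))]

/-- Solving the well-posed loop for o turns the closed-loop matrices into a network trajectory; the
summed storage then meets the bounded real lemma. -/
theorem achievesHinf_of_local {O : (i : Fin L) → Outputs S i}
    {GP : (i : Fin L) → LinearMap.BilinForm ℝ ((Fin (S.n i) → ℝ) × (Fin (S.n i) → ℝ))}
    (hsymm : ∀ i v w, GP i v w = GP i w v) (hGP : ∀ i v, v ≠ 0 → 0 < GP i v v)
    {G : (i j : Fin L) → LinearMap.BilinForm ℝ (EdgeSignals S i j)}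
    (hG : ∀ i j, S.graph.Adj i j → ∀ v,
      G i j v v + G j i (edgeFlip S i j v) (edgeFlip S i j v) = 0)
    {T : (i : Fin L) → Matrix (Fin (S.n i) ⊕ RegIdx S i) (Fin (S.n i) ⊕ RegIdx S i) ℝ} {γ : ℝ}
    (hγ : 0 < γ) {Θ : Controller S} (hwp : Θ.WellPosed)
    (hΘ : ∀ i, ∀ x : FreeSignals S i, x ≠ 0 → localForm (GP i) (fun j => G i j.1) (T i) (γ ^ 2)
      (openLoop (O i) x + controlEffect (O i) (Θ i *ᵥ controlInput (O i) x))
      (openLoop (O i) x + controlEffect (O i) (Θ i *ᵥ controlInput (O i) x)) < 0)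
    {M : (i : Fin L) → Subsystem S i}
    (hM : ∀ i p, 0 ≤ Sum.elim ((M i).mat *ᵥ p) p ⬝ᵥ T i *ᵥ Sum.elim ((M i).mat *ᵥ p) p) :
    AchievesHinf (clA M O Θ) (clB S) (clC O Θ) 0 γ := by
  refine achievesHinf_of_dissipation _ _ _ _ hγ (storage GP)
    ⟨fun x y => ?_⟩ (storage_pos hGP) fun v w hvw => ?_
  · simp only [storage_apply, hsymm _ (statePart S _ x)]
  · obtain ⟨x, ξ, rfl⟩ : ∃ x ξ, v = Sum.elim x ξ := ⟨_, _, (Sum.elim_comp_inl_inr v).symm⟩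
    set y := plantC O *ᵥ x with hy
    set o := (1 - Θ.os * link S)⁻¹ *ᵥ (Θ.ox *ᵥ ξ + Θ.oy *ᵥ y) with ho
    have ho' : o = Θ.ox *ᵥ ξ + Θ.os *ᵥ (link S *ᵥ o) + Θ.oy *ᵥ y := by
      have h : (1 - Θ.os * link S) *ᵥ o = Θ.ox *ᵥ ξ + Θ.oy *ᵥ y := by
        rw [ho, mulVec_mulVec, mul_nonsing_inv _ hwp, one_mulVec]
      rw [sub_mulVec, one_mulVec, ← mulVec_mulVec, sub_eq_iff_eq_add] at h
      exact h.trans (add_right_comm _ _ _)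
    have hs : link S *ᵥ o = Θ.loop *ᵥ (Θ.ox *ᵥ ξ + Θ.oy *ᵥ y) := by
      rw [ho, Controller.loop, mulVec_mulVec]
    have h := network_dissipation hG hΘ hM x ξ w o ho' _ rfl _ rfl (by
      rcases hvw with h | h
      · by_contra! hcon
        exact h (by rw [hcon.1, hcon.2.1, Sum.elim_zero_zero])
      · exact .inr (.inr (.inr h)))
    have hu : Θ.ux *ᵥ ξ + Θ.us *ᵥ (link S *ᵥ o) + Θ.uy *ᵥ y = Θ.KC *ᵥ ξ + Θ.KD *ᵥ y := by
      rw [hs, Controller.KC, Controller.KD]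
      simp only [add_mulVec, mulVec_add, ← mulVec_mulVec]
      abel
    have hξ : Θ.xx *ᵥ ξ + Θ.xs *ᵥ (link S *ᵥ o) + Θ.xy *ᵥ y = Θ.KA *ᵥ ξ + Θ.KB *ᵥ y := by
      rw [hs, Controller.KA, Controller.KB]
      simp only [add_mulVec, mulVec_add, ← mulVec_mulVec]
      abel
    rw [← hy, hu, hξ] at h
    have e1 : clA M O Θ *ᵥ Sum.elim x ξ + clB S *ᵥ w =
        Sum.elim (plantA M *ᵥ x + plantB M *ᵥ (Θ.KC *ᵥ ξ + Θ.KD *ᵥ y) + w)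
          (Θ.KA *ᵥ ξ + Θ.KB *ᵥ y) := by
      rw [clA, clB, fromBlocks_mulVec, fromRows_mulVec, one_mulVec, zero_mulVec, ← Sum.elim_add_add]
      simp only [Sum.elim_comp_inl, Sum.elim_comp_inr, add_mulVec, mulVec_add, ← mulVec_mulVec,
        ← hy]
      congr 1 <;> abel
    have e2 : clC O Θ *ᵥ Sum.elim x ξ + (0 : Matrix (ZAll S) (XAll S) ℝ) *ᵥ w =
        plantCz O *ᵥ x + plantDz O *ᵥ (Θ.KC *ᵥ ξ + Θ.KD *ᵥ y) := by
      rw [clC, fromCols_mulVec_sumElim, zero_mulVec]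
      simp only [add_mulVec, mulVec_add, ← mulVec_mulVec, ← hy]
      abel
    rw [e1, e2]
    exact h

end GlobalDissipation

/-! ### Assembly -/

theorem proposition3 {L : ℕ} (S : Network L) (O : (i : Fin L) → Outputs S i)
    {N : ℕ} (d : Data S N) (ν : (i : Fin L) → NoiseModel S N i)
    (hQ : ∀ i, (-(ν i).Qw).PosDef) (hR : ∀ i, (ν i).Rw.IsSymm)
    (hrank : ∀ i, (d.reg i).rank = Fintype.card (RegIdx S i))
    (hinv : ∀ i, IsUnit (dataBar d (ν i)).det)
    (γ : ℝ) (hγ : 0 < γ)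
    (kΨ kΦ : Fin L → ℕ)
    (Ψ : (i : Fin L) → Matrix (InIdx S i) (Fin (kΨ i)) ℝ)
    (hΨ : ∀ i, IsKerBasis (measMat (O i)) (Ψ i))
    (Φ : (i : Fin L) → Matrix (OutIdx S i) (Fin (kΦ i)) ℝ)
    (hΦ : ∀ i, IsKerBasis (actMat (O i)) (Φ i))
    (hLMI : ∃ (P Pbar : (i : Fin L) → Matrix (Fin (S.n i)) (Fin (S.n i)) ℝ)
      (X Xbar : Scales S) (α : Fin L → ℝ),
      (∀ i j, S.graph.Adj i j → (X.X11 i j).IsSymm ∧ (Xbar.X11 i j).IsSymm) ∧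
      ∀ i, (P i).PosDef ∧ (Pbar i).PosDef ∧ 0 < α i ∧
        (-((Ψ i)ᵀ * ((outer (O i))ᵀ * middle (P i) (X.Z i) (α i) (dataMat d (ν i)) (γ ^ 2) *
          outer (O i)) * Ψ i)).PosDef ∧
        ((Φ i)ᵀ * ((outerPerp (O i))ᵀ * middle (Pbar i) (Xbar.Z i) (α i)⁻¹ (dataBar d (ν i))
          (γ ^ 2)⁻¹ * outerPerp (O i)) * Φ i).PosDef ∧
        (fromBlocks (P i) 1 1 (Pbar i)).PosSemidef) :
    ∃ Θ : Controller S, Θ.WellPosed ∧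
      ∀ M : (i : Fin L) → Subsystem S i, (∀ i, M i ∈ consistent d (ν i)) →
        AchievesHinf (clA M O Θ) (clB S) (clC O Θ) 0 γ := by
  -- Positivity of R_D and well-posedness are both drawn from some consistent plant. If there is
  -- none, the robust claim is vacuous and the zero controller is well posed.
  by_cases hne : ∃ M : (i : Fin L) → Subsystem S i, ∀ i, M i ∈ consistent d (ν i)
  swap
  · refine ⟨0, ?_, fun M hM => absurd ⟨M, hM⟩ hne⟩
    have h : Controller.os (0 : Controller S) = 0 := by
      rw [Controller.os]
      exact blockDiagonal'_zero
    rw [Controller.WellPosed, h, Matrix.zero_mul, sub_zero, det_one]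
    exact isUnit_one
  obtain ⟨M₀, hM₀⟩ := hne
  obtain ⟨P, Pb, X, Xb, α, hsymm, hall⟩ := hLMI
  choose hP hPb hα hprimal hdual hcoup using hall
  obtain ⟨P', X', Xb', hsymm', hP', hprimal', hdual', hgen⟩ :=
    exists_generic_solution hΨ hΦ hsymm hP hPb hprimal hdual hcoup
  have hD : ∀ i, (dataBar d (ν i)).IsSymm := fun i =>
    dataBar_isSymm d (by simpa using (hQ i).isSymm_real.neg) (hR i)
  have hDi : ∀ i, ((dataBar d (ν i))⁻¹).IsSymm := fun i => by
    rw [IsSymm, transpose_nonsing_inv, (hD i).eq]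
  have hDneg : ∀ i, _ := fun i => dataBar_neg d (hQ i) (hrank i)
  choose GP hGP hGPpos using fun i => exists_state_completion (hP' i).1 (hPb i) (hP' i).2
  obtain ⟨G, hG, hJ, hcancel⟩ := exists_edge_forms hsymm' hgen
  -- This provides the n_i negative directions for l in the inertia count.
  have hT : ∀ i (l : Fin (S.n i) → ℝ), l ≠ 0 →
      Sum.elim l 0 ⬝ᵥ flipScale (α i) (dataBar d (ν i))⁻¹ *ᵥ Sum.elim l 0 < 0 := by
    intro i l hl
    have h := inv_pos_right (hD i) (hinv i) (hDneg i) (M₀ i).mat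
      (dataBar_nonneg_of_consistent d (hM₀ i)) l hl
    have h' : Sum.elim (0 : RegIdx S i → ℝ) l ⬝ᵥ (dataBar d (ν i))⁻¹ *ᵥ Sum.elim 0 l =
        l ⬝ᵥ ((dataBar d (ν i))⁻¹).toBlocks₂₂ *ᵥ l := by
      conv_lhs => rw [← fromBlocks_toBlocks (dataBar d (ν i))⁻¹]
      rw [fromBlocks_mulVec, sumElim_dotProduct_sumElim]
      simp
    rw [flipScale_form _ (hDi i), h']
    exact neg_neg_of_pos (mul_pos (hα i) h)
  choose Θ hΘ using fun i => exists_local_controller (O i) (hα i).ne' (pow_pos hγ 2) (hD i)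
    (hinv i) (hGP i) (hGPpos i) (fun j => hG i j.1 j.2) (hT i) (fun j => hJ i j.1 j.2)
    (hprimal' i) (hdual' i)
  have hM : ∀ M : (i : Fin L) → Subsystem S i, (∀ i, M i ∈ consistent d (ν i)) → ∀ i p,
      0 ≤ Sum.elim ((M i).mat *ᵥ p) p ⬝ᵥ flipScale (α i) (dataBar d (ν i))⁻¹ *ᵥ
        Sum.elim ((M i).mat *ᵥ p) p := by
    intro M hM i p
    have h := inv_nonpos_graph (hD i) (hinv i) (hDneg i) (M i).mat
      (dataBar_nonneg_of_consistent d (hM i)) p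
    rw [flipScale_form _ (hDi i)]
    exact neg_nonneg.2 (mul_nonpos_of_nonneg_of_nonpos (hα i).le h)
  -- Well-posedness concerns Θ alone, so a single consistent plant suffices.
  have hwp : Controller.WellPosed Θ := wellPosed_of_dissipation hGPpos hcancel hΘ (hM M₀ hM₀)
  exact ⟨Θ, hwp, fun M hMc => achievesHinf_of_local (fun i => (hGP i).symm) hGPpos hcancel hγ hwp
    hΘ (hM M hMc)⟩
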